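/- Assume that all non-trivial zeros of the Riemann zeta function are simple. For a positive integer $r$ let $\sigma_r(n)=\sum_{d\mid n}d^r$ and let $\sigma_r^{-1}$ be its inverse under Dirichlet convolution. There is a constant $A_0>0$ such that the following holds. Group the non-trivial zeros $\rho$ of $\zeta(s)$ into brackets, putting $\rho_1$ and $\rho_2$ into the same bracket whenever $$|\operatorname{Im}\rho_1-\operatorname{Im}\rho_2|<\exp\left(-\frac{A_0|\operatorname{Im}\rho_1|}{\log|\operatorname{Im}\rho_1|}\right)+\exp\left(-\frac{A_0|\operatorname{Im}\rho_2|}{\log|\operatorname{Im}\rho_2|}\right)$$ (the brackets are the classes of the equivalence relation generated by this condition); all brackets are finite. Let $r$ be an odd positive integer and let $\alpha,\beta>0$ satisfy $\alpha\beta=4\pi^2$. Then all the series below converge and $$\alpha^{\frac{r+1}{2}}\sum_{n=1}^{\infty}\frac{\sigma_r^{-1}(n)}{n^{r+1}}e^{-\alpha/n}-(-\beta)^{\frac{r+1}{2}}\sum_{n=1}^{\infty}\frac{\sigma_r^{-1}(n)}{n^{r+1}}e^{-\beta/n}$$ $$=2\alpha^{\frac{r-1}{2}}\sum_{m=1}^{\lfloor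 r/2\rfloor}\frac{(-1)^m}{\zeta(r-2m)\zeta(2m+1)}\left(\frac{\beta}{2\pi}\right)^{2m}+\alpha^{-\frac{r+1}{2}}\sum_{\rho}\frac{\alpha^{\rho}}{\zeta'(\rho)}\left[\frac{\Gamma(r+1-\rho)}{\zeta(\rho-r)}+\frac{\alpha^{r}\,\Gamma(1-\rho)}{\zeta(r+\rho)}\right],$$ where $1/\zeta(1)$ is read as $0$, and the sum over the non-trivial zeros $\rho$ of $\zeta(s)$ is the limit, as $T\to\infty$, of the sum over all brackets contained in $\{|\operatorname{Im}\rho|<T\}$. -/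

import Mathlib

open Filter Topology

noncomputable section

/-- The Dirichlet inverse of the divisor function `σ_r`, as a complex-valued arithmetic function. -/
def sigmaInv (r : ℕ) : ArithmeticFunction ℂ :=
  ArithmeticFunction.dirichletInverse (ArithmeticFunction.sigma r : ArithmeticFunction ℂ)
    (invertibleOne.copy _ (by simp))

theorem sigma_mul_sigmaInv (r : ℕ) :
    (ArithmeticFunction.sigma r : ArithmeticFunction ℂ) * sigmaInv r = 1 :=
  ArithmeticFunction.self_mul_dirichletInverse _ _

/-- The reciprocal of the Riemann zeta function, extended analytically to `1`: since `ζ` has a pole at `1`,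
`1 / ζ(1)` is `0` (Mathlib assigns a nonzero finite value to `riemannZeta 1`). -/
def zetaRecip (s : ℂ) : ℂ := if s = 1 then 0 else 1 / riemannZeta s

/-- The non-trivial zeros of the Riemann zeta function: those in the open critical strip. -/
def nontrivialZeros : Set ℂ := {ρ | riemannZeta ρ = 0 ∧ 0 < ρ.re ∧ ρ.re < 1}

/-- `exp (-A |γ| / log |γ|)` where `γ` is the ordinate of `ρ`. -/
def bracketRadius (A : ℝ) (ρ : ℂ) : ℝ := Real.exp (-(A * |ρ.im|) / Real.log |ρ.im|)

/-- The bracketing condition for two non-trivial zeros. -/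
def BracketClose (A : ℝ) (ρ₁ ρ₂ : nontrivialZeros) : Prop :=
  |(ρ₁ : ℂ).im - (ρ₂ : ℂ).im| < bracketRadius A ρ₁ + bracketRadius A ρ₂

/-- The bracket of a non-trivial zero: its class for the equivalence relation generated by the
bracketing condition. -/
def bracket (A : ℝ) (ρ : nontrivialZeros) : Set nontrivialZeros :=
  {ρ' | Relation.EqvGen (BracketClose A) ρ ρ'}

/-- The non-trivial zeros whose whole bracket has ordinates of absolute value less than `T`. -/
def zerosInBracketsBelow (A T : ℝ) : Set ℂ :=
  {ρ | ∃ h : ρ ∈ nontrivialZeros, ∀ ρ' ∈ bracket A ⟨ρ, h⟩, |(ρ' : ℂ).im| < T}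

theorem finite_zerosInBracketsBelow (A T : ℝ) : (zerosInBracketsBelow A T).Finite := by
  have hc : IsCompact (Set.Icc (0 : ℝ) 1 ×ℂ Set.Icc (-T) T) :=
    isCompact_Icc.reProdIm isCompact_Icc
  refine hc.inter_riemannZetaZeros_finite.subset ?_
  rintro ρ ⟨h, hT⟩
  have h1 := abs_lt.mp (hT ⟨ρ, h⟩ (Relation.EqvGen.refl _))
  exact ⟨⟨⟨h.2.1.le, h.2.2.le⟩, ⟨h1.1.le, h1.2.le⟩⟩, h.1⟩

/-- The partial sum, over all complete brackets below height `T`, of a series over the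
non-trivial zeros. -/
def bracketedPartialSum (A : ℝ) (f : ℂ → ℂ) (T : ℝ) : ℂ :=
  ∑ ρ ∈ (finite_zerosInBracketsBelow A T).toFinset, f ρ

/-- `f` is summable over the non-trivial zeros with sum `Z`, the terms being bracketed with the
constant `A` and the brackets being taken in order of increasing height: every bracket is a finite
set, and the sums over all complete brackets below height `T` converge to `Z` as `T → ∞`. -/
def HasBracketedSum (A : ℝ) (f : ℂ → ℂ) (Z : ℂ) : Prop :=
  (∀ ρ : nontrivialZeros, (bracket A ρ).Finite) ∧
    Tendsto (bracketedPartialSum A f) atTop (𝓝 Z)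

/-- `S` is the sum of the convergent (possibly only conditionally) series
`∑_{n ≥ 1} σ_r⁻¹(n) n^{-(r+1)} exp(-x / n)`. -/
def HasSigmaInvSum (r : ℕ) (x : ℝ) (S : ℂ) : Prop :=
  Tendsto (fun N : ℕ => ∑ n ∈ Finset.Icc 1 N,
    sigmaInv r n / (n : ℂ) ^ (r + 1) * (Real.exp (-x / n) : ℂ)) atTop (𝓝 S)

/-- The term at a zero `ρ` of the series over the non-trivial zeros. -/
def zeroTerm (r : ℕ) (x : ℝ) (ρ : ℂ) : ℂ :=
  (x : ℂ) ^ ρ / deriv riemannZeta ρ *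
    (Complex.Gamma (r + 1 - ρ) / riemannZeta (ρ - r)
      + (x : ℂ) ^ r * Complex.Gamma (1 - ρ) / riemannZeta (r + ρ))

end

/-! Write r = 2k + 1. Mellin inversion on Re s = -1/2 represents e^{-y} - 1 by Γ(s)
(`expNegSubOne_eq_integral`). Putting y = x/n and summing against σ_r⁻¹(n)/n^{r+1}, whose Dirichlet
series is a product of two reciprocal zeta values, turns the series into the integral of Γ(s) x^{-s}
/ (ζ(r+1-s) ζ(1-s)) over that line, divided by 2πi. The subtracted constant 1 costs nothing because
∑ σ_r⁻¹(n)/n^{r+1} = 0 (`tendsto_sum_sigmaInv_div`). That fact has the depth of the prime number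
theorem: it follows from ∑ μ(n)/n = 0 (`tendsto_moebiusSum`), proved by a Tauberian argument from
the non-vanishing of ζ on Re s = 1.

By the functional equation the integrand equals (2π/x)^s / (2 cos(πs/2) ζ(s) ζ(r+1-s)), called
`cosKernel`. For odd r the reflection s ↦ r+1-s carries the kernel of α to that of β up to an
explicit factor (`cosKernel_one_add_sub`), so the integrals over Re s = -1/2 and Re s = r + 3/2 give
the α-series and the β-series. Their difference is the sum of the residues in between
(`rectIntegral_cosKernel`): the odd integers, where the cosine vanishes, give the finite sum, and
the points 1-ρ and r+1-ρ give the two terms of the series over zeros.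

The horizontal edges must tend to 0, which needs lower bounds for |ζ| at suitable heights. Near
height T there are O(log T) zeros (Jensen), and a Blaschke quotient with Borel–Carathéodory bounds
|ζ| below by the product of the distances to them. If every zero stays at least exp(-A|γ|/log|γ|)
away from the edge in ordinate, this product is at least e^{-εT} once A is small
(`exists_le_norm_riemannZeta`), and the decay of 1/cos wins. Such heights exist in every interval
[T-1, T] with T large, and they separate brackets. Conversely, the zeros in complete brackets below
T are exactly the zeros below some such height (`eventually_zerosInBracketsBelow_eq`), so the
bracketed partial sums are residue sums of admissible rectangles. -/

/-! ### Rectangle integrals and the residue theorem for simple poles. -/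

/-- The integral of `f` over the boundary of `[a, b] × [c, d]`, counterclockwise. -/
noncomputable def rectIntegral (f : ℂ → ℂ) (a b c d : ℝ) : ℂ :=
  (∫ x in a..b, f (x + c * Complex.I)) - (∫ x in a..b, f (x + d * Complex.I))
    + Complex.I * (∫ y in c..d, f (b + y * Complex.I))
    - Complex.I * (∫ y in c..d, f (a + y * Complex.I))

/-- The points of the boundary of the rectangle `[a, b] × [c, d]`. -/
def rectBoundary (a b c d : ℝ) : Set ℂ :=
  (Set.Icc a b ×ℂ Set.Icc c d) \ (Set.Ioo a b ×ℂ Set.Ioo c d)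

theorem rectIntegral_eq_zero {f : ℂ → ℂ} {a b c d : ℝ} (hab : a ≤ b) (hcd : c ≤ d)
    (hf : DifferentiableOn ℂ f (Set.Icc a b ×ℂ Set.Icc c d)) : rectIntegral f a b c d = 0 := by
  have := Complex.integral_boundary_rect_eq_zero_of_differentiableOn f ⟨a, c⟩ ⟨b, d⟩
    (by simpa [Set.uIcc_of_le hab, Set.uIcc_of_le hcd] using hf)
  simpa [rectIntegral] using this

theorem mem_rectBoundary_bottom {a b c d x : ℝ} (hcd : c ≤ d) (hx : x ∈ Set.Icc a b) :
    (x + c * Complex.I : ℂ) ∈ rectBoundary a b c d := by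
  simp [rectBoundary, Complex.mem_reProdIm, hcd, hx.1, hx.2]

theorem mem_rectBoundary_top {a b c d x : ℝ} (hcd : c ≤ d) (hx : x ∈ Set.Icc a b) :
    (x + d * Complex.I : ℂ) ∈ rectBoundary a b c d := by
  simp [rectBoundary, Complex.mem_reProdIm, hcd, hx.1, hx.2]

theorem mem_rectBoundary_right {a b c d y : ℝ} (hab : a ≤ b) (hy : y ∈ Set.Icc c d) :
    (b + y * Complex.I : ℂ) ∈ rectBoundary a b c d := by
  simp [rectBoundary, Complex.mem_reProdIm, hab, hy.1, hy.2]

theorem mem_rectBoundary_left {a b c d y : ℝ} (hab : a ≤ b) (hy : y ∈ Set.Icc c d) :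
    (a + y * Complex.I : ℂ) ∈ rectBoundary a b c d := by
  simp [rectBoundary, Complex.mem_reProdIm, hab, hy.1, hy.2]

theorem rectIntegral_congr {f g : ℂ → ℂ} {a b c d : ℝ} (hab : a ≤ b) (hcd : c ≤ d)
    (h : Set.EqOn f g (rectBoundary a b c d)) : rectIntegral f a b c d = rectIntegral g a b c d := by
  unfold rectIntegral
  congr 1
  · congr 1
    · congr 1
      · refine intervalIntegral.integral_congr fun x hx => h (mem_rectBoundary_bottom hcd ?_)
        rwa [Set.uIcc_of_le hab] at hx
      · refine intervalIntegral.integral_congr fun x hx => h (mem_rectBoundary_top hcd ?_)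
        rwa [Set.uIcc_of_le hab] at hx
    · congr 1
      refine intervalIntegral.integral_congr fun x hx => h (mem_rectBoundary_right hab ?_)
      rwa [Set.uIcc_of_le hcd] at hx
  · congr 1
    refine intervalIntegral.integral_congr fun x hx => h (mem_rectBoundary_left hab ?_)
    rwa [Set.uIcc_of_le hcd] at hx

theorem rectIntegral_add {f g : ℂ → ℂ} {a b c d : ℝ} (hab : a ≤ b) (hcd : c ≤ d)
    (hf : ContinuousOn f (rectBoundary a b c d)) (hg : ContinuousOn g (rectBoundary a b c d)) :
    rectIntegral (fun z => f z + g z) a b c d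
      = rectIntegral f a b c d + rectIntegral g a b c d := by
  have key : ∀ {f : ℂ → ℂ}, ContinuousOn f (rectBoundary a b c d) →
      IntervalIntegrable (fun x : ℝ => f (x + c * Complex.I)) MeasureTheory.volume a b ∧
      IntervalIntegrable (fun x : ℝ => f (x + d * Complex.I)) MeasureTheory.volume a b ∧
      IntervalIntegrable (fun y : ℝ => f (b + y * Complex.I)) MeasureTheory.volume c d ∧
      IntervalIntegrable (fun y : ℝ => f (a + y * Complex.I)) MeasureTheory.volume c d := by
    intro f hf
    refine ⟨?_, ?_, ?_, ?_⟩ <;> apply ContinuousOn.intervalIntegrable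
    · rw [Set.uIcc_of_le hab]
      exact hf.comp (by fun_prop) fun x hx => mem_rectBoundary_bottom hcd hx
    · rw [Set.uIcc_of_le hab]
      exact hf.comp (by fun_prop) fun x hx => mem_rectBoundary_top hcd hx
    · rw [Set.uIcc_of_le hcd]
      exact hf.comp (by fun_prop) fun x hx => mem_rectBoundary_right hab hx
    · rw [Set.uIcc_of_le hcd]
      exact hf.comp (by fun_prop) fun x hx => mem_rectBoundary_left hab hx
  obtain ⟨f1, f2, f3, f4⟩ := key hf
  obtain ⟨g1, g2, g3, g4⟩ := key hg
  unfold rectIntegral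
  rw [intervalIntegral.integral_add f1 g1, intervalIntegral.integral_add f2 g2,
    intervalIntegral.integral_add f3 g3, intervalIntegral.integral_add f4 g4]
  ring

theorem rectIntegral_const_mul (k : ℂ) (f : ℂ → ℂ) (a b c d : ℝ) :
    rectIntegral (fun z => k * f z) a b c d = k * rectIntegral f a b c d := by
  simp only [rectIntegral, intervalIntegral.integral_const_mul]
  ring

/-- The principal logarithm of z - p is a primitive on the bottom, right and top edges. The left
edge crosses its branch cut, so log(-(z - p)) is used there. The two branches differ by πi with
opposite signs at the two left corners, which produces 2πi. -/
theorem rectIntegral_inv_sub {p : ℂ} {a b c d : ℝ} (hp : p ∈ Set.Ioo a b ×ℂ Set.Ioo c d) :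
    rectIntegral (fun z => (z - p)⁻¹) a b c d = 2 * Real.pi * Complex.I := by
  obtain ⟨⟨ha, hb⟩, hc, hd⟩ := Complex.mem_reProdIm.1 hp
  have h1 : ∫ x in a..b, ((x + c * Complex.I : ℂ) - p)⁻¹
      = Complex.log (b + c * Complex.I - p) - Complex.log (a + c * Complex.I - p) := by
    refine intervalIntegral.integral_eq_sub_of_hasDerivAt
      (f := fun x : ℝ => Complex.log (x + c * Complex.I - p)) (fun x _ => ?_) ?_
    · have : HasDerivAt (fun x : ℝ => (x + c * Complex.I - p : ℂ)) 1 x :=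
        ((Complex.ofRealCLM.hasDerivAt (x := x)).add_const _).sub_const _
      simpa using this.clog_real (Complex.mem_slitPlane_iff.2 (Or.inr (by simp; linarith)))
    · refine ContinuousOn.intervalIntegrable (ContinuousOn.inv₀ (by fun_prop) fun x _ h => ?_)
      have := congrArg Complex.im h
      simp at this; linarith
  have h2 : ∫ x in a..b, ((x + d * Complex.I : ℂ) - p)⁻¹
      = Complex.log (b + d * Complex.I - p) - Complex.log (a + d * Complex.I - p) := by
    refine intervalIntegral.integral_eq_sub_of_hasDerivAt
      (f := fun x : ℝ => Complex.log (x + d * Complex.I - p)) (fun x _ => ?_) ?_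
    · have : HasDerivAt (fun x : ℝ => (x + d * Complex.I - p : ℂ)) 1 x :=
        ((Complex.ofRealCLM.hasDerivAt (x := x)).add_const _).sub_const _
      simpa using this.clog_real (Complex.mem_slitPlane_iff.2 (Or.inr (by simp; linarith)))
    · refine ContinuousOn.intervalIntegrable (ContinuousOn.inv₀ (by fun_prop) fun x _ h => ?_)
      have := congrArg Complex.im h
      simp at this; linarith
  have h3 : Complex.I * ∫ y in c..d, ((b + y * Complex.I : ℂ) - p)⁻¹
      = Complex.log (b + d * Complex.I - p) - Complex.log (b + c * Complex.I - p) := by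
    rw [← intervalIntegral.integral_const_mul]
    refine intervalIntegral.integral_eq_sub_of_hasDerivAt
      (f := fun y : ℝ => Complex.log (b + y * Complex.I - p)) (fun x _ => ?_) ?_
    · have : HasDerivAt (fun y : ℝ => (b + y * Complex.I - p : ℂ)) (1 * Complex.I) x :=
        (((Complex.ofRealCLM.hasDerivAt (x := x)).mul_const _).const_add _).sub_const _
      simpa [div_eq_mul_inv] using
        this.clog_real (Complex.mem_slitPlane_iff.2 (Or.inl (by simp; linarith)))
    · refine ContinuousOn.intervalIntegrable (ContinuousOn.mul (by fun_prop)
        (ContinuousOn.inv₀ (by fun_prop) fun x _ h => ?_))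
      have := congrArg Complex.re h
      simp at this; linarith
  have h4 : Complex.I * ∫ y in c..d, ((a + y * Complex.I : ℂ) - p)⁻¹
      = Complex.log (-(a + d * Complex.I - p)) - Complex.log (-(a + c * Complex.I - p)) := by
    rw [← intervalIntegral.integral_const_mul]
    refine intervalIntegral.integral_eq_sub_of_hasDerivAt
      (f := fun y : ℝ => Complex.log (-(a + y * Complex.I - p))) (fun x _ => ?_) ?_
    · have : HasDerivAt (fun y : ℝ => (-(a + y * Complex.I - p) : ℂ)) (-(1 * Complex.I)) x :=
        ((((Complex.ofRealCLM.hasDerivAt (x := x)).mul_const _).const_add _).sub_const _).neg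
      have := this.clog_real (Complex.mem_slitPlane_iff.2 (Or.inl (by simp; linarith)))
      rw [neg_div_neg_eq] at this
      simpa [div_eq_mul_inv] using this
    · refine ContinuousOn.intervalIntegrable (ContinuousOn.mul (by fun_prop)
        (ContinuousOn.inv₀ (by fun_prop) fun x _ h => ?_))
      have := congrArg Complex.re h
      simp at this; linarith
  have h5 : Complex.log (-(a + d * Complex.I - p))
      = Complex.log (a + d * Complex.I - p) - Real.pi * Complex.I := by
    simp only [Complex.log, norm_neg]
    rw [Complex.arg_neg_eq_arg_sub_pi_of_im_pos (by simp; linarith)]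
    push_cast; ring
  have h6 : Complex.log (-(a + c * Complex.I - p))
      = Complex.log (a + c * Complex.I - p) + Real.pi * Complex.I := by
    simp only [Complex.log, norm_neg]
    rw [Complex.arg_neg_eq_arg_add_pi_of_im_neg (by simp; linarith)]
    push_cast; ring
  simp only [rectIntegral, h1, h2, h3, h4, h5, h6]
  ring

/-- Induction on the set of poles: subtracting res p / (z - p) leaves a function that is o(1/(z -
p)) at p, hence has a removable singularity there, and the subtracted term integrates to 2πi res p.
-/
theorem rectIntegral_eq_sum_residues {a b c d : ℝ} (hab : a < b) (hcd : c < d) {U : Set ℂ}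
    (hU : IsOpen U) (hsub : Set.Icc a b ×ℂ Set.Icc c d ⊆ U) (P : Finset ℂ) (f res : ℂ → ℂ)
    (hP : ∀ p ∈ P, p ∈ Set.Ioo a b ×ℂ Set.Ioo c d)
    (hf : DifferentiableOn ℂ f (U \ P))
    (hres : ∀ p ∈ P, Tendsto (fun z => (z - p) * f z) (𝓝[≠] p) (𝓝 (res p))) :
    rectIntegral f a b c d = 2 * Real.pi * Complex.I * ∑ p ∈ P, res p := by
  classical
  induction P using Finset.induction_on generalizing f with
  | empty =>
    simpa using rectIntegral_eq_zero hab.le hcd.le (hf.mono (by simpa using hsub))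
  | insert p P hpP ih =>
    have hpR := hP p (Finset.mem_insert_self _ _)
    have hpU : p ∈ U := hsub ⟨⟨hpR.1.1.le, hpR.1.2.le⟩, hpR.2.1.le, hpR.2.2.le⟩
    have hbd : ∀ z ∈ rectBoundary a b c d, z ∉ Set.Ioo a b ×ℂ Set.Ioo c d := fun z hz => hz.2
    set g : ℂ → ℂ := fun z => f z - res p * (z - p)⁻¹ with hg
    set F := Function.update g p (limUnder (𝓝[≠] p) g) with hF
    have hV : IsOpen (U \ P) := hU.sdiff P.finite_toSet.isClosed
    have hpV : p ∈ U \ P := ⟨hpU, by simpa using hpP⟩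
    have hgd : DifferentiableOn ℂ g ((U \ P) \ {p}) := by
      refine DifferentiableOn.sub (hf.mono ?_) ?_
      · rintro z ⟨⟨h1, h2⟩, h3⟩
        refine ⟨h1, ?_⟩
        simp only [Finset.coe_insert, Set.mem_insert_iff, not_or]
        exact ⟨h3, h2⟩
      · refine DifferentiableOn.const_mul (DifferentiableOn.inv (by fun_prop) ?_) _
        rintro z ⟨-, h3⟩
        exact sub_ne_zero.2 h3
    have hFd : DifferentiableOn ℂ F (U \ P) := by
      refine Complex.differentiableOn_update_limUnder_of_isLittleO (hV.mem_nhds hpV) hgd ?_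
      have hne : ∀ᶠ z in 𝓝[≠] p, z - p ≠ 0 :=
        eventually_nhdsWithin_of_forall fun z hz => sub_ne_zero.2 hz
      rw [Asymptotics.isLittleO_iff_tendsto' (hne.mono fun z hz h => absurd h (inv_ne_zero hz))]
      have h0 : Tendsto (fun z : ℂ => z - p) (𝓝[≠] p) (𝓝 0) := by
        have : Tendsto (fun z : ℂ => z - p) (𝓝 p) (𝓝 (p - p)) :=
          (continuous_id.sub continuous_const).tendsto p
        rw [sub_self] at this
        exact this.mono_left nhdsWithin_le_nhds
      have := ((hres p (Finset.mem_insert_self _ _)).sub_const (res p)).sub (h0.mul_const (g p))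
      rw [sub_self, zero_mul, sub_zero] at this
      refine this.congr' (hne.mono fun z hz => ?_)
      simp only [hg]
      field_simp
    have hFg : ∀ z, z ≠ p → F z = g z := fun z hz => Function.update_of_ne hz _ _
    have h1 := ih F (fun q hq => hP q (Finset.mem_insert_of_mem hq)) hFd ?_
    · have hnp : ∀ z ∈ rectBoundary a b c d, z ≠ p := fun z hz h => hbd z hz (h ▸ hpR)
      have h2 : rectIntegral f a b c d
          = rectIntegral (fun z => F z + res p * (z - p)⁻¹) a b c d := by
        refine rectIntegral_congr hab.le hcd.le fun z hz => ?_
        simp only [hFg z (hnp z hz), hg]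
        ring
      rw [h2, rectIntegral_add hab.le hcd.le, h1, rectIntegral_const_mul, rectIntegral_inv_sub hpR,
        Finset.sum_insert hpP]
      · ring
      · refine hFd.continuousOn.mono fun z hz => ⟨hsub hz.1, fun hzP => ?_⟩
        exact hbd z hz (hP z (Finset.mem_insert_of_mem hzP))
      · refine ContinuousOn.mul continuousOn_const (ContinuousOn.inv₀ (by fun_prop) ?_)
        exact fun z hz => sub_ne_zero.2 (hnp z hz)
    · intro q hq
      have hqp : q ≠ p := fun h => hpP (h ▸ hq)
      have h3 : Tendsto (fun z : ℂ => (z - q) * (res p * (z - p)⁻¹)) (𝓝[≠] q) (𝓝 0) := by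
        have : ContinuousAt (fun z : ℂ => (z - q) * (res p * (z - p)⁻¹)) q :=
          ContinuousAt.mul (by fun_prop)
            (ContinuousAt.mul (by fun_prop) (ContinuousAt.inv₀ (by fun_prop) (sub_ne_zero.2 hqp)))
        have := this.tendsto
        simp only [sub_self, zero_mul] at this
        exact this.mono_left nhdsWithin_le_nhds
      have := (hres q (Finset.mem_insert_of_mem hq)).sub h3
      rw [sub_zero] at this
      refine this.congr' ?_
      have : ∀ᶠ z in 𝓝[≠] q, z ≠ p :=
        (isOpen_ne.mem_nhds hqp : _ ∈ 𝓝 q) |> fun h => nhdsWithin_le_nhds h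
      filter_upwards [this] with z hz
      rw [hFg z hz]
      simp only [hg]
      ring

/-! ### Zeros and lower bounds of entire functions on discs. -/

theorem Differentiable.exists_eq_mul_prod_sub {f : ℂ → ℂ} (hf : Differentiable ℂ f) (Z : Finset ℂ)
    (hZ : ∀ ρ ∈ Z, f ρ = 0) :
    ∃ g : ℂ → ℂ, Differentiable ℂ g ∧ ∀ z, f z = g z * ∏ ρ ∈ Z, (z - ρ) := by
  classical
  induction Z using Finset.induction_on with
  | empty => exact ⟨f, hf, by simp⟩
  | insert p Z hp ih =>
    obtain ⟨g, hg, hfg⟩ := ih fun ρ hρ => hZ ρ (Finset.mem_insert_of_mem hρ)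
    have hgp : g p = 0 := by
      have := hZ p (Finset.mem_insert_self _ _)
      rw [hfg p, mul_eq_zero, Finset.prod_eq_zero_iff] at this
      refine this.resolve_right ?_
      rintro ⟨q, hq, hpq⟩
      exact hp (by rwa [sub_eq_zero.1 hpq])
    refine ⟨dslope g p, ?_, fun z => ?_⟩
    · rw [← differentiableOn_univ, Complex.differentiableOn_dslope univ_mem]
      exact hg.differentiableOn
    · rw [hfg z, Finset.prod_insert hp]
      have := sub_smul_dslope g p z
      rw [hgp, sub_zero, smul_eq_mul] at this
      rw [← this]
      ring

/-- The factor `(R² - conj ρ z) / R`, of modulus `|z - ρ|` on the circle `|z| = R`. -/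
theorem norm_sq_sub_conj_mul_div {R : ℝ} (hR : 0 < R) (ρ z : ℂ) (hz : ‖z‖ = R) :
    ‖((R : ℂ) ^ 2 - (starRingEnd ℂ) ρ * z) / R‖ = ‖z - ρ‖ := by
  have h1 : (R : ℂ) ^ 2 = (starRingEnd ℂ) z * z := by
    rw [← Complex.normSq_eq_conj_mul_self, Complex.normSq_eq_norm_sq, hz]; push_cast; ring
  rw [h1, ← sub_mul, norm_div, norm_mul, hz, ← map_sub, Complex.norm_conj]
  simp [abs_of_pos hR]
  field_simp

/-- Each factor z - ρ is exchanged for its reflected factor, which has the same modulus on the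
circle of radius R. The bound on the circle therefore passes to h, and the maximum principle carries
it inside. -/
theorem exists_blaschke_quotient {f : ℂ → ℂ} (hf : Differentiable ℂ f) {R M : ℝ}
    (hR : 0 < R) (hM : ∀ z, ‖z‖ = R → ‖f z‖ ≤ M) (Z : Finset ℂ) (hZ : ∀ ρ ∈ Z, f ρ = 0) :
    ∃ g h : ℂ → ℂ, Differentiable ℂ g ∧ Differentiable ℂ h ∧
      (∀ z, f z = g z * ∏ ρ ∈ Z, (z - ρ)) ∧
      (∀ z, h z = g z * ∏ ρ ∈ Z, (((R : ℂ) ^ 2 - (starRingEnd ℂ) ρ * z) / R)) ∧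
      ∀ z, ‖z‖ ≤ R → ‖h z‖ ≤ M := by
  obtain ⟨g, hg, hfg⟩ := hf.exists_eq_mul_prod_sub Z hZ
  have hh : Differentiable ℂ
      (fun z => g z * ∏ ρ ∈ Z, (((R : ℂ) ^ 2 - (starRingEnd ℂ) ρ * z) / R)) := by
    refine hg.mul ?_
    refine Differentiable.fun_finsetProd fun ρ _ => by fun_prop
  refine ⟨g, _, hg, hh, hfg, fun z => rfl, fun z hz => ?_⟩
  refine Complex.norm_le_of_forall_mem_frontier_norm_le (U := Metric.ball 0 R)
    Metric.isBounded_ball hh.diffContOnCl (fun w hw => ?_) ?_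
  · rw [frontier_ball _ hR.ne', mem_sphere_zero_iff_norm] at hw
    have := hM w hw
    rw [hfg w, norm_mul, norm_prod] at this
    rw [norm_mul, norm_prod]
    simpa only [norm_sq_sub_conj_mul_div hR _ w hw] using this
  · rw [closure_ball _ hR.ne']
    simpa using hz

/-- Jensen's inequality: at 0 the exchange of factors replaces each |ρ| ≤ R₁ by R, so every zero
gains a factor of at least R/R₁, while |h 0| ≤ M. -/
theorem card_zeros_mul_log_le {f : ℂ → ℂ} (hf : Differentiable ℂ f) {R R₁ M : ℝ}
    (hR₁ : 0 < R₁) (hR : R₁ < R) (hM : ∀ z, ‖z‖ = R → ‖f z‖ ≤ M) (h0 : f 0 ≠ 0) (Z : Finset ℂ)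
    (hZ : ∀ ρ ∈ Z, f ρ = 0) (hZ₁ : ∀ ρ ∈ Z, ‖ρ‖ ≤ R₁) :
    (Z.card : ℝ) * Real.log (R / R₁) ≤ Real.log (M / ‖f 0‖) := by
  have hR0 := hR₁.trans hR
  obtain ⟨g, h, -, -, hfg, hhg, hhM⟩ := exists_blaschke_quotient hf hR0 hM Z hZ
  have hf0 : 0 < ‖f 0‖ := norm_pos_iff.2 h0
  have h1 : ‖h 0‖ = ‖g 0‖ * R ^ Z.card := by
    rw [hhg]
    simp [abs_of_pos hR0, pow_two, hR0.ne']
  have h2 : ‖f 0‖ ≤ ‖g 0‖ * R₁ ^ Z.card := by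
    rw [hfg, norm_mul, norm_prod]
    refine mul_le_mul_of_nonneg_left ?_ (norm_nonneg _)
    rw [← Finset.prod_const]
    exact Finset.prod_le_prod (fun _ _ => norm_nonneg _) fun ρ hρ => by simpa using hZ₁ ρ hρ
  have h3 := hhM 0 (by simpa using hR0.le)
  rw [h1] at h3
  have h4 : (R / R₁) ^ Z.card ≤ M / ‖f 0‖ := by
    rw [div_pow, div_le_div_iff₀ (by positivity) hf0]
    calc R ^ Z.card * ‖f 0‖ ≤ R ^ Z.card * (‖g 0‖ * R₁ ^ Z.card) := by gcongr
      _ = ‖g 0‖ * R ^ Z.card * R₁ ^ Z.card := by ring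
      _ ≤ M * R₁ ^ Z.card := by gcongr
  rw [← Real.log_pow]
  exact Real.log_le_log (by positivity) h4

/-- A holomorphic function without zeros and bounded by `M` on a disc cannot be small on a smaller
concentric disc. -/
theorem le_norm_of_ne_zero_on_ball {h : ℂ → ℂ} (hh : Differentiable ℂ h) {R₁ R₂ M : ℝ}
    (hR₂ : 0 < R₂) (hR₁ : R₂ < R₁) (hM : ∀ z, ‖z‖ < R₁ → ‖h z‖ ≤ M)
    (hne : ∀ z, ‖z‖ < R₁ → h z ≠ 0) {z : ℂ} (hz : ‖z‖ ≤ R₂) :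
    ‖h 0‖ * Real.exp (-(2 * (Real.log (M / ‖h 0‖) + 1) * R₂ / (R₁ - R₂))) ≤ ‖h z‖ := by
  have hR0 : 0 < R₁ := hR₂.trans hR₁
  have hh0 : 0 < ‖h 0‖ := norm_pos_iff.2 (hne 0 (by simpa using hR0))
  have hd : DifferentiableOn ℂ (fun z => deriv h z / h z) (Metric.ball 0 R₁) := by
    refine DifferentiableOn.div ?_ hh.differentiableOn fun z hz => hne z (by simpa using hz)
    exact (hh.deriv).differentiableOn
  obtain ⟨L, hL0, hL⟩ := hd.isExactOn_ball.with_val_at 0 0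
  have hexp : ∀ w, ‖w‖ < R₁ → h w = h 0 * Complex.exp (L w) := by
    intro w hw
    have hD : ∀ x ∈ Metric.ball (0 : ℂ) R₁,
        HasDerivAt (fun x => h x * Complex.exp (-L x)) 0 x := by
      intro x hx
      have hx' := hne x (by simpa using hx)
      have := (hh x).hasDerivAt.mul ((hL x hx).neg.cexp)
      convert! this using 1
      field_simp
      ring
    have := (Metric.isOpen_ball).is_const_of_deriv_eq_zero
      (convex_ball (0 : ℂ) R₁).isPreconnected
      (fun x hx => (hD x hx).differentiableAt.differentiableWithinAt)
      (fun x hx => (hD x hx).deriv) (x := w) (y := 0) (by simpa using hw) (by simpa using hR0)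
    simp only [hL0, neg_zero, Complex.exp_zero, mul_one] at this
    rw [← this, mul_assoc, ← Complex.exp_add]
    simp
  have hm : 0 ≤ Real.log (M / ‖h 0‖) :=
    Real.log_nonneg ((one_le_div hh0).2 (hM 0 (by simpa using hR0)))
  -- The added 1 makes the bound strictly positive, as Borel–Carathéodory requires; the logarithm
  -- may be 0.
  have hre : Set.MapsTo L (Metric.ball 0 R₁) {w | w.re ≤ Real.log (M / ‖h 0‖) + 1} := by
    intro w hw
    have hw' : ‖w‖ < R₁ := by simpa using hw
    have h1 := hM w hw'
    rw [hexp w hw', norm_mul, Complex.norm_exp] at h1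
    have h2 : Real.exp (L w).re ≤ M / ‖h 0‖ := by rw [le_div_iff₀ hh0]; linarith
    have h3 := Real.log_le_log (Real.exp_pos _) h2
    rw [Real.log_exp] at h3
    simp only [Set.mem_ofPred_eq]
    linarith
  have hzR : ‖z‖ < R₁ := hz.trans_lt hR₁
  have hBC := Complex.borelCaratheodory_zero (by linarith)
    (fun x hx => (hL x hx).differentiableAt.differentiableWithinAt) hre hR0
    (by simpa using hzR) hL0
  rw [hexp z hzR, norm_mul, Complex.norm_exp]
  refine mul_le_mul_of_nonneg_left (Real.exp_le_exp.2 ?_) hh0.le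
  have h5 := (abs_le.1 (Complex.abs_re_le_norm (L z))).1
  have h6 : 2 * (Real.log (M / ‖h 0‖) + 1) * ‖z‖ / (R₁ - ‖z‖)
      ≤ 2 * (Real.log (M / ‖h 0‖) + 1) * R₂ / (R₁ - R₂) := by
    have : 0 < R₁ - R₂ := by linarith
    gcongr
  linarith

/-- Simplicity makes the Blaschke quotient h zero-free on the disc of radius R₁, so
`le_norm_of_ne_zero_on_ball` bounds it below. Going back from h to f exchanges reflected factors,
each at most 2R, for the distances |z - ρ|. -/
theorem norm_mul_prod_le_of_simple_zeros {f : ℂ → ℂ} (hf : Differentiable ℂ f) {R R₁ R₂ M : ℝ}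
    (hR₂ : 0 < R₂) (hR₁ : R₂ < R₁) (hR : R₁ < R) (hM : ∀ z, ‖z‖ = R → ‖f z‖ ≤ M) (h0 : f 0 ≠ 0)
    (Z : Finset ℂ) (hZ : ∀ ρ, ρ ∈ Z ↔ f ρ = 0 ∧ ‖ρ‖ ≤ R₁) (hs : ∀ ρ ∈ Z, deriv f ρ ≠ 0)
    {z : ℂ} (hz : ‖z‖ ≤ R₂) :
    ‖f 0‖ * Real.exp (-(2 * (Real.log (M / ‖f 0‖) + 1) * R₂ / (R₁ - R₂)))
      * ∏ ρ ∈ Z, (‖z - ρ‖ / (2 * R)) ≤ ‖f z‖ := by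
  have hR10 := hR₂.trans hR₁
  have hR0 := hR10.trans hR
  obtain ⟨g, h, hg, hh, hfg, hhg, hhM⟩ :=
    exists_blaschke_quotient hf hR0 hM Z fun ρ hρ => ((hZ ρ).1 hρ).1
  have hf0 : 0 < ‖f 0‖ := norm_pos_iff.2 h0
  -- A zero of g in this disc would be a zero of f that is already divided out, hence a multiple
  -- one.
  have hgne : ∀ w, ‖w‖ ≤ R₁ → g w ≠ 0 := by
    intro w hw hgw
    have hw0 : f w = 0 := by rw [hfg, hgw, zero_mul]
    have hwZ := (hZ w).2 ⟨hw0, hw⟩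
    refine hs w hwZ ?_
    have hD : HasDerivAt f (deriv g w * ∏ ρ ∈ Z, (w - ρ)
        + g w * deriv (fun x => ∏ ρ ∈ Z, (x - ρ)) w) w := by
      have hP : Differentiable ℂ (fun x : ℂ => ∏ ρ ∈ Z, (x - ρ)) :=
        Differentiable.fun_finsetProd fun ρ _ => by fun_prop
      have := (hg w).hasDerivAt.mul (hP w).hasDerivAt
      rwa [show (g * fun x => ∏ ρ ∈ Z, (x - ρ)) = f from (funext hfg).symm] at this
    rw [hD.deriv, hgw, Finset.prod_eq_zero hwZ (sub_self w)]
    simp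
  have hhne : ∀ w, ‖w‖ < R₁ → h w ≠ 0 := by
    intro w hw
    rw [hhg]
    refine mul_ne_zero (hgne w hw.le) (Finset.prod_ne_zero_iff.2 fun ρ hρ => ?_)
    refine div_ne_zero (fun he => ?_) (by exact_mod_cast hR0.ne')
    have h1 := congrArg norm (sub_eq_zero.1 he)
    rw [norm_mul, Complex.norm_conj, norm_pow, Complex.norm_real, Real.norm_eq_abs,
      abs_of_pos hR0] at h1
    have h2 := ((hZ ρ).1 hρ).2
    have : ‖ρ‖ * ‖w‖ ≤ R₁ * R₁ := by gcongr
    nlinarith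
  have hL := le_norm_of_ne_zero_on_ball hh hR₂ hR₁ (fun w hw => hhM w (hw.le.trans hR.le)) hhne hz
  have hh0 : ‖f 0‖ ≤ ‖h 0‖ := by
    rw [hfg, hhg, norm_mul, norm_mul, norm_prod, norm_prod]
    refine mul_le_mul_of_nonneg_left ?_ (norm_nonneg _)
    refine Finset.prod_le_prod (fun _ _ => norm_nonneg _) fun ρ hρ => ?_
    have := ((hZ ρ).1 hρ).2
    simp only [zero_sub, norm_neg, mul_zero, sub_zero, norm_div, norm_pow, Complex.norm_real,
      Real.norm_eq_abs, abs_of_pos hR0]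
    rw [pow_two, mul_div_assoc, div_self hR0.ne', mul_one]
    linarith
  have hM0 : ‖f 0‖ ≤ M := hh0.trans (hhM 0 (by simpa using hR0.le))
  -- The lower bound increases with the value at 0, so ‖h 0‖ may be replaced by the smaller ‖f 0‖.
  have h3 : ‖f 0‖ * Real.exp (-(2 * (Real.log (M / ‖f 0‖) + 1) * R₂ / (R₁ - R₂))) ≤ ‖h z‖ := by
    refine le_trans ?_ hL
    have hd : 0 < R₁ - R₂ := by linarith
    have hMpos : 0 < M := hf0.trans_le hM0
    have hh00 : 0 < M / ‖h 0‖ := div_pos hMpos (hf0.trans_le hh0)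
    gcongr
  have h4 : ∀ ρ ∈ Z, ‖((R : ℂ) ^ 2 - (starRingEnd ℂ) ρ * z) / R‖ ≤ 2 * R := by
    intro ρ hρ
    have := ((hZ ρ).1 hρ).2
    rw [norm_div, Complex.norm_real, Real.norm_eq_abs, abs_of_pos hR0, div_le_iff₀ hR0]
    refine (norm_sub_le _ _).trans ?_
    rw [norm_mul, Complex.norm_conj, norm_pow, Complex.norm_real, Real.norm_eq_abs, abs_of_pos hR0]
    have : ‖ρ‖ * ‖z‖ ≤ R * R := by gcongr <;> linarith
    nlinarith
  have h5 : ‖h z‖ ≤ ‖g z‖ * (2 * R) ^ Z.card := by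
    rw [hhg, norm_mul, norm_prod, ← Finset.prod_const]
    gcongr with ρ hρ
    exact h4 ρ hρ
  calc _ ≤ (‖g z‖ * (2 * R) ^ Z.card) * ∏ ρ ∈ Z, (‖z - ρ‖ / (2 * R)) :=
        mul_le_mul_of_nonneg_right (h3.trans h5)
          (Finset.prod_nonneg fun _ _ => by positivity)
    _ = ‖f z‖ := by
        rw [Finset.prod_div_distrib, Finset.prod_const, hfg z, norm_mul, norm_prod]
        have : (2 * R) ^ Z.card ≠ 0 := by positivity
        field_simp

/-! ### Polynomial growth of (s - 1) ζ(s) in Re s ≥ 1/8. -/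

/-- The fractional part, restricted to `(1, ∞)`. -/
noncomputable def fractTail (x : ℝ) : ℂ := (Set.Ioi (1 : ℝ)).indicator (fun x => ((Int.fract x : ℝ) : ℂ)) x

theorem norm_fractTail_le (x : ℝ) : ‖fractTail x‖ ≤ (Set.Ioi (1 : ℝ)).indicator 1 x := by
  unfold fractTail
  by_cases h : x ∈ Set.Ioi (1 : ℝ)
  · simp only [Set.indicator_of_mem h, Complex.norm_real, Real.norm_eq_abs, Int.abs_fract,
      Pi.one_apply]
    exact (Int.fract_lt_one x).le
  · simp [Set.indicator_of_notMem h]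

theorem measurable_fractTail : Measurable fractTail :=
  (Complex.measurable_ofReal.comp measurable_fract).indicator measurableSet_Ioi

theorem differentiableAt_mellin_fractTail {s : ℂ} (hs : s.re < 0) :
    DifferentiableAt ℂ (mellin fractTail) s := by
  have hle : ∀ x, ‖fractTail x‖ ≤ 1 := fun x => (norm_fractTail_le x).trans
    (Set.indicator_le_self' (fun _ _ => zero_le_one) x)
  refine mellin_differentiableAt_of_isBigO_rpow (a := 0) (b := s.re - 1) ?_ ?_ hs ?_ (by linarith)
  · refine MeasureTheory.LocallyIntegrable.locallyIntegrableOn (fun x => ?_) _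
    refine ⟨Metric.closedBall x 1, Metric.closedBall_mem_nhds x one_pos, ?_⟩
    exact MeasureTheory.Measure.integrableOn_of_bounded (M := 1)
      (isCompact_closedBall x 1).measure_lt_top.ne measurable_fractTail.aestronglyMeasurable
      (Eventually.of_forall hle)
  · simp only [neg_zero, Real.rpow_zero]
    exact Asymptotics.isBigO_of_le _ fun x => by simpa using hle x
  · have h0 : fractTail =ᶠ[𝓝[>] 0] fun _ => (0 : ℂ) := by
      have : Set.Iio (1 : ℝ) ∈ 𝓝[>] (0 : ℝ) := nhdsWithin_le_nhds (Iio_mem_nhds one_pos)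
      filter_upwards [this] with x hx
      exact Set.indicator_of_notMem (by simpa using le_of_lt hx) _
    exact h0.trans_isBigO (Asymptotics.isBigO_zero _ _)

theorem norm_mellin_fractTail_neg_le {s : ℂ} (hs : 0 < s.re) :
    ‖mellin fractTail (-s)‖ ≤ 1 / s.re := by
  have hint : MeasureTheory.IntegrableOn (fun x : ℝ => x ^ (-s.re - 1)) (Set.Ioi 1) :=
    integrableOn_Ioi_rpow_of_lt (by linarith) one_pos
  have hb : ∀ x ∈ Set.Ioi (0 : ℝ), ‖(x : ℂ) ^ (-s - 1) • fractTail x‖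
      ≤ (Set.Ioi (1 : ℝ)).indicator (fun x : ℝ => x ^ (-s.re - 1)) x := by
    intro x hx
    rw [norm_smul, Complex.norm_cpow_eq_rpow_re_of_pos hx]
    have := norm_fractTail_le x
    by_cases h : x ∈ Set.Ioi (1 : ℝ)
    · rw [Set.indicator_of_mem h] at this ⊢
      simp only [Complex.sub_re, Complex.neg_re, Complex.one_re, Pi.one_apply] at this ⊢
      exact mul_le_of_le_one_right (Real.rpow_nonneg (le_of_lt hx) _) this
    · rw [Set.indicator_of_notMem h] at this ⊢
      rw [le_antisymm this (norm_nonneg _), mul_zero]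
  have hint' : MeasureTheory.IntegrableOn
      ((Set.Ioi (1 : ℝ)).indicator (fun x : ℝ => x ^ (-s.re - 1))) (Set.Ioi 0) :=
    (hint.integrable_indicator measurableSet_Ioi).integrableOn
  calc ‖mellin fractTail (-s)‖
      ≤ ∫ x in Set.Ioi (0 : ℝ), (Set.Ioi (1 : ℝ)).indicator (fun x : ℝ => x ^ (-s.re - 1)) x :=
        MeasureTheory.norm_integral_le_of_norm_le hint'
          ((MeasureTheory.ae_restrict_iff' measurableSet_Ioi).2 (Eventually.of_forall hb))
    _ = ∫ x in Set.Ioi (1 : ℝ), x ^ (-s.re - 1) := by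
        rw [MeasureTheory.setIntegral_indicator measurableSet_Ioi]
        congr 2
        ext x; simp only [Set.mem_inter_iff, Set.mem_Ioi]; constructor <;> grind
    _ = 1 / s.re := by
        rw [integral_Ioi_rpow_of_lt (by linarith) one_pos]
        simp

/-- Abel summation gives ζ(s) = s ∫ ⌊t⌋ t^{-s-1} dt over t > 1. Splitting ⌊t⌋ into t minus its
fractional part isolates the pole and leaves an integral that converges for Re s > 0. -/
theorem riemannZeta₁_eq_of_one_lt_re {s : ℂ} (hs : 1 < s.re) :
    riemannZeta₁ s = s - s * (s - 1) * mellin fractTail (-s) := by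
  have hs1 : s ≠ 1 := by rintro rfl; simp at hs
  have hs1' : s - 1 ≠ 0 := sub_ne_zero.2 hs1
  have hsum : (fun n : ℕ => ∑ k ∈ Finset.Icc 1 n, ‖(1 : ℕ → ℂ) k‖)
      =O[atTop] fun n => (n : ℝ) ^ (1 : ℝ) := by
    refine Asymptotics.isBigO_of_le _ fun n => ?_
    simp
  have h1 := LSeries_eq_mul_integral' 1 zero_le_one hs hsum
  rw [LSeries_one_eq_riemannZeta hs] at h1
  have hi1 : MeasureTheory.IntegrableOn (fun t : ℝ => (t : ℂ) ^ (-s)) (Set.Ioi 1) :=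
    integrableOn_Ioi_cpow_of_lt (by simpa using hs) one_pos
  have hi2 : MeasureTheory.IntegrableOn (fun t : ℝ => (t : ℂ) ^ (-s - 1) * ((Int.fract t : ℝ) : ℂ))
      (Set.Ioi 1) := by
    refine MeasureTheory.Integrable.mul_bdd (c := 1)
      (integrableOn_Ioi_cpow_of_lt (a := -s - 1) (by simp; linarith) one_pos) ?_ ?_
    · exact (Complex.measurable_ofReal.comp measurable_fract).aestronglyMeasurable
    · refine Eventually.of_forall fun x => ?_
      simp only [Complex.norm_real, Real.norm_eq_abs, Int.abs_fract]
      exact (Int.fract_lt_one x).le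
  have h2 : ∫ t in Set.Ioi (1 : ℝ), (∑ k ∈ Finset.Icc 1 ⌊t⌋₊, (1 : ℕ → ℂ) k) * (t : ℂ) ^ (-(s + 1))
      = (∫ t in Set.Ioi (1 : ℝ), (t : ℂ) ^ (-s))
        - ∫ t in Set.Ioi (1 : ℝ), (t : ℂ) ^ (-s - 1) * ((Int.fract t : ℝ) : ℂ) := by
    rw [← MeasureTheory.integral_sub hi1 hi2]
    refine MeasureTheory.setIntegral_congr_fun measurableSet_Ioi fun t ht => ?_
    have ht0 : (0 : ℝ) < t := one_pos.trans ht
    have ht0' : (t : ℂ) ≠ 0 := by exact_mod_cast ht0.ne'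
    have h3 : ((⌊t⌋₊ : ℕ) : ℂ) = t - ((Int.fract t : ℝ) : ℂ) := by
      rw [← Int.self_sub_floor]
      have : ((⌊t⌋₊ : ℕ) : ℂ) = ((⌊t⌋ : ℤ) : ℂ) := by
        exact_mod_cast congrArg ((↑) : ℝ → ℂ) (natCast_floor_eq_intCast_floor (R := ℝ) ht0.le)
      rw [this]; push_cast; ring
    simp only [Pi.one_apply, Finset.sum_const, Nat.card_Icc, add_tsub_cancel_right, nsmul_eq_mul,
      mul_one]
    rw [h3, neg_add', sub_mul, Complex.cpow_sub _ _ ht0', Complex.cpow_one]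
    field_simp
  have h4 : mellin fractTail (-s) = ∫ t in Set.Ioi (1 : ℝ), (t : ℂ) ^ (-s - 1) * ((Int.fract t : ℝ) : ℂ) := by
    have : ∀ t : ℝ, (t : ℂ) ^ (-s - 1) • fractTail t
        = (Set.Ioi (1 : ℝ)).indicator (fun t : ℝ => (t : ℂ) ^ (-s - 1) * ((Int.fract t : ℝ) : ℂ)) t := by
      intro t
      by_cases h : t ∈ Set.Ioi (1 : ℝ) <;> simp [fractTail, Set.indicator, h]
    simp only [mellin, this]
    rw [MeasureTheory.setIntegral_indicator measurableSet_Ioi]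
    congr 2
    ext x; simp only [Set.mem_inter_iff, Set.mem_Ioi]; constructor <;> grind
  rw [h2, ← h4, integral_Ioi_cpow_of_lt (by simpa using hs) one_pos,
    riemannZeta_eq_inv_sub_mul hs1] at h1
  have h5 : -s + 1 ≠ 0 := by rw [← neg_ne_zero]; convert hs1' using 1; ring
  have h6 : riemannZeta₁ s = (s - 1) * ((s - 1)⁻¹ * riemannZeta₁ s) := by field_simp
  rw [h6, h1]
  simp only [Complex.ofReal_one, Complex.one_cpow]
  have h7 : (-1 : ℂ) / (-s + 1) = 1 / (s - 1) := by rw [div_eq_div_iff h5 hs1']; ring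
  rw [h7]
  field_simp

theorem riemannZeta₁_eq {s : ℂ} (hs : 0 < s.re) :
    riemannZeta₁ s = s - s * (s - 1) * mellin fractTail (-s) := by
  have hopen : IsOpen {z : ℂ | 0 < z.re} := isOpen_lt continuous_const Complex.continuous_re
  have hconv : Convex ℝ {z : ℂ | 0 < z.re} := convex_halfSpace_re_gt 0
  have hd : DifferentiableOn ℂ (fun s : ℂ => s - s * (s - 1) * mellin fractTail (-s))
      {z : ℂ | 0 < z.re} := by
    intro z hz
    have h1 : DifferentiableAt ℂ (fun s : ℂ => mellin fractTail (-s)) z :=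
      DifferentiableAt.comp (g := mellin fractTail) z
        (differentiableAt_mellin_fractTail (by simpa using hz)) differentiableAt_id.neg
    exact (differentiableAt_id.sub (DifferentiableAt.mul (by fun_prop) h1)).differentiableWithinAt
  refine (differentiable_riemannZeta₁.differentiableOn.analyticOnNhd
    hopen).eqOn_of_preconnected_of_eventuallyEq (hd.analyticOnNhd hopen) hconv.isPreconnected
    (z₀ := 2) (by simp) ?_ hs
  have : {z : ℂ | 1 < z.re} ∈ 𝓝 (2 : ℂ) :=
    (isOpen_lt continuous_const Complex.continuous_re).mem_nhds (by simp)
  filter_upwards [this] with z hz using riemannZeta₁_eq_of_one_lt_re hz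

/-- The abscissa 1/8 is the leftmost point of the discs of radius 15/8 centred at 2 + iT to which
the bound is applied. -/
theorem norm_riemannZeta₁_le {s : ℂ} (hs : 1 / 8 ≤ s.re) :
    ‖riemannZeta₁ s‖ ≤ 9 * (‖s‖ + 1) ^ 2 := by
  have h0 : 0 < s.re := by linarith
  rw [riemannZeta₁_eq h0]
  have h1 : ‖mellin fractTail (-s)‖ ≤ 8 :=
    (norm_mellin_fractTail_neg_le h0).trans (by rw [div_le_iff₀ h0]; linarith)
  have h2 : ‖s - 1‖ ≤ ‖s‖ + 1 := (norm_sub_le _ _).trans (by simp)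
  calc _ ≤ ‖s‖ + ‖s‖ * ‖s - 1‖ * ‖mellin fractTail (-s)‖ :=
        (norm_sub_le _ _).trans (by rw [norm_mul, norm_mul])
    _ ≤ ‖s‖ + ‖s‖ * (‖s‖ + 1) * 8 := by gcongr
    _ ≤ _ := by nlinarith [norm_nonneg s]

/-! ### Estimates for the Gamma function. -/

/-- In Euler's product the powers of n and the factorials balance, and factor by factor |σ + j + it|
/ (σ + j) decreases in σ. -/
theorem norm_GammaSeq_mul_le {σ σ' : ℝ} (t : ℝ) (hσ : 0 < σ) (h : σ ≤ σ') (n : ℕ) :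
    ‖Complex.GammaSeq (σ + t * Complex.I) n‖ * Real.GammaSeq σ' n
      ≤ ‖Complex.GammaSeq (σ' + t * Complex.I) n‖ * Real.GammaSeq σ n := by
  rcases Nat.eq_zero_or_pos n with rfl | hn
  · have h1 : (σ : ℂ) + t * Complex.I ≠ 0 := fun h0 => by
      have := congrArg Complex.re h0; simp at this; linarith
    simp [Complex.GammaSeq, Real.GammaSeq, hσ.ne', (hσ.trans_le h).ne', h1]
  have hn' : (0 : ℝ) < n := by exact_mod_cast hn
  have key : ∏ j ∈ Finset.range (n + 1), (‖(σ' + t * Complex.I + j : ℂ)‖ * (σ + j))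
      ≤ ∏ j ∈ Finset.range (n + 1), (‖(σ + t * Complex.I + j : ℂ)‖ * (σ' + j)) := by
    refine Finset.prod_le_prod (fun j _ => by positivity) fun j _ => ?_
    have hj : (0 : ℝ) ≤ j := Nat.cast_nonneg j
    have e : ∀ x : ℝ, ‖(x + t * Complex.I + j : ℂ)‖ ^ 2 = (x + j) ^ 2 + t ^ 2 := by
      intro x
      rw [← Complex.normSq_eq_norm_sq, Complex.normSq_apply]
      simp; ring
    have hσ' := hσ.trans_le h
    refine (sq_le_sq₀ (by positivity) (by positivity)).1 ?_
    rw [mul_pow, mul_pow, e, e]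
    have : (σ + j) ^ 2 ≤ (σ' + j) ^ 2 := by gcongr
    nlinarith [sq_nonneg t]
  simp only [Complex.GammaSeq, Real.GammaSeq, norm_div, norm_mul, norm_prod]
  rw [Complex.norm_natCast_cpow_of_pos hn, Complex.norm_natCast_cpow_of_pos hn]
  simp only [Complex.add_re, Complex.ofReal_re, Complex.mul_re, Complex.I_re, mul_zero,
    Complex.ofReal_im, Complex.I_im, mul_one, sub_self, add_zero, Complex.norm_natCast]
  have hp : ∀ x : ℝ, 0 < x → 0 < ∏ j ∈ Finset.range (n + 1), ‖(x + t * Complex.I + j : ℂ)‖ := by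
    intro x hx
    refine Finset.prod_pos fun j _ => norm_pos_iff.2 fun h0 => ?_
    have := congrArg Complex.re h0; simp at this
    have hj : (0 : ℝ) ≤ j := Nat.cast_nonneg j
    linarith
  have hq : ∀ x : ℝ, 0 < x → 0 < ∏ j ∈ Finset.range (n + 1), (x + j : ℝ) :=
    fun x hx => Finset.prod_pos fun j _ => by positivity
  rw [Finset.prod_mul_distrib, Finset.prod_mul_distrib] at key
  have h1 := hp σ hσ
  have h2 := hp σ' (hσ.trans_le h)
  have h3 := hq σ hσ
  have h4 := hq σ' (hσ.trans_le h)
  rw [div_mul_div_comm, div_mul_div_comm, div_le_div_iff₀ (by positivity) (by positivity)]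
  have : 0 ≤ (n : ℝ) ^ σ * (n.factorial : ℝ) * ((n : ℝ) ^ σ' * (n.factorial : ℝ)) := by positivity
  nlinarith [mul_le_mul_of_nonneg_left key this]

/-- For fixed `t`, the quotient `|Γ(σ + it)| / Γ(σ)` increases with `σ > 0`. -/
theorem norm_Gamma_mul_le {σ σ' : ℝ} (t : ℝ) (hσ : 0 < σ) (h : σ ≤ σ') :
    ‖Complex.Gamma (σ + t * Complex.I)‖ * Real.Gamma σ'
      ≤ ‖Complex.Gamma (σ' + t * Complex.I)‖ * Real.Gamma σ :=
  le_of_tendsto_of_tendsto'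
    ((Complex.GammaSeq_tendsto_Gamma _).norm.mul (Real.GammaSeq_tendsto_Gamma _))
    ((Complex.GammaSeq_tendsto_Gamma _).norm.mul (Real.GammaSeq_tendsto_Gamma _))
    (norm_GammaSeq_mul_le t hσ h)

theorem norm_Gamma_one_add_mul_I_sq {t : ℝ} (ht : t ≠ 0) :
    ‖Complex.Gamma (1 + t * Complex.I)‖ ^ 2 = Real.pi * t / Real.sinh (Real.pi * t) := by
  have hconj : ‖Complex.Gamma (1 - t * Complex.I)‖ = ‖Complex.Gamma (1 + t * Complex.I)‖ := by
    rw [← Complex.norm_conj, ← Complex.Gamma_conj]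
    congr 2
    simp
  have hti : (t : ℂ) * Complex.I ≠ 0 := mul_ne_zero (by exact_mod_cast ht) Complex.I_ne_zero
  have h1 : Complex.Gamma (1 + t * Complex.I) * Complex.Gamma (1 - t * Complex.I)
      = ((Real.pi * t / Real.sinh (Real.pi * t) : ℝ) : ℂ) := by
    rw [add_comm, Complex.Gamma_add_one _ hti, mul_assoc, Complex.Gamma_mul_Gamma_one_sub,
      ← mul_assoc, Complex.sin_mul_I]
    push_cast
    field_simp [Complex.I_ne_zero]
  have hpos : 0 ≤ Real.pi * t / Real.sinh (Real.pi * t) := by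
    rcases lt_or_gt_of_ne ht with h | h
    · exact div_nonneg_of_nonpos (by nlinarith [Real.pi_pos])
        (Real.sinh_nonpos_iff.2 (by nlinarith [Real.pi_pos]))
    · exact div_nonneg (by positivity) (Real.sinh_nonneg_iff.2 (by positivity))
  have h2 := congrArg norm h1
  rw [norm_mul, hconj, Complex.norm_real, Real.norm_eq_abs, abs_of_nonneg hpos] at h2
  rw [pow_two, h2]

theorem norm_Gamma_one_add_mul_I_le {t : ℝ} (ht : 1 ≤ |t|) :
    ‖Complex.Gamma (1 + t * Complex.I)‖ ≤ 4 * |t| * Real.exp (-(Real.pi * |t| / 2)) := by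
  have ht0 : t ≠ 0 := by rintro rfl; simp at ht; linarith
  have hpos : 0 < |t| := abs_pos.2 ht0
  have hpi := Real.pi_gt_three
  have hpi4 := Real.pi_le_four
  refine (sq_le_sq₀ (by positivity) (by positivity)).1 ?_
  rw [norm_Gamma_one_add_mul_I_sq ht0]
  have h1 : Real.pi * t / Real.sinh (Real.pi * t)
      = Real.pi * |t| / Real.sinh (Real.pi * |t|) := by
    rcases abs_choice t with h | h <;> rw [h]
    rw [mul_neg, Real.sinh_neg, neg_div_neg_eq]
  have h2 : Real.exp (Real.pi * |t|) / 4 ≤ Real.sinh (Real.pi * |t|) := by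
    rw [Real.sinh_eq]
    have h3 : Real.exp (-(Real.pi * |t|)) ≤ 1 := Real.exp_le_one_iff.2 (by nlinarith)
    have h4 := Real.add_one_le_exp (Real.pi * |t|)
    nlinarith
  have h5 : 0 < Real.sinh (Real.pi * |t|) := lt_of_lt_of_le (by positivity) h2
  rw [h1, div_le_iff₀ h5]
  have h6 : (4 * |t| * Real.exp (-(Real.pi * |t| / 2))) ^ 2
      = 16 * |t| ^ 2 * Real.exp (-(Real.pi * |t|)) := by
    rw [mul_pow, ← Real.exp_nat_mul]; ring_nf
  rw [h6]
  calc Real.pi * |t| ≤ 16 * |t| ^ 2 * (1 / 4) := by nlinarith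
    _ = 16 * |t| ^ 2 * Real.exp (-(Real.pi * |t|)) * (Real.exp (Real.pi * |t|) / 4) := by
        rw [Real.exp_neg]; field_simp
    _ ≤ _ := by gcongr

theorem norm_sin_le_exp (z : ℂ) : ‖Complex.sin z‖ ≤ Real.exp |z.im| := by
  rw [Complex.sin, norm_div, norm_mul, Complex.norm_I, mul_one]
  have h1 : ‖Complex.exp (-z * Complex.I)‖ ≤ Real.exp |z.im| := by
    rw [Complex.norm_exp]
    exact Real.exp_le_exp.2 (by simpa using le_abs_self _)
  have h2 : ‖Complex.exp (z * Complex.I)‖ ≤ Real.exp |z.im| := by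
    rw [Complex.norm_exp]
    exact Real.exp_le_exp.2 (by simpa using neg_le_abs _)
  have h3 := norm_sub_le (Complex.exp (-z * Complex.I)) (Complex.exp (z * Complex.I))
  rw [Complex.norm_ofNat, div_le_iff₀ two_pos]
  linarith

/-- This is the factor in the functional equation that transfers lower bounds for ζ to the left of
Re s = 1/2. By reflection, its product with 2 sin(πs/2) Γ(1-s) is π. The exponential growth of the
sine cancels the decay of Γ(1-s), which is compared with Γ on the line Re = 2 through
`norm_Gamma_mul_le`. -/
theorem exists_le_norm_cos_mul_Gamma :
    ∃ c : ℝ, 0 < c ∧ ∀ s : ℂ, 1 / 2 ≤ s.re → s.re ≤ 3 / 2 → 1 ≤ |s.im| →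
      c / (1 + |s.im|) ^ 2 ≤ ‖Complex.cos (Real.pi * s / 2) * Complex.Gamma s‖ := by
  obtain ⟨B, hB⟩ := (isCompact_Icc (a := (1 / 2 : ℝ)) (b := 3 / 2)).exists_bound_of_continuousOn
    (f := Real.Gamma) fun x hx => (Real.differentiableAt_Gamma fun m => by
      have : (0 : ℝ) ≤ m := Nat.cast_nonneg m
      have := hx.1; linarith).continuousAt.continuousWithinAt
  have hB0 : 0 < B + 1 := by
    have := (norm_nonneg _).trans (hB 1 ⟨by norm_num, by norm_num⟩); linarith
  refine ⟨Real.pi / (8 * (B + 1)), by positivity, fun s h1 h2 h3 => ?_⟩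
  set t := s.im with ht
  have hs1 : 1 - s ≠ 0 := fun h => by
    have := congrArg Complex.im h; simp at this; rw [← ht] at this; simp [this] at h3; linarith
  have hsin : Complex.sin (Real.pi * s) ≠ 0 := by
    rw [Complex.sin_ne_zero_iff]
    intro k hk
    have := congrArg Complex.im hk
    simp [← ht, Real.pi_ne_zero] at this
    simp [this] at h3; linarith
  have hrefl : Complex.cos (Real.pi * s / 2) * Complex.Gamma s
      * (2 * Complex.sin (Real.pi * s / 2) * Complex.Gamma (1 - s)) = Real.pi := by
    have h4 := Complex.Gamma_mul_Gamma_one_sub s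
    have h5 : Complex.sin (Real.pi * s)
        = 2 * Complex.sin (Real.pi * s / 2) * Complex.cos (Real.pi * s / 2) := by
      rw [← Complex.sin_two_mul]; congr 1; ring
    calc _ = (Complex.Gamma s * Complex.Gamma (1 - s)) * Complex.sin (Real.pi * s) := by
          rw [h5]; ring
      _ = _ := by rw [h4]; field_simp
  have hG : ‖Complex.Gamma (1 - s)‖
      ≤ (B + 1) * (4 * |t| * Real.exp (-(Real.pi * |t| / 2)) * (1 + |t|)) := by
    have h6 : Complex.Gamma (2 - s) = (1 - s) * Complex.Gamma (1 - s) := by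
      rw [← Complex.Gamma_add_one _ hs1]; congr 1; ring
    have h7 : 1 ≤ ‖1 - s‖ := by
      refine le_trans ?_ (Complex.abs_im_le_norm _)
      simpa using h3
    have h8 : ‖Complex.Gamma (1 - s)‖ ≤ ‖Complex.Gamma (2 - s)‖ := by
      rw [h6, norm_mul]; exact le_mul_of_one_le_left (norm_nonneg _) h7
    have h9 := norm_Gamma_mul_le (σ := 2 - s.re) (σ' := 2) (-t) (by linarith) (by linarith)
    rw [Real.Gamma_two, mul_one] at h9
    have h10 : ((2 - s.re : ℝ) : ℂ) + ((-t : ℝ) : ℂ) * Complex.I = 2 - s := by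
      apply Complex.ext <;> simp [ht]
    have h11 : ‖Complex.Gamma (((2 : ℝ) : ℂ) + ((-t : ℝ) : ℂ) * Complex.I)‖
        ≤ (1 + |t|) * (4 * |t| * Real.exp (-(Real.pi * |t| / 2))) := by
      have hne : (1 : ℂ) + ((-t : ℝ) : ℂ) * Complex.I ≠ 0 := fun h => by
        have := congrArg Complex.re h; simp at this
      have : ((2 : ℝ) : ℂ) + ((-t : ℝ) : ℂ) * Complex.I
          = (1 + ((-t : ℝ) : ℂ) * Complex.I) + 1 := by push_cast; ring
      rw [this, Complex.Gamma_add_one _ hne, norm_mul]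
      have h12 := norm_Gamma_one_add_mul_I_le (t := -t) (by simpa using h3)
      rw [abs_neg] at h12
      gcongr
      refine (norm_add_le _ _).trans ?_
      simp
    rw [h10] at h9
    have h13 : Real.Gamma (2 - s.re) ≤ B + 1 := by
      have := (le_abs_self _).trans (hB (2 - s.re) ⟨by linarith, by linarith⟩); linarith
    have h14 : 0 ≤ Real.Gamma (2 - s.re) := (Real.Gamma_pos_of_pos (by linarith)).le
    calc _ ≤ _ := h8.trans h9
      _ ≤ ((1 + |t|) * (4 * |t| * Real.exp (-(Real.pi * |t| / 2)))) * (B + 1) := by gcongr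
      _ = _ := by ring
  have hS : ‖Complex.sin (Real.pi * s / 2)‖ ≤ Real.exp (Real.pi * |t| / 2) := by
    refine (norm_sin_le_exp _).trans (Real.exp_le_exp.2 (le_of_eq ?_))
    have : (Real.pi * s / 2 : ℂ).im = Real.pi * t / 2 := by
      rw [show (Real.pi * s / 2 : ℂ) = ((Real.pi / 2 : ℝ) : ℂ) * s by push_cast; ring]
      rw [Complex.im_ofReal_mul]; ring
    rw [this, abs_div, abs_mul, abs_of_pos Real.pi_pos]; simp
  have h15 := congrArg norm hrefl
  rw [norm_mul, norm_mul, norm_mul _ (Complex.Gamma (1 - s)), norm_mul (2 : ℂ), Complex.norm_ofNat,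
    Complex.norm_real,
    Real.norm_eq_abs, abs_of_pos Real.pi_pos, ← norm_mul] at h15
  set X := ‖Complex.cos (Real.pi * s / 2) * Complex.Gamma s‖
  have h16 : Real.pi ≤ X * (8 * (B + 1) * (1 + |t|) ^ 2) := by
    rw [← h15]
    refine mul_le_mul_of_nonneg_left ?_ (norm_nonneg _)
    calc _ ≤ 2 * Real.exp (Real.pi * |t| / 2)
          * ((B + 1) * (4 * |t| * Real.exp (-(Real.pi * |t| / 2)) * (1 + |t|))) := by gcongr
      _ = 8 * (B + 1) * (|t| * (1 + |t|)) := by rw [Real.exp_neg]; field_simp; ring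
      _ ≤ _ := by rw [pow_two]; gcongr; linarith
  rw [div_div, div_le_iff₀ (by positivity)]
  exact h16

/-! ### Non-trivial zeros and the reciprocal of ζ. -/

theorem riemannZeta₁_eq_sub_mul {s : ℂ} (hs : s ≠ 1) :
    riemannZeta₁ s = (s - 1) * riemannZeta s := by
  rw [riemannZeta_eq_inv_sub_mul hs, mul_inv_cancel_left₀ (sub_ne_zero.2 hs)]

theorem zetaRecip_eq (s : ℂ) : zetaRecip s = (s - 1) / riemannZeta₁ s := by
  unfold zetaRecip
  split_ifs with h
  · simp [h]
  · rw [riemannZeta₁_eq_sub_mul h, ← div_div, div_self (sub_ne_zero.2 h)]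

theorem riemannZeta₁_ne_zero_of_one_le_re {s : ℂ} (hs : 1 ≤ s.re) : riemannZeta₁ s ≠ 0 := by
  rcases eq_or_ne s 1 with rfl | h
  · simp
  · rw [riemannZeta₁_eq_sub_mul h]
    exact mul_ne_zero (sub_ne_zero.2 h) (riemannZeta_ne_zero_of_one_le_re hs)

theorem mem_nontrivialZeros_of_riemannZeta₁_eq_zero {s : ℂ} (hs : 0 < s.re)
    (h : riemannZeta₁ s = 0) : s ∈ nontrivialZeros := by
  have hre : s.re < 1 := by
    by_contra hge
    exact riemannZeta₁_ne_zero_of_one_le_re (not_lt.1 hge) h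
  have h1 : s ≠ 1 := by rintro rfl; simp at hre
  rw [riemannZeta₁_eq_sub_mul h1] at h
  exact ⟨(mul_eq_zero.1 h).resolve_left (sub_ne_zero.2 h1), hs, hre⟩

theorem ne_one_of_mem_nontrivialZeros {ρ : ℂ} (h : ρ ∈ nontrivialZeros) : ρ ≠ 1 := by
  rintro rfl
  simpa using h.2.2

theorem deriv_riemannZeta₁_of_mem_nontrivialZeros {ρ : ℂ} (h : ρ ∈ nontrivialZeros) :
    deriv riemannZeta₁ ρ = (ρ - 1) * deriv riemannZeta ρ := by
  have h1 := ne_one_of_mem_nontrivialZeros h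
  have h2 : riemannZeta₁ =ᶠ[𝓝 ρ] fun s => (s - 1) * riemannZeta s := by
    filter_upwards [isOpen_ne.mem_nhds h1] with s hs using riemannZeta₁_eq_sub_mul hs
  have h3 := ((hasDerivAt_id ρ).sub_const 1).mul (differentiableAt_riemannZeta h1).hasDerivAt
  rw [h2.deriv_eq]
  have := h3.deriv
  simp only [id, h.1, mul_zero, zero_add] at this
  exact this

theorem conj_mem_nontrivialZeros {ρ : ℂ} (h : ρ ∈ nontrivialZeros) :
    (starRingEnd ℂ) ρ ∈ nontrivialZeros := by
  refine ⟨by rw [riemannZeta_conj, h.1, map_zero], ?_, ?_⟩ <;> simp [h.2.1, h.2.2]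

theorem ne_neg_natCast_of_re_pos {s : ℂ} (h : 0 < s.re) (n : ℕ) : s ≠ -n := by
  rintro rfl
  simp at h
  linarith [(Nat.cast_nonneg n : (0 : ℝ) ≤ n)]

theorem one_sub_mem_nontrivialZeros {ρ : ℂ} (h : ρ ∈ nontrivialZeros) :
    1 - ρ ∈ nontrivialZeros := by
  refine ⟨?_, by simp [h.2.2], by simp [h.2.1]⟩
  rw [riemannZeta_one_sub (ne_neg_natCast_of_re_pos h.2.1) (ne_one_of_mem_nontrivialZeros h), h.1,
    mul_zero]

theorem exists_norm_zetaRecip_le :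
    ∃ B : ℝ, 1 ≤ B ∧ ∀ s : ℂ, 3 / 2 ≤ s.re → ‖zetaRecip s‖ ≤ B := by
  have hμ : LSeriesSummable (fun n => (ArithmeticFunction.moebius n : ℂ)) ((3 / 2 : ℝ) : ℂ) :=
    ArithmeticFunction.LSeriesSummable_moebius_iff.2 (by norm_num)
  refine ⟨1 + ∑' n, ‖LSeries.term (fun n => (ArithmeticFunction.moebius n : ℂ))
    ((3 / 2 : ℝ) : ℂ) n‖, ?_, fun s hs => ?_⟩
  · exact le_add_of_nonneg_right (tsum_nonneg fun _ => norm_nonneg _)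
  have h1 : 1 < s.re := by linarith
  have hs1 : s ≠ 1 := by rintro rfl; simp at h1
  have h2 : zetaRecip s = LSeries (fun n => (ArithmeticFunction.moebius n : ℂ)) s := by
    rw [zetaRecip, if_neg hs1, div_eq_iff (riemannZeta_ne_zero_of_one_lt_re h1),
      ← ArithmeticFunction.LSeries_zeta_eq_riemannZeta h1, mul_comm,
      ArithmeticFunction.LSeries_zeta_mul_Lseries_moebius h1]
  rw [h2]
  have hb : ∀ n, ‖LSeries.term (fun n => (ArithmeticFunction.moebius n : ℂ)) s n‖
      ≤ ‖LSeries.term (fun n => (ArithmeticFunction.moebius n : ℂ)) ((3 / 2 : ℝ) : ℂ) n‖ :=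
    fun n => LSeries.norm_term_le_of_re_le_re _ (by simpa using hs) n
  refine (tsum_of_norm_bounded hμ.norm.hasSum hb).trans ?_
  linarith

/-! ### Lower bounds for ζ at heights avoiding the zeros. -/

/-- The concentric discs about 2 + iT have radii 15/8, 7/4 and 3/2: the largest stays in Re s ≥ 1/8
where growth is polynomial, and the smallest contains the segment from 1/2 + iT to 2 + iT. Since 1/ζ
is bounded near the centre line Re s = 2, both the zero count and the lower bound lose only O(log
T). -/
theorem exists_zeros_near_height :
    ∃ C : ℝ, 0 < C ∧ ∀ T : ℝ, 4 ≤ T → ∃ Z : Finset ℂ,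
      (∀ ρ, ρ ∈ Z ↔ riemannZeta₁ ρ = 0 ∧ ‖ρ - (2 + T * Complex.I)‖ ≤ 7 / 4) ∧
      (Z.card : ℝ) ≤ C * Real.log T ∧
      ((∀ ρ ∈ nontrivialZeros, deriv riemannZeta ρ ≠ 0) →
        ∀ s : ℂ, ‖s - (2 + T * Complex.I)‖ ≤ 3 / 2 →
          Real.exp (-(C * Real.log T)) * ∏ ρ ∈ Z, (‖s - ρ‖ / 4) ≤ ‖riemannZeta₁ s‖) := by
  obtain ⟨B, hB1, hB⟩ := exists_norm_zetaRecip_le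
  have hB0 : 0 < B := by linarith
  have hl : 0 < Real.log (15 / 14) := Real.log_pos (by norm_num)
  set D := Real.log (81 * B) with hD
  have hD0 : 0 ≤ D := Real.log_nonneg (by linarith)
  have hlog4 : (1 : ℝ) ≤ Real.log 4 := by
    rw [Real.le_log_iff_exp_le (by norm_num)]
    linarith [Real.exp_one_lt_d9]
  -- The first summand is the Jensen count with R/R₁ = 15/14. For the second, 2R₂/(R₁ - R₂) = 12
  -- multiplies a quantity at most (2 + D + 1) log T, and the lower bound 1/B at the centre costs at
  -- most D more.
  refine ⟨(2 + D) / Real.log (15 / 14) + 13 * (2 + D + 1), by positivity, fun T hT => ?_⟩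
  have hlogT : 1 ≤ Real.log T := hlog4.trans (Real.log_le_log (by norm_num) hT)
  set c : ℂ := 2 + T * Complex.I with hc
  set f : ℂ → ℂ := fun z => riemannZeta₁ (c + z) with hf
  have hfd : Differentiable ℂ f := differentiable_riemannZeta₁.comp (by fun_prop)
  have hre : ∀ r : ℝ, ∀ z : ℂ, ‖z‖ ≤ r → 2 - r ≤ (c + z).re := by
    intro r z hz
    have h1 := (abs_le.1 ((Complex.abs_re_le_norm z).trans hz)).1
    simp [hc]; linarith
  have hM : ∀ z, ‖z‖ = 15 / 8 → ‖f z‖ ≤ 81 * T ^ 2 := by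
    intro z hz
    have h1 := norm_riemannZeta₁_le (s := c + z) (by have := hre _ z hz.le; linarith)
    have h2 : ‖c + z‖ ≤ 2 + T + 15 / 8 := by
      refine (norm_add_le _ _).trans ?_
      rw [hz]
      gcongr
      refine (norm_add_le _ _).trans ?_
      simp [abs_of_nonneg (show (0 : ℝ) ≤ T by linarith)]
    calc ‖f z‖ ≤ 9 * (‖c + z‖ + 1) ^ 2 := h1
      _ ≤ 9 * (3 * T) ^ 2 := by gcongr; linarith
      _ = 81 * T ^ 2 := by ring
  have hc1 : c ≠ 1 := fun h => by have := congrArg Complex.re h; simp [hc] at this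
  have hf0 : B⁻¹ ≤ ‖f 0‖ := by
    have h1 := hB c (by simp [hc]; norm_num)
    rw [zetaRecip_eq, norm_div] at h1
    have h2 : (1 : ℝ) ≤ ‖c - 1‖ := by
      refine le_trans ?_ (Complex.re_le_norm _)
      simp [hc]; norm_num
    have h3 : 0 < ‖riemannZeta₁ c‖ :=
      norm_pos_iff.2 (riemannZeta₁_ne_zero_of_one_le_re (by simp [hc]))
    rw [div_le_iff₀ h3] at h1
    simp only [hf, add_zero]
    rw [inv_le_iff_one_le_mul₀ hB0]
    linarith
  have hf00 : 0 < ‖f 0‖ := lt_of_lt_of_le (by positivity) hf0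
  have hlogM : Real.log (81 * T ^ 2 / ‖f 0‖) ≤ (2 + D) * Real.log T := by
    have h1 : 81 * T ^ 2 / ‖f 0‖ ≤ 81 * B * T ^ 2 := by
      rw [div_le_iff₀ hf00]
      have : 1 ≤ B * ‖f 0‖ := by rwa [inv_le_iff_one_le_mul₀' hB0] at hf0
      nlinarith [sq_nonneg T]
    have h2 := Real.log_le_log (by positivity) h1
    rw [Real.log_mul (by positivity) (by positivity), Real.log_pow] at h2
    push_cast at h2
    nlinarith
  have hfin : {z : ℂ | f z = 0 ∧ ‖z‖ ≤ 7 / 4}.Finite := by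
    have h1 : ((Metric.closedBall c (7 / 4)) ∩ riemannZetaZeros).Finite :=
      (isCompact_closedBall c (7 / 4)).inter_riemannZetaZeros_finite
    refine (h1.image fun w => w - c).subset ?_
    rintro z ⟨hz0, hz⟩
    refine ⟨c + z, ⟨by simpa using hz, ?_⟩, by ring⟩
    exact (mem_nontrivialZeros_of_riemannZeta₁_eq_zero
      (by have := hre _ z hz; linarith) hz0).1
  have hmem : ∀ z, z ∈ hfin.toFinset ↔ f z = 0 ∧ ‖z‖ ≤ 7 / 4 := fun z => by simp
  have hinj : Function.Injective fun z : ℂ => c + z := add_right_injective c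
  refine ⟨hfin.toFinset.map ⟨_, hinj⟩, fun ρ => ?_, ?_, fun hsimple s hs => ?_⟩
  · simp only [Finset.mem_map, Function.Embedding.coeFn_mk, hmem]
    constructor
    · rintro ⟨z, ⟨h1, h2⟩, rfl⟩
      exact ⟨h1, by simpa using h2⟩
    · rintro ⟨h1, h2⟩
      exact ⟨ρ - c, ⟨by simpa [hf] using h1, h2⟩, by ring⟩
  · rw [Finset.card_map]
    have h1 := card_zeros_mul_log_le hfd (R := 15 / 8) (R₁ := 7 / 4) (by norm_num) (by norm_num) hM
      (norm_pos_iff.1 hf00) hfin.toFinset (fun ρ h => ((hmem ρ).1 h).1)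
      (fun ρ h => ((hmem ρ).1 h).2)
    rw [show (15 / 8 : ℝ) / (7 / 4) = 15 / 14 by norm_num] at h1
    have h2 : (hfin.toFinset.card : ℝ) ≤ (2 + D) / Real.log (15 / 14) * Real.log T := by
      rw [div_mul_eq_mul_div, le_div_iff₀ hl]; linarith
    refine h2.trans ?_
    gcongr
    linarith
  · have h1 := norm_mul_prod_le_of_simple_zeros hfd (R := 15 / 8) (R₁ := 7 / 4) (R₂ := 3 / 2)
      (by norm_num) (by norm_num) (by norm_num) hM (norm_pos_iff.1 hf00) hfin.toFinset hmem
      (fun ρ hρ => ?_) (z := s - c) hs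
    · have h2 : f (s - c) = riemannZeta₁ s := by simp [hf]
      rw [h2] at h1
      refine le_trans ?_ h1
      rw [Finset.prod_map]
      simp only [Function.Embedding.coeFn_mk]
      refine mul_le_mul ?_ ?_ (Finset.prod_nonneg fun _ _ => by positivity) (by positivity)
      · refine le_trans ?_ (mul_le_mul_of_nonneg_right hf0 (by positivity))
        have h3 : Real.exp (-Real.log B) = B⁻¹ := by rw [Real.exp_neg, Real.exp_log hB0]
        rw [← h3, ← Real.exp_add, Real.exp_le_exp]
        have h4 : Real.log B ≤ D := Real.log_le_log hB0 (by linarith)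
        have h5 : 0 ≤ (2 + D) / Real.log (15 / 14) := by positivity
        have h6 : 0 ≤ (2 + D) / Real.log (15 / 14) * Real.log T := by positivity
        norm_num
        nlinarith
      · refine Finset.prod_le_prod (fun _ _ => by positivity) fun ρ _ => ?_
        rw [sub_sub, show (2 : ℝ) * (15 / 8) = 15 / 4 by norm_num]
        exact div_le_div_of_nonneg_left (norm_nonneg _) (by norm_num) (by norm_num)
    · have h2 := (hmem ρ).1 hρ
      have h3 := mem_nontrivialZeros_of_riemannZeta₁_eq_zero
        (by have := hre _ ρ h2.2; linarith) h2.1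
      have h4 : deriv f ρ = deriv riemannZeta₁ (c + ρ) := deriv_comp_const_add riemannZeta₁ c ρ
      rw [h4, deriv_riemannZeta₁_of_mem_nontrivialZeros h3]
      exact mul_ne_zero (sub_ne_zero.2 (ne_one_of_mem_nontrivialZeros h3)) (hsimple _ h3)

/-- No zero has an ordinate whose absolute value is within its bracket radius of `T`. -/
def Uncovered (A T : ℝ) : Prop :=
  ∀ ρ ∈ nontrivialZeros, bracketRadius A ρ ≤ |(|ρ.im| - T)|

theorem eventually_mul_log_le (K : ℝ) {δ : ℝ} (hδ : 0 < δ) :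
    ∀ᶠ T : ℝ in atTop, K * Real.log T ≤ δ * T := by
  have h := Real.isLittleO_log_id_atTop.def (c := δ / (|K| + 1)) (by positivity)
  filter_upwards [h, eventually_ge_atTop 1] with T hT hT1
  have h0 := Real.log_nonneg hT1
  simp only [id, Real.norm_eq_abs, abs_of_nonneg h0, abs_of_nonneg (zero_le_one.trans hT1)] at hT
  rw [div_mul_eq_mul_div, le_div_iff₀ (by positivity)] at hT
  have := le_abs_self K
  nlinarith

theorem le_bracketRadius {A T : ℝ} (hA : 0 < A) (hT : 4 ≤ T) {ρ : ℂ} (h1 : T / 2 ≤ |ρ.im|)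
    (h2 : |ρ.im| ≤ 2 * T) : Real.exp (-(4 * A * T / Real.log T)) ≤ bracketRadius A ρ := by
  have hlogT : 0 < Real.log T := Real.log_pos (by linarith)
  have hlog : Real.log T / 2 ≤ Real.log |ρ.im| := by
    have h3 : Real.log (T / 2) ≤ Real.log |ρ.im| := Real.log_le_log (by linarith) h1
    rw [Real.log_div (by linarith) two_ne_zero] at h3
    have h4 : Real.log (2 ^ 2) ≤ Real.log T := Real.log_le_log (by norm_num) (by linarith)
    rw [Real.log_pow] at h4
    push_cast at h4
    linarith
  unfold bracketRadius
  rw [Real.exp_le_exp, neg_div, neg_le_neg_iff, div_le_div_iff₀ (by linarith) hlogT]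
  nlinarith [mul_le_mul h2 hlog (by positivity) (by positivity), mul_pos hA hlogT]

/-- At most C log T zeros matter, each at distance at least exp(-4AT/log T). The logarithms cancel
in the product, leaving exp(-4ACT); with A = ε/(16C) this costs only εT/4, and the other losses are
O(log T). -/
theorem exists_le_norm_riemannZeta_of_im_pos
    (hsimple : ∀ ρ ∈ nontrivialZeros, deriv riemannZeta ρ ≠ 0) {ε : ℝ} (hε : 0 < ε) :
    ∃ A : ℝ, 0 < A ∧ ∀ᶠ T : ℝ in atTop, Uncovered A T → ∀ s : ℂ, s.im = T → 1 / 2 ≤ s.re →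
      Real.exp (-(ε * T)) ≤ ‖riemannZeta s‖ := by
  obtain ⟨C, hC, hZ⟩ := exists_zeros_near_height
  obtain ⟨B, hB1, hB⟩ := exists_norm_zetaRecip_le
  have hA : 0 < ε / (16 * C) := by positivity
  refine ⟨ε / (16 * C), hA, ?_⟩
  have hBev : ∀ᶠ T : ℝ in atTop, Real.exp (-(ε * T)) ≤ B⁻¹ := by
    have : Tendsto (fun T : ℝ => Real.exp (-(ε * T))) atTop (𝓝 0) :=
      Real.tendsto_exp_atBot.comp (tendsto_neg_atTop_atBot.comp (tendsto_id.const_mul_atTop hε))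
    exact this.eventually_le_const (by positivity)
  filter_upwards [hBev, eventually_ge_atTop 4,
    eventually_mul_log_le (3 * C + 2) (δ := ε / 2) (by positivity)] with T hBT hT hlog hU s hsT hs
  have hs1 : s ≠ 1 := by rintro rfl; simp at hsT; linarith
  have hlogT : 0 < Real.log T := Real.log_pos (by linarith)
  rcases le_total 2 s.re with h2 | h2
  · have h3 := hB s (by linarith)
    rw [zetaRecip, if_neg hs1, one_div, norm_inv] at h3
    exact hBT.trans (inv_le_of_inv_le₀
      (norm_pos_iff.2 (riemannZeta_ne_zero_of_one_le_re (by linarith))) h3)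
  obtain ⟨Z, hmem, hcard, hlow⟩ := hZ T hT
  have hs' : s - (2 + T * Complex.I) = ((s.re - 2 : ℝ) : ℂ) := by
    apply Complex.ext <;> simp [hsT]
  have h3 := hlow hsimple s (by
    rw [hs', Complex.norm_real, Real.norm_eq_abs, abs_le]; constructor <;> linarith)
  -- The summand 2 pays for the factor 1/4 in ‖s - ρ‖ / 4, since e^{-2} ≤ 1/4.
  set x := 4 * (ε / (16 * C)) * T / Real.log T + 2 with hx
  have hx0 : 0 ≤ x := by positivity
  have hprod : Real.exp (-(x * (C * Real.log T))) ≤ ∏ ρ ∈ Z, (‖s - ρ‖ / 4) := by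
    calc Real.exp (-(x * (C * Real.log T))) ≤ Real.exp (-x) ^ Z.card := by
          rw [← Real.exp_nat_mul, Real.exp_le_exp]
          nlinarith
      _ = ∏ ρ ∈ Z, Real.exp (-x) := by rw [Finset.prod_const]
      _ ≤ _ := by
        refine Finset.prod_le_prod (fun _ _ => (Real.exp_pos _).le) fun ρ hρ => ?_
        obtain ⟨hρ0, hρT⟩ := (hmem ρ).1 hρ
        have hre := (abs_le.1 ((Complex.abs_re_le_norm _).trans hρT)).1
        have him := abs_le.1 ((Complex.abs_im_le_norm _).trans hρT)
        simp at hre him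
        have hρn := mem_nontrivialZeros_of_riemannZeta₁_eq_zero (by linarith) hρ0
        have hpos : 0 < ρ.im := by linarith
        have habs : |ρ.im| = ρ.im := abs_of_pos hpos
        have h4 := le_bracketRadius hA hT (ρ := ρ) (by rw [habs]; linarith) (by rw [habs]; linarith)
        have h5 : bracketRadius (ε / (16 * C)) ρ ≤ ‖s - ρ‖ := by
          refine (hU ρ hρn).trans (le_trans (le_of_eq ?_) (Complex.abs_im_le_norm _))
          rw [habs, Complex.sub_im, hsT, abs_sub_comm]
        have h6 : Real.exp (-2) ≤ 1 / 4 := by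
          rw [Real.exp_neg, ← one_div]
          refine one_div_le_one_div_of_le (by norm_num) ?_
          have := Real.add_one_le_exp (1 : ℝ)
          have h7 : Real.exp 2 = Real.exp 1 * Real.exp 1 := by rw [← Real.exp_add]; norm_num
          nlinarith
        calc Real.exp (-x) = Real.exp (-(4 * (ε / (16 * C)) * T / Real.log T)) * Real.exp (-2) := by
              rw [← Real.exp_add, hx]; ring_nf
          _ ≤ ‖s - ρ‖ * (1 / 4) := by gcongr; exact h4.trans h5
          _ = _ := by ring
  have hzeta : ‖riemannZeta₁ s‖ ≤ Real.exp (2 * Real.log T) * ‖riemannZeta s‖ := by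
    rw [riemannZeta₁_eq_sub_mul hs1, norm_mul]
    gcongr
    rw [show 2 * Real.log T = Real.log (T ^ 2) by rw [Real.log_pow]; norm_num,
      Real.exp_log (by positivity)]
    refine (Complex.norm_le_abs_re_add_abs_im _).trans ?_
    simp only [Complex.sub_re, Complex.one_re, Complex.sub_im, Complex.one_im, sub_zero, hsT]
    have h4 : |s.re - 1| ≤ 1 := abs_le.2 ⟨by linarith, by linarith⟩
    rw [abs_of_pos (by linarith : (0 : ℝ) < T)]
    nlinarith
  have h4 : Real.exp (-(C * Real.log T)) * Real.exp (-(x * (C * Real.log T)))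
      ≤ Real.exp (2 * Real.log T) * ‖riemannZeta s‖ :=
    (mul_le_mul_of_nonneg_left hprod (Real.exp_pos _).le).trans (h3.trans hzeta)
  rw [← Real.exp_add] at h4
  have h5 : Real.exp (-(ε * T)) * Real.exp (2 * Real.log T)
      ≤ Real.exp (-(C * Real.log T) + -(x * (C * Real.log T))) := by
    rw [← Real.exp_add, Real.exp_le_exp]
    have h6 : x * (C * Real.log T) = ε / 4 * T + 2 * (C * Real.log T) := by
      rw [hx]; field_simp; ring
    rw [h6]
    nlinarith
  have h7 := h5.trans h4
  rw [mul_comm] at h7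
  exact le_of_mul_le_mul_left h7 (Real.exp_pos _)

/-- Conjugation handles negative ordinates, and the functional equation reflects -1/2 ≤ Re s ≤ 1/2
to 1/2 ≤ Re w ≤ 3/2 at a polynomial cost, absorbed by running the previous bound with ε/2. -/
theorem exists_le_norm_riemannZeta
    (hsimple : ∀ ρ ∈ nontrivialZeros, deriv riemannZeta ρ ≠ 0) {ε : ℝ} (hε : 0 < ε) :
    ∃ A : ℝ, 0 < A ∧ ∀ᶠ T : ℝ in atTop, Uncovered A T → ∀ s : ℂ, |s.im| = T → -(1 / 2) ≤ s.re →
      Real.exp (-(ε * T)) ≤ ‖riemannZeta s‖ := by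
  obtain ⟨A, hA, h⟩ := exists_le_norm_riemannZeta_of_im_pos hsimple (half_pos hε)
  obtain ⟨c, hc, hG⟩ := exists_le_norm_cos_mul_Gamma
  refine ⟨A, hA, ?_⟩
  -- The exponent -3/2 is the least value of -Re w, and c/4 comes from (1 + T)² ≤ 4T².
  set c' : ℝ := 2 * (2 * Real.pi) ^ (-(3 / 2) : ℝ) * (c / 4) with hc'
  have hc'0 : 0 < c' := by positivity
  filter_upwards [h, eventually_ge_atTop 1,
    eventually_mul_log_le 2 (δ := ε / 4) (by positivity),
    (tendsto_id.const_mul_atTop (by positivity : 0 < ε / 4)).eventually_ge_atTop (-Real.log c')]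
    with T hT hT1 hlog hcT hU s hsT hs
  have key : ∀ s : ℂ, |s.im| = T → 1 / 2 ≤ s.re → Real.exp (-(ε / 2 * T)) ≤ ‖riemannZeta s‖ := by
    intro s hsT hs
    rcases abs_choice s.im with h1 | h1 <;> rw [h1] at hsT
    · exact hT hU s hsT hs
    · have := hT hU ((starRingEnd ℂ) s) (by simpa using hsT) (by simpa using hs)
      rwa [riemannZeta_conj, Complex.norm_conj] at this
  rcases le_total (1 / 2) s.re with h1 | h1
  · refine le_trans (Real.exp_le_exp.2 ?_) (key s hsT h1)
    nlinarith
  set w := 1 - s with hw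
  have hwT : |w.im| = T := by simpa [hw] using hsT
  have hwre : w.re = 1 - s.re := by simp [hw]
  have hw1 : w ≠ 1 := by rintro h1; rw [h1] at hwT; simp at hwT; linarith
  have h2 := key w hwT (by linarith)
  have h3 := hG w (by linarith) (by linarith) (by linarith)
  have h4 := riemannZeta_one_sub (ne_neg_natCast_of_re_pos (s := w) (by linarith)) hw1
  rw [show 1 - w = s by simp [hw]] at h4
  have h5 : ‖riemannZeta s‖ = 2 * (2 * Real.pi) ^ (-w.re)
      * ‖Complex.cos (Real.pi * w / 2) * Complex.Gamma w‖ * ‖riemannZeta w‖ := by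
    rw [h4]
    simp only [norm_mul, Complex.norm_ofNat]
    have : ‖(2 * Real.pi : ℂ) ^ (-w)‖ = (2 * Real.pi) ^ (-w.re) := by
      rw [show (2 * Real.pi : ℂ) = ((2 * Real.pi : ℝ) : ℂ) by push_cast; ring,
        Complex.norm_cpow_eq_rpow_re_of_pos (by positivity)]
      simp
    rw [this]; ring
  have h6 : (2 * Real.pi) ^ (-(3 / 2) : ℝ) ≤ (2 * Real.pi) ^ (-w.re) :=
    Real.rpow_le_rpow_of_exponent_le (by linarith [Real.pi_gt_three]) (by linarith)
  have h7 : c / 4 * Real.exp (-(2 * Real.log T)) ≤ c / (1 + |w.im|) ^ 2 := by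
    rw [hwT, show 2 * Real.log T = Real.log (T ^ 2) by rw [Real.log_pow]; norm_num, Real.exp_neg,
      Real.exp_log (by positivity), ← div_eq_mul_inv, div_div]
    refine div_le_div_of_nonneg_left hc.le (by positivity) ?_
    nlinarith
  rw [h5]
  calc Real.exp (-(ε * T))
      ≤ Real.exp (Real.log c' + -(2 * Real.log T) + -(ε / 2 * T)) := by
        rw [Real.exp_le_exp]
        simp only [id] at hcT
        linarith
    _ = c' * Real.exp (-(2 * Real.log T)) * Real.exp (-(ε / 2 * T)) := by
        rw [Real.exp_add, Real.exp_add, Real.exp_log hc'0]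
    _ = 2 * (2 * Real.pi) ^ (-(3 / 2) : ℝ) * (c / 4 * Real.exp (-(2 * Real.log T)))
          * Real.exp (-(ε / 2 * T)) := by rw [hc']; ring
    _ ≤ _ := by gcongr; exact h7.trans h3

/-! ### The prime number theorem in the form ∑ μ(n)/n = 0. -/

/-- The partial sum `∑_{n ≤ e^u} μ(n) / n`. -/
noncomputable def moebiusSum (u : ℝ) : ℂ :=
  ∑ n ∈ Finset.Icc 1 ⌊Real.exp u⌋₊, (ArithmeticFunction.moebius n : ℂ) / n

theorem moebiusSum_of_neg {u : ℝ} (hu : u < 0) : moebiusSum u = 0 := by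
  have : ⌊Real.exp u⌋₊ = 0 := Nat.floor_eq_zero.2 (by simpa using hu)
  simp [moebiusSum, this]

theorem norm_moebius_div_le (n : ℕ) :
    ‖(ArithmeticFunction.moebius n : ℂ) / n‖ ≤ 1 / (n : ℝ) := by
  rw [norm_div, Complex.norm_natCast, Complex.norm_intCast]
  gcongr
  exact_mod_cast ArithmeticFunction.abs_moebius_le_one

theorem sum_Ioc_one_div_le {a b : ℕ} (hab : a < b) :
    ∑ n ∈ Finset.Ioc a b, 1 / (n : ℝ) ≤ 1 / (a + 1 : ℝ) + (Real.log b - Real.log (a + 1)) := by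
  induction b, hab using Nat.le_induction with
  | base => simp
  | succ b hb ih =>
    rw [Finset.sum_Ioc_succ_top (by omega)]
    have hb0 : (0 : ℝ) < b := by exact_mod_cast (by omega : 0 < b)
    have h1 := Real.one_sub_inv_le_log_of_pos (x := ((b + 1 : ℕ) : ℝ) / b) (by positivity)
    rw [Real.log_div (by positivity) hb0.ne'] at h1
    have h2 : 1 - (((b + 1 : ℕ) : ℝ) / b)⁻¹ = 1 / ((b + 1 : ℕ) : ℝ) := by
      push_cast; field_simp; ring
    linarith

/-- This is the slow oscillation required by the Tauberian argument: the terms are at most 1/n, and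
the harmonic sum over e^u < n ≤ e^v is v - u up to its first term, which is at most min(1, e^{-u}).
-/
theorem norm_moebiusSum_sub_le_of_le {u v : ℝ} (huv : u ≤ v) :
    ‖moebiusSum v - moebiusSum u‖ ≤ (v - u) + min 1 (Real.exp (-u)) := by
  have hmin : 0 < min 1 (Real.exp (-u)) := lt_min one_pos (Real.exp_pos _)
  set a := ⌊Real.exp u⌋₊ with ha
  set b := ⌊Real.exp v⌋₊ with hb
  have hab : a ≤ b := Nat.floor_mono (Real.exp_le_exp.2 huv)
  have h1 : moebiusSum v - moebiusSum u
      = ∑ n ∈ Finset.Ioc a b, (ArithmeticFunction.moebius n : ℂ) / n := by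
    simp only [moebiusSum, ← ha, ← hb]
    rw [sub_eq_iff_eq_add, add_comm]
    have := Finset.sum_Ioc_consecutive (fun n : ℕ => (ArithmeticFunction.moebius n : ℂ) / n)
      (Nat.zero_le a) hab
    exact this.symm
  rw [h1]
  rcases hab.eq_or_lt with h | h
  · rw [h]; simp only [Finset.Ioc_self, Finset.sum_empty, norm_zero]; linarith
  have h2 : ‖∑ n ∈ Finset.Ioc a b, (ArithmeticFunction.moebius n : ℂ) / n‖
      ≤ 1 / (a + 1 : ℝ) + (Real.log b - Real.log (a + 1)) :=
    (norm_sum_le _ _).trans ((Finset.sum_le_sum fun n _ => norm_moebius_div_le n).trans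
      (sum_Ioc_one_div_le h))
  have hbpos : (0 : ℝ) < b := by exact_mod_cast (by omega : 0 < b)
  have h3 : Real.log b ≤ v := by
    rw [Real.log_le_iff_le_exp hbpos]
    exact Nat.floor_le (Real.exp_pos v).le
  have h4 : Real.exp u < a + 1 := Nat.lt_floor_add_one _
  have h5 : u ≤ Real.log (a + 1) := by
    rw [Real.le_log_iff_exp_le (by positivity)]
    exact h4.le
  have h6 : 1 / (a + 1 : ℝ) ≤ min 1 (Real.exp (-u)) := by
    refine le_min ?_ ?_
    · rw [div_le_one (by positivity)]
      linarith [(Nat.cast_nonneg a : (0 : ℝ) ≤ a)]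
    · rw [Real.exp_neg, ← one_div]
      exact one_div_le_one_div_of_le (Real.exp_pos u) h4.le
  linarith

theorem norm_moebiusSum_sub_le (u v : ℝ) :
    ‖moebiusSum v - moebiusSum u‖ ≤ |v - u| + min 1 (Real.exp (-(v - |v - u|))) := by
  rcases le_total u v with h | h
  · rw [abs_of_nonneg (by linarith : 0 ≤ v - u)]
    simpa using norm_moebiusSum_sub_le_of_le h
  · rw [norm_sub_rev, abs_of_nonpos (by linarith : v - u ≤ 0)]
    refine (norm_moebiusSum_sub_le_of_le h).trans ?_
    have : Real.exp (-v) ≤ Real.exp (-(v - -(v - u))) := Real.exp_le_exp.2 (by linarith)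
    have := min_le_min_left 1 this
    linarith

theorem norm_moebiusSum_le (u : ℝ) : ‖moebiusSum u‖ ≤ 2 + |u| := by
  have h := norm_moebiusSum_sub_le u (-1)
  rw [moebiusSum_of_neg (by norm_num), zero_sub, norm_neg] at h
  have h1 : |-1 - u| ≤ 1 + |u| := by
    rw [← abs_neg]
    refine le_trans (le_of_eq ?_) ((abs_add_le 1 u).trans (by simp))
    congr 1; ring
  have := min_le_left 1 (Real.exp (-(-1 - |-1 - u|)))
  linarith

theorem measurable_moebiusSum : Measurable moebiusSum :=
  (measurable_from_nat (f := fun N : ℕ =>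
    ∑ n ∈ Finset.Icc 1 N, (ArithmeticFunction.moebius n : ℂ) / n)).comp
    (Nat.measurable_floor.comp Real.measurable_exp)

/-- Abel summation in the variable t = e^u gives 1/(s ζ(1+s)). The factor s cancels the pole of ζ,
so the Laplace transform extends continuously to Re s = 0, including s = 0. -/
theorem integral_moebiusSum_mul_exp {s : ℂ} (hs : 0 < s.re) :
    ∫ u : ℝ, moebiusSum u * Complex.exp (-(s * u)) = (riemannZeta₁ (1 + s))⁻¹ := by
  have hs0 : s ≠ 0 := by rintro rfl; simp at hs
  have hs1 : 1 + s ≠ 1 := by simpa using hs0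
  set f : ℕ → ℂ := fun n => (ArithmeticFunction.moebius n : ℂ) / n with hf
  have hterm : ∀ n, LSeries.term f s n
      = LSeries.term (fun n => (ArithmeticFunction.moebius n : ℂ)) (1 + s) n := by
    intro n
    rcases eq_or_ne n 0 with rfl | hn
    · simp
    · have hn' : (n : ℂ) ≠ 0 := by exact_mod_cast hn
      rw [LSeries.term_of_ne_zero hn, LSeries.term_of_ne_zero hn, hf, Complex.cpow_add _ _ hn',
        Complex.cpow_one, div_div]
  have hμ : LSeriesSummable (fun n => (ArithmeticFunction.moebius n : ℂ)) (1 + s) :=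
    ArithmeticFunction.LSeriesSummable_moebius_iff.2 (by simpa using hs)
  have hsum : LSeriesSummable f s := by
    unfold LSeriesSummable at hμ ⊢
    rwa [show LSeries.term f s = _ from funext hterm]
  have hL : LSeries f s = s * (riemannZeta₁ (1 + s))⁻¹ := by
    have h1 : LSeries f s = LSeries (fun n => (ArithmeticFunction.moebius n : ℂ)) (1 + s) := by
      simp only [LSeries, hterm]
    have h2 : (1 : ℝ) < (1 + s).re := by simpa using hs
    have h3 := ArithmeticFunction.LSeries_zeta_mul_Lseries_moebius h2
    rw [ArithmeticFunction.LSeries_zeta_eq_riemannZeta h2] at h3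
    rw [h1, riemannZeta₁_eq_sub_mul hs1, add_sub_cancel_left, mul_inv, mul_inv_cancel_left₀ hs0]
    exact eq_inv_of_mul_eq_one_right h3
  have hO : (fun n : ℕ => ∑ k ∈ Finset.Icc 1 n, f k) =O[atTop] fun n : ℕ => (n : ℝ) ^ (s.re / 2) := by
    have h1 : (fun n : ℕ => ∑ k ∈ Finset.Icc 1 n, f k) =O[atTop]
        fun n : ℕ => 2 + |Real.log (n : ℝ)| := by
      refine Asymptotics.IsBigO.of_bound 1 ?_
      filter_upwards [eventually_gt_atTop 0] with n hn
      have h2 := norm_moebiusSum_le (Real.log n)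
      rw [moebiusSum, Real.exp_log (by exact_mod_cast hn), Nat.floor_natCast] at h2
      rw [one_mul, Real.norm_of_nonneg (by positivity)]
      exact h2
    refine h1.trans (Asymptotics.IsBigO.add ?_ ?_)
    · refine Asymptotics.IsBigO.of_bound 2 ?_
      filter_upwards [eventually_ge_atTop 1] with n hn
      have h3 : (1 : ℝ) ≤ (n : ℝ) ^ (s.re / 2) :=
        Real.one_le_rpow (by exact_mod_cast hn) (by linarith)
      rw [Real.norm_of_nonneg (by norm_num), Real.norm_of_nonneg (by linarith)]
      linarith
    · exact ((isLittleO_log_rpow_atTop (half_pos hs)).isBigO.comp_tendsto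
        tendsto_natCast_atTop_atTop).abs_left
  have h1 := LSeries_eq_mul_integral f (half_pos hs).le (by linarith) hsum hO
  rw [hL] at h1
  have h2 := mul_left_cancel₀ hs0 h1
  rw [h2]
  have himg : Set.Ioi (0 : ℝ) = Real.exp '' Set.univ := by
    rw [Set.image_univ, Real.range_exp]
  have h3 := MeasureTheory.integral_image_eq_integral_abs_deriv_smul (s := Set.univ)
    MeasurableSet.univ (fun x _ => (Real.hasDerivAt_exp x).hasDerivWithinAt)
    Real.exp_injective.injOn
    (fun t : ℝ => (∑ k ∈ Finset.Icc 1 ⌊t⌋₊, f k) * (t : ℂ) ^ (-(s + 1)))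
  rw [← himg, MeasureTheory.setIntegral_univ] at h3
  have h4 : ∫ t in Set.Ioi (1 : ℝ), (∑ k ∈ Finset.Icc 1 ⌊t⌋₊, f k) * (t : ℂ) ^ (-(s + 1))
      = ∫ t in Set.Ioi (0 : ℝ), (∑ k ∈ Finset.Icc 1 ⌊t⌋₊, f k) * (t : ℂ) ^ (-(s + 1)) := by
    rw [← MeasureTheory.integral_Ici_eq_integral_Ioi]
    refine (MeasureTheory.setIntegral_eq_of_subset_of_forall_sdiff_eq_zero measurableSet_Ioi
      (fun t ht => lt_of_lt_of_le one_pos ht) fun t ht => ?_).symm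
    have : ⌊t⌋₊ = 0 := Nat.floor_eq_zero.2 (not_le.1 fun h => ht.2 h)
    simp [this]
  rw [h4, h3]
  refine MeasureTheory.integral_congr_ae (Eventually.of_forall fun u => ?_)
  simp only
  rw [abs_of_pos (Real.exp_pos u), Complex.real_smul, moebiusSum]
  have h5 : ((Real.exp u : ℝ) : ℂ) ^ (-(s + 1)) = Complex.exp (-(s * u)) * Complex.exp (-u) := by
    rw [Complex.cpow_def_of_ne_zero (by exact_mod_cast (Real.exp_pos u).ne'),
      ← Complex.ofReal_log (Real.exp_pos u).le, Real.log_exp, ← Complex.exp_add]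
    congr 1; ring
  have h6 : Complex.exp (u : ℂ) * Complex.exp (-u) = 1 := by rw [← Complex.exp_add]; simp
  rw [h5, Complex.ofReal_exp]
  linear_combination (-(∑ k ∈ Finset.Icc 1 ⌊Real.exp u⌋₊, f k) * Complex.exp (-(s * u))) * h6

section

open Filter Topology SchwartzMap
open scoped FourierTransform

theorem integrable_moebiusSum_mul_exp {ε : ℝ} (hε : 0 < ε) :
    MeasureTheory.Integrable (fun u : ℝ => ‖moebiusSum u‖ * Real.exp (-(ε * u))) := by
  have h1 : MeasureTheory.IntegrableOn (fun u : ℝ => (2 + u) * Real.exp (-(ε * u))) (Set.Ioi 0) := by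
    have h2 := integrableOn_rpow_mul_exp_neg_mul_rpow (p := 1) (s := 0) (b := ε) (by norm_num)
      one_pos hε
    have h3 := integrableOn_rpow_mul_exp_neg_mul_rpow (p := 1) (s := 1) (b := ε) (by norm_num)
      one_pos hε
    have h4 : MeasureTheory.IntegrableOn (fun u : ℝ => 2 * (u ^ (0 : ℝ) * Real.exp (-ε * u ^ (1 : ℝ)))
        + u ^ (1 : ℝ) * Real.exp (-ε * u ^ (1 : ℝ))) (Set.Ioi 0) := (h2.const_mul 2).add h3
    refine h4.congr_fun (fun u hu => ?_) measurableSet_Ioi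
    simp only [Real.rpow_zero, Real.rpow_one, neg_mul]
    ring
  have h2 : MeasureTheory.IntegrableOn (fun u : ℝ => ‖moebiusSum u‖ * Real.exp (-(ε * u)))
      (Set.Ici 0) := by
    rw [integrableOn_Ici_iff_integrableOn_Ioi]
    refine h1.mono' ?_ ?_
    · exact (measurable_moebiusSum.norm.mul (by fun_prop)).aestronglyMeasurable
    · refine (MeasureTheory.ae_restrict_iff' measurableSet_Ioi).2 (Eventually.of_forall fun u hu => ?_)
      have := norm_moebiusSum_le u
      rw [abs_of_pos hu] at this
      rw [Real.norm_of_nonneg (by positivity)]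
      gcongr
  rw [← MeasureTheory.integrableOn_univ]
  refine h2.of_forall_sdiff_eq_zero MeasurableSet.univ fun u hu => ?_
  have : u < 0 := not_le.1 fun h => hu.2 h
  simp [moebiusSum_of_neg this]

theorem fourierInv_eq_integral (ψ : 𝓢(ℝ, ℂ)) (x : ℝ) :
    (𝓕⁻ ψ) x = ∫ t : ℝ, Complex.exp (2 * Real.pi * t * x * Complex.I) * ψ t := by
  rw [SchwartzMap.fourierInv_coe, Real.fourierInv_eq']
  refine MeasureTheory.integral_congr_ae (Eventually.of_forall fun t => ?_)
  simp only [RCLike.inner_apply, conj_trivial, smul_eq_mul]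
  congr 2
  push_cast; ring

/-- Fubini, legitimate because e^{-εu} dominates the linear growth of `moebiusSum`. Smoothing on the
u side becomes a test function on the line Re s = ε. -/
theorem integral_laplace_mul_schwartz (ψ : 𝓢(ℝ, ℂ)) {l ε : ℝ} (hε : 0 < ε) (v : ℝ) :
    ∫ t : ℝ, (riemannZeta₁ (1 + (ε + 2 * Real.pi * (l * t) * Complex.I)))⁻¹
        * (Complex.exp (2 * Real.pi * t * (l * v) * Complex.I) * ψ t)
      = ∫ u : ℝ, moebiusSum u * Complex.exp (-(ε * u)) * (𝓕⁻ ψ) (l * (v - u)) := by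
  set F : ℝ → ℝ → ℂ := fun t u =>
    moebiusSum u * Complex.exp (-((ε + 2 * Real.pi * (l * t) * Complex.I) * u))
      * (Complex.exp (2 * Real.pi * t * (l * v) * Complex.I) * ψ t) with hF
  have hL : ∀ t : ℝ, (riemannZeta₁ (1 + (ε + 2 * Real.pi * (l * t) * Complex.I)))⁻¹
        * (Complex.exp (2 * Real.pi * t * (l * v) * Complex.I) * ψ t) = ∫ u, F t u := by
    intro t
    rw [← integral_moebiusSum_mul_exp (by simpa using hε), ← MeasureTheory.integral_mul_const]
  have hR : ∀ u : ℝ, moebiusSum u * Complex.exp (-(ε * u)) * (𝓕⁻ ψ) (l * (v - u))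
      = ∫ t, F t u := by
    intro u
    rw [fourierInv_eq_integral, ← MeasureTheory.integral_const_mul]
    refine MeasureTheory.integral_congr_ae (Eventually.of_forall fun t => ?_)
    simp only [hF]
    have : Complex.exp (-((ε + 2 * Real.pi * (l * t) * Complex.I) * u))
        * Complex.exp (2 * Real.pi * t * (l * v) * Complex.I)
        = Complex.exp (-(ε * u))
          * Complex.exp (2 * Real.pi * t * ((l * (v - u) : ℝ) : ℂ) * Complex.I) := by
      rw [← Complex.exp_add, ← Complex.exp_add]
      congr 1; push_cast; ring
    linear_combination (-moebiusSum u * ψ t) * this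
  simp only [hL, hR]
  refine MeasureTheory.integral_integral_swap ?_
  have hprod := (ψ.integrable (μ := MeasureTheory.volume)).norm.mul_prod
    (integrable_moebiusSum_mul_exp hε)
  refine hprod.mono' ?_ (Eventually.of_forall ?_)
  · refine Measurable.aestronglyMeasurable ?_
    have h1 := measurable_moebiusSum
    have h2 := ψ.continuous.measurable
    simp only [Function.uncurry_def, hF]
    refine ((h1.comp measurable_snd).mul ?_).mul (Measurable.mul ?_ (h2.comp measurable_fst))
    · fun_prop
    · fun_prop
  · rintro ⟨t, u⟩
    simp only [Function.uncurry_apply_pair, hF, norm_mul, Complex.norm_exp]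
    apply le_of_eq
    simp
    ring

/-- The compact support of ψ keeps t bounded, and ζ has no zeros on Re s = 1, so the integrand is
uniformly bounded as the line moves to Re s = 0. -/
theorem tendsto_integral_laplace_mul_schwartz (ψ : 𝓢(ℝ, ℂ)) (hψ : HasCompactSupport ψ)
    (l v : ℝ) :
    Tendsto (fun ε : ℝ => ∫ t : ℝ, (riemannZeta₁ (1 + (ε + 2 * Real.pi * (l * t) * Complex.I)))⁻¹
        * (Complex.exp (2 * Real.pi * t * (l * v) * Complex.I) * ψ t)) (𝓝[>] 0)
      (𝓝 (∫ t : ℝ, (riemannZeta₁ (1 + ((0 : ℝ) + 2 * Real.pi * (l * t) * Complex.I)))⁻¹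
        * (Complex.exp (2 * Real.pi * t * (l * v) * Complex.I) * ψ t))) := by
  have hne : ∀ ε t : ℝ, 0 ≤ ε → riemannZeta₁ (1 + (ε + 2 * Real.pi * (l * t) * Complex.I)) ≠ 0 :=
    fun ε t hε => riemannZeta₁_ne_zero_of_one_le_re (by simpa using hε)
  have hcont : Continuous fun p : ℝ × ℝ =>
      riemannZeta₁ (1 + (p.1 + 2 * Real.pi * (l * p.2) * Complex.I)) :=
    differentiable_riemannZeta₁.continuous.comp (by fun_prop)
  have hK : IsCompact (Set.Icc (0 : ℝ) 1 ×ˢ tsupport ψ) := isCompact_Icc.prod hψ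
  obtain ⟨B, hB⟩ := hK.exists_bound_of_continuousOn
    (f := fun p : ℝ × ℝ => (riemannZeta₁ (1 + (p.1 + 2 * Real.pi * (l * p.2) * Complex.I)))⁻¹)
    (hcont.continuousOn.inv₀ fun p hp => hne p.1 p.2 hp.1.1)
  have hIoc : Set.Ioc (0 : ℝ) 1 ∈ 𝓝[>] (0 : ℝ) := Ioc_mem_nhdsGT one_pos
  refine MeasureTheory.tendsto_integral_filter_of_dominated_convergence (fun t => B * ‖ψ t‖) ?_ ?_
    ((ψ.integrable (μ := MeasureTheory.volume)).norm.const_mul B) (Eventually.of_forall fun t => ?_)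
  · filter_upwards [hIoc] with ε hε
    have h1 : Continuous fun t : ℝ => riemannZeta₁ (1 + (ε + 2 * Real.pi * (l * t) * Complex.I)) :=
      differentiable_riemannZeta₁.continuous.comp (by fun_prop)
    have h2 := ψ.continuous
    exact ((h1.inv₀ fun t => hne ε t hε.1.le).mul (by fun_prop)).aestronglyMeasurable
  · filter_upwards [hIoc] with ε hε
    refine Eventually.of_forall fun t => ?_
    rw [norm_mul, norm_mul, Complex.norm_exp]
    by_cases ht : t ∈ tsupport ψ
    · have := hB (ε, t) ⟨⟨hε.1.le, hε.2⟩, ht⟩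
      simp only at this
      have h0 : (2 * Real.pi * t * (l * v) * Complex.I : ℂ).re = 0 := by simp
      rw [h0, Real.exp_zero, one_mul]
      gcongr
    · simp [image_eq_zero_of_notMem_tsupport ht]
  · refine Tendsto.mul_const _ (tendsto_nhdsWithin_of_tendsto_nhds ?_)
    have h1 : Continuous fun ε : ℝ => riemannZeta₁ (1 + (ε + 2 * Real.pi * (l * t) * Complex.I)) :=
      differentiable_riemannZeta₁.continuous.comp (by fun_prop)
    exact (h1.tendsto 0).inv₀ (hne 0 t le_rfl)

theorem integrable_abs_mul_schwartz (k : 𝓢(ℝ, ℂ)) {l : ℝ} (hl : 0 < l) (v : ℝ) :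
    MeasureTheory.Integrable (fun u : ℝ => |v - u| * ‖k (l * (v - u))‖) := by
  have h := ((k.integrable_pow_mul MeasureTheory.volume 1).comp_mul_left' hl.ne').comp_sub_left v
  refine (h.const_mul l⁻¹).congr (Eventually.of_forall fun u => ?_)
  simp [abs_of_pos hl]
  field_simp

theorem integrable_schwartz_comp (k : 𝓢(ℝ, ℂ)) {l : ℝ} (hl : 0 < l) (v : ℝ) :
    MeasureTheory.Integrable (fun u : ℝ => k (l * (v - u))) :=
  ((k.integrable (μ := MeasureTheory.volume)).comp_mul_left' hl.ne').comp_sub_left v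

theorem integrable_moebiusSum_mul_schwartz (k : 𝓢(ℝ, ℂ)) {l : ℝ} (hl : 0 < l) (v : ℝ) :
    MeasureTheory.Integrable (fun u : ℝ => (2 + |u|) * ‖k (l * (v - u))‖) := by
  have h1 := (integrable_schwartz_comp k hl v).norm.const_mul (2 + |v|)
  refine (h1.add (integrable_abs_mul_schwartz k hl v)).mono' ?_ (Eventually.of_forall fun u => ?_)
  · have := k.continuous
    exact Continuous.aestronglyMeasurable (by fun_prop)
  · rw [Real.norm_of_nonneg (by positivity)]
    simp only [Pi.add_apply]
    have : |u| ≤ |v| + |v - u| := by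
      have := abs_sub_abs_le_abs_sub u v
      rw [abs_sub_comm] at this
      linarith
    nlinarith [norm_nonneg (k (l * (v - u)))]

theorem tendsto_integral_moebiusSum_mul_schwartz (k : 𝓢(ℝ, ℂ)) {l : ℝ} (hl : 0 < l) (v : ℝ) :
    Tendsto (fun ε : ℝ => ∫ u : ℝ, moebiusSum u * Complex.exp (-(ε * u)) * k (l * (v - u)))
      (𝓝[>] 0) (𝓝 (∫ u : ℝ, moebiusSum u * k (l * (v - u)))) := by
  have hk := k.continuous
  refine MeasureTheory.tendsto_integral_filter_of_dominated_convergence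
    (fun u => (2 + |u|) * ‖k (l * (v - u))‖) ?_ ?_ (integrable_moebiusSum_mul_schwartz k hl v)
    (Eventually.of_forall fun u => ?_)
  · refine Eventually.of_forall fun ε => ?_
    have h1 : Measurable fun u : ℝ => Complex.exp (-(ε * u)) := by fun_prop
    have h2 : Measurable fun u : ℝ => k (l * (v - u)) := by fun_prop
    exact ((measurable_moebiusSum.mul h1).mul h2).aestronglyMeasurable
  · filter_upwards [self_mem_nhdsWithin] with ε hε
    refine Eventually.of_forall fun u => ?_
    rw [norm_mul, norm_mul, Complex.norm_exp]
    refine mul_le_mul_of_nonneg_right ?_ (norm_nonneg _)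
    rcases lt_or_ge u 0 with hu | hu
    · rw [moebiusSum_of_neg hu]; simp; positivity
    · refine (mul_le_of_le_one_right (norm_nonneg _) ?_).trans (norm_moebiusSum_le u)
      have : (0 : ℝ) ≤ ε * u := mul_nonneg (le_of_lt hε) hu
      simpa using this
  · refine Tendsto.mul_const _ (tendsto_nhdsWithin_of_tendsto_nhds ?_)
    have h1 : Continuous fun ε : ℝ => moebiusSum u * Complex.exp (-(ε * u)) := by fun_prop
    simpa using h1.tendsto 0

/-- Letting ε → 0 in `integral_laplace_mul_schwartz` exhibits the smoothed sum as a Fourier integral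
of an integrable function at frequency proportional to v, and the Riemann–Lebesgue lemma applies. -/
theorem tendsto_moebiusSum_convolution (ψ : 𝓢(ℝ, ℂ)) (hψ : HasCompactSupport ψ) {l : ℝ}
    (hl : 0 < l) :
    Tendsto (fun v : ℝ => ∫ u : ℝ, moebiusSum u * (𝓕⁻ ψ) (l * (v - u))) atTop (𝓝 0) := by
  have h1 : ∀ v : ℝ, ∫ u : ℝ, moebiusSum u * (𝓕⁻ ψ) (l * (v - u))
      = ∫ t : ℝ, (riemannZeta₁ (1 + ((0 : ℝ) + 2 * Real.pi * (l * t) * Complex.I)))⁻¹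
        * (Complex.exp (2 * Real.pi * t * (l * v) * Complex.I) * ψ t) := by
    intro v
    refine tendsto_nhds_unique (tendsto_integral_moebiusSum_mul_schwartz (𝓕⁻ ψ) hl v) ?_
    refine (tendsto_integral_laplace_mul_schwartz ψ hψ l v).congr' ?_
    filter_upwards [self_mem_nhdsWithin] with ε hε using integral_laplace_mul_schwartz ψ hε v
  simp only [h1]
  have h2 := Real.tendsto_integral_exp_smul_cocompact (fun t : ℝ =>
    (riemannZeta₁ (1 + ((0 : ℝ) + 2 * Real.pi * (l * t) * Complex.I)))⁻¹ * ψ t)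
  have h3 : Tendsto (fun v : ℝ => -(l * v)) atTop (cocompact ℝ) :=
    (tendsto_neg_atTop_atBot.comp (tendsto_id.const_mul_atTop hl)).mono_right atBot_le_cocompact
  refine (h2.comp h3).congr fun v => ?_
  refine MeasureTheory.integral_congr_ae (Eventually.of_forall fun t => ?_)
  simp only [Circle.smul_def, Real.fourierChar_apply, smul_eq_mul]
  have h4 : Complex.exp (((2 * Real.pi * -(t * -(l * v)) : ℝ) : ℂ) * Complex.I)
      = Complex.exp (2 * Real.pi * t * (l * v) * Complex.I) := by
    congr 1; push_cast; ring
  rw [h4]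
  ring

/-- Unsmoothing: with a kernel of mass 1 concentrated at scale 1/l, slow oscillation makes
`moebiusSum v` differ from its smoothed value by O(1/l) plus an exponentially small term. One fixes
l large and then lets v → ∞. -/
theorem tendsto_moebiusSum : Tendsto moebiusSum atTop (𝓝 0) := by
  obtain ⟨φ⟩ : Nonempty (ContDiffBump (0 : ℝ)) := inferInstance
  have hφc : HasCompactSupport (fun t : ℝ => ((φ t : ℝ) : ℂ)) :=
    φ.hasCompactSupport.comp_left (g := ((↑) : ℝ → ℂ)) Complex.ofReal_zero
  set ψ : 𝓢(ℝ, ℂ) := hφc.toSchwartzMap (Complex.ofRealCLM.contDiff.comp φ.contDiff) with hψdef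
  have hψ : HasCompactSupport ψ := hφc
  set k : 𝓢(ℝ, ℂ) := 𝓕⁻ ψ with hk
  -- The mass of k is the value at 0 of its Fourier transform ψ, a bump equal to 1 there.
  have hkint : ∫ x, k x = 1 := by
    have h1 : (𝓕 k) 0 = ψ 0 := by rw [hk, FourierTransform.fourier_fourierInv_eq]
    rw [SchwartzMap.fourier_coe, Real.fourier_eq'] at h1
    have h2 : ψ 0 = 1 := by
      change ((φ 0 : ℝ) : ℂ) = 1
      rw [φ.one_of_mem_closedBall (by simpa using φ.rIn_pos.le)]
      simp
    rw [h2] at h1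
    simpa using h1
  set K₀ := ∫ x, ‖k x‖ with hK₀
  set K₁ := ∫ x, |x| * ‖k x‖ with hK₁
  have hK₀0 : 0 ≤ K₀ := MeasureTheory.integral_nonneg fun _ => norm_nonneg _
  have hK₁0 : 0 ≤ K₁ := MeasureTheory.integral_nonneg fun _ => by positivity
  have main : ∀ l : ℝ, 0 < l → ∀ v : ℝ, 2 ≤ v →
      ‖moebiusSum v‖ ≤ l * ‖∫ u : ℝ, moebiusSum u * k (l * (v - u))‖
        + (2 * K₁ / l + Real.exp (-(v / 2)) * K₀) := by
    intro l hl v hv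
    have hs : ∀ f : ℝ → ℂ, l * ∫ u : ℝ, f (l * (v - u)) = ∫ x, f x := by
      intro f
      rw [MeasureTheory.integral_sub_left_eq_self (fun u => f (l * u)),
        MeasureTheory.Measure.integral_comp_mul_left, abs_of_pos (inv_pos.2 hl), Complex.real_smul,
        ← mul_assoc]
      push_cast
      rw [mul_inv_cancel₀ (by exact_mod_cast hl.ne'), one_mul]
    have hs' : ∀ f : ℝ → ℝ, l * ∫ u : ℝ, f (l * (v - u)) = ∫ x, f x := by
      intro f
      rw [MeasureTheory.integral_sub_left_eq_self (fun u => f (l * u)),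
        MeasureTheory.Measure.integral_comp_mul_left, abs_of_pos (inv_pos.2 hl), smul_eq_mul,
        ← mul_assoc, mul_inv_cancel₀ hl.ne', one_mul]
    have hint1 := integrable_schwartz_comp k hl v
    have hint2 : MeasureTheory.Integrable (fun u : ℝ => moebiusSum u * k (l * (v - u))) := by
      refine (integrable_moebiusSum_mul_schwartz k hl v).mono' ?_ (Eventually.of_forall fun u => ?_)
      · have := k.continuous
        have h2 : Measurable fun u : ℝ => k (l * (v - u)) := by fun_prop
        exact (measurable_moebiusSum.mul h2).aestronglyMeasurable
      · rw [norm_mul]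
        gcongr
        exact norm_moebiusSum_le u
    have h1 : moebiusSum v = l * (∫ u : ℝ, moebiusSum u * k (l * (v - u)))
        + l * ∫ u : ℝ, (moebiusSum v - moebiusSum u) * k (l * (v - u)) := by
      have h2 : ∫ u : ℝ, (moebiusSum v - moebiusSum u) * k (l * (v - u))
          = moebiusSum v * (∫ u : ℝ, k (l * (v - u)))
            - ∫ u : ℝ, moebiusSum u * k (l * (v - u)) := by
        rw [← MeasureTheory.integral_const_mul,
          ← MeasureTheory.integral_sub (hint1.const_mul _) hint2]
        simp only [sub_mul]
      have h3 := hs k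
      rw [hkint] at h3
      rw [h2]
      linear_combination (-moebiusSum v) * h3
    have h4 : ‖∫ u : ℝ, (moebiusSum v - moebiusSum u) * k (l * (v - u))‖
        ≤ ∫ u : ℝ, (2 * (|v - u| * ‖k (l * (v - u))‖)
          + Real.exp (-(v / 2)) * ‖k (l * (v - u))‖) := by
      refine MeasureTheory.norm_integral_le_of_norm_le
        (((integrable_abs_mul_schwartz k hl v).const_mul 2).add (hint1.norm.const_mul _))
        (Eventually.of_forall fun u => ?_)
      rw [norm_mul]
      have h5 := norm_moebiusSum_sub_le u v
      -- Near v the exponential is at most e^{-v/2}; beyond distance v/2 the assumption 2 ≤ v makes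
      -- |v - u| at least 1.
      have h6 : min 1 (Real.exp (-(v - |v - u|))) ≤ |v - u| + Real.exp (-(v / 2)) := by
        rcases le_total |v - u| (v / 2) with h | h
        · refine (min_le_right _ _).trans ?_
          have := Real.exp_le_exp.2 (by linarith : -(v - |v - u|) ≤ -(v / 2))
          linarith [abs_nonneg (v - u)]
        · refine (min_le_left _ _).trans ?_
          linarith [Real.exp_pos (-(v / 2))]
      nlinarith [norm_nonneg (k (l * (v - u)))]
    rw [MeasureTheory.integral_add ((integrable_abs_mul_schwartz k hl v).const_mul 2)
      (hint1.norm.const_mul _), MeasureTheory.integral_const_mul,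
      MeasureTheory.integral_const_mul] at h4
    have h7 : l * ∫ u : ℝ, ‖k (l * (v - u))‖ = K₀ := hs' fun x => ‖k x‖
    have h8 : l * ∫ u : ℝ, |v - u| * ‖k (l * (v - u))‖ = K₁ / l := by
      have h9 := hs' fun x => |x| * ‖k x‖
      simp only [abs_mul, abs_of_pos hl, mul_assoc, MeasureTheory.integral_const_mul] at h9
      rw [eq_div_iff hl.ne', hK₁, ← h9]
      ring
    calc ‖moebiusSum v‖ ≤ l * ‖∫ u : ℝ, moebiusSum u * k (l * (v - u))‖
          + l * ‖∫ u : ℝ, (moebiusSum v - moebiusSum u) * k (l * (v - u))‖ := by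
          nth_rewrite 1 [h1]
          refine (norm_add_le _ _).trans (le_of_eq ?_)
          rw [norm_mul, norm_mul, Complex.norm_real, Real.norm_of_nonneg hl.le]
      _ ≤ l * ‖∫ u : ℝ, moebiusSum u * k (l * (v - u))‖
          + l * (2 * (∫ u : ℝ, |v - u| * ‖k (l * (v - u))‖)
            + Real.exp (-(v / 2)) * ∫ u : ℝ, ‖k (l * (v - u))‖) := by gcongr
      _ = l * ‖∫ u : ℝ, moebiusSum u * k (l * (v - u))‖
          + (2 * (l * ∫ u : ℝ, |v - u| * ‖k (l * (v - u))‖)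
            + Real.exp (-(v / 2)) * (l * ∫ u : ℝ, ‖k (l * (v - u))‖)) := by ring
      _ = _ := by rw [h7, h8]; ring
  rw [tendsto_zero_iff_norm_tendsto_zero]
  rw [Metric.tendsto_nhds]
  intro δ hδ
  -- This gives 2K₁/l ≤ δ/3; the added 1 keeps l positive even if K₁ = 0.
  set l := 2 * K₁ / (δ / 3) + 1 with hl
  have hl0 : 0 < l := by positivity
  have hl1 : 2 * K₁ / l ≤ δ / 3 := by
    rw [div_le_iff₀ hl0, hl]
    have : δ / 3 * (2 * K₁ / (δ / 3)) = 2 * K₁ := by field_simp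
    nlinarith
  have h1 : Tendsto (fun v : ℝ => l * ‖∫ u : ℝ, moebiusSum u * k (l * (v - u))‖) atTop (𝓝 0) := by
    simpa using (tendsto_moebiusSum_convolution ψ hψ hl0).norm.const_mul l
  have h2 : Tendsto (fun v : ℝ => Real.exp (-(v / 2)) * K₀) atTop (𝓝 0) := by
    have : Tendsto (fun v : ℝ => Real.exp (-(v / 2))) atTop (𝓝 0) :=
      Real.tendsto_exp_atBot.comp
        (tendsto_neg_atTop_atBot.comp (tendsto_id.atTop_div_const two_pos))
    simpa using this.mul_const K₀
  filter_upwards [h1.eventually_lt_const (by positivity : 0 < δ / 3),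
    h2.eventually_lt_const (by positivity : 0 < δ / 3), eventually_ge_atTop 2] with v h1 h2 hv
  rw [dist_zero_right, norm_norm]
  have := main l hl0 v hv
  linarith

end

/-! ### Brackets of zeros and the heights that separate them. -/

theorem bracketRadius_pos (A : ℝ) (ρ : ℂ) : 0 < bracketRadius A ρ := Real.exp_pos _

/-- Since log y ≤ 2√y, the radius decays faster than any power of the height, which is all the
measure argument needs. -/
theorem bracketRadius_le {A y : ℝ} (hA : 0 < A) (hy : 2 ≤ y) {ρ : ℂ} (h : y ≤ |ρ.im|) :
    bracketRadius A ρ ≤ Real.exp (-(A / 2 * √y)) := by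
  have hpos : 0 < |ρ.im| := by linarith
  have hlog : 0 < Real.log |ρ.im| := Real.log_pos (by linarith)
  have h1 : Real.log |ρ.im| ≤ 2 * √|ρ.im| := by
    have h2 := Real.log_le_sub_one_of_pos (Real.sqrt_pos.2 hpos)
    rw [Real.log_sqrt hpos.le] at h2
    linarith
  have h3 : √y ≤ √|ρ.im| := Real.sqrt_le_sqrt h
  unfold bracketRadius
  rw [Real.exp_le_exp, neg_div, neg_le_neg_iff, le_div_iff₀ hlog]
  calc A / 2 * √y * Real.log |ρ.im| ≤ A / 2 * √|ρ.im| * (2 * √|ρ.im|) := by gcongr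
    _ = A * (√|ρ.im| * √|ρ.im|) := by ring
    _ = A * |ρ.im| := by rw [Real.mul_self_sqrt hpos.le]

theorem finite_nontrivialZeros_abs_im_le (T : ℝ) :
    {ρ | ρ ∈ nontrivialZeros ∧ |ρ.im| ≤ T}.Finite := by
  have hc : IsCompact (Set.Icc (0 : ℝ) 1 ×ℂ Set.Icc (-T) T) :=
    isCompact_Icc.reProdIm isCompact_Icc
  refine hc.inter_riemannZetaZeros_finite.subset ?_
  rintro ρ ⟨h, hT⟩
  have h1 := abs_le.mp hT
  exact ⟨⟨⟨h.2.1.le, h.2.2.le⟩, ⟨h1.1, h1.2⟩⟩, h.1⟩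

/-- For small ordinates the logarithm in the radius may be negative or zero, so no uniform formula
applies; there only finitely many zeros are concerned. -/
theorem exists_bracketRadius_bound {A : ℝ} (hA : 0 < A) :
    ∃ R : ℝ, ∀ ρ ∈ nontrivialZeros, bracketRadius A ρ ≤ R := by
  obtain ⟨R, hR⟩ := ((finite_nontrivialZeros_abs_im_le 2).image (bracketRadius A)).bddAbove
  refine ⟨max R 1, fun ρ hρ => ?_⟩
  rcases le_total |ρ.im| 2 with h | h
  · exact (hR ⟨ρ, ⟨hρ, h⟩, rfl⟩).trans (le_max_left _ _)
  · refine (bracketRadius_le hA le_rfl h).trans ((Real.exp_le_one_iff.2 ?_).trans (le_max_right _ _))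
    have : 0 ≤ A / 2 * √2 := by positivity
    linarith

/-- A zero in the right half of the critical strip with a given absolute ordinate. -/
theorem exists_nontrivialZero_im_eq_abs {ρ : ℂ} (h : ρ ∈ nontrivialZeros) :
    ∃ ρ' ∈ nontrivialZeros, ρ'.im = |ρ.im| ∧ 1 / 2 ≤ ρ'.re := by
  have key : ∀ ρ ∈ nontrivialZeros, 1 / 2 ≤ ρ.re →
      ∃ ρ' ∈ nontrivialZeros, ρ'.im = |ρ.im| ∧ 1 / 2 ≤ ρ'.re := by
    intro ρ h hre
    rcases abs_choice ρ.im with h1 | h1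
    · exact ⟨ρ, h, h1.symm, hre⟩
    · exact ⟨_, conj_mem_nontrivialZeros h, by simp [h1], by simpa using hre⟩
  rcases le_total (1 / 2) ρ.re with hre | hre
  · exact key ρ h hre
  · obtain ⟨ρ', h1, h2, h3⟩ := key (1 - ρ) (one_sub_mem_nontrivialZeros h) (by simp; linarith)
    exact ⟨ρ', h1, by simpa using h2, h3⟩

/-- The intervals of radius δ about the ordinates have total length below 1 and cannot cover an
interval of length 1. -/
theorem exists_far_from_finset (Z : Finset ℂ) {a δ : ℝ} (h : Z.card * (2 * δ) < 1) :
    ∃ t ∈ Set.Icc a (a + 1), ∀ ρ ∈ Z, δ ≤ |ρ.im - t| := by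
  by_contra hcon
  push Not at hcon
  have hsub : Set.Icc a (a + 1) ⊆ ⋃ ρ ∈ Z, Metric.ball ρ.im δ := by
    intro t ht
    obtain ⟨ρ, hρ, h1⟩ := hcon t ht
    simp only [Set.mem_iUnion, Metric.mem_ball, exists_prop]
    exact ⟨ρ, hρ, by rwa [Real.dist_eq, abs_sub_comm]⟩
  have h1 := (MeasureTheory.measure_mono (μ := MeasureTheory.volume) hsub).trans
    (MeasureTheory.measure_biUnion_finset_le Z _)
  simp only [Real.volume_Icc, Real.volume_ball, Finset.sum_const, add_sub_cancel_left,
    nsmul_eq_mul] at h1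
  rw [← ENNReal.ofReal_natCast, ← ENNReal.ofReal_mul (Nat.cast_nonneg _),
    ENNReal.ofReal_le_ofReal_iff'] at h1
  rcases h1 with h1 | h1 <;> linarith

/-- Zeros fall in three ranges. Those below T/2 have bounded radius and are far away. Those near T
number O(log T) with tiny radii, so a height t can avoid them all. The others above T/2 lie at
distance at least 9/10 - 1/2 = 2/5 from t, which exceeds their radius. -/
theorem eventually_exists_uncovered {A : ℝ} (hA : 0 < A) :
    ∀ᶠ T : ℝ in atTop, ∃ t ∈ Set.Icc (T - 1) T, Uncovered A t := by
  obtain ⟨C, hC, hZ⟩ := exists_zeros_near_height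
  obtain ⟨R, hR⟩ := exists_bracketRadius_bound hA
  have hsq : Tendsto (fun T : ℝ => √(T / 2)) atTop atTop :=
    Real.tendsto_sqrt_atTop.comp (tendsto_id.atTop_div_const two_pos)
  have h1 : ∀ᶠ u : ℝ in atTop, ‖u ^ 2‖ ≤ 1 / (8 * C) * ‖Real.exp (A / 2 * u)‖ :=
    (isLittleO_pow_exp_pos_mul_atTop 2 (by positivity : 0 < A / 2)).def (by positivity)
  have h2 : ∀ᶠ u : ℝ in atTop, Real.exp (-(A / 2 * u)) ≤ 2 / 5 := by
    have : Tendsto (fun u : ℝ => Real.exp (-(A / 2 * u))) atTop (𝓝 0) :=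
      Real.tendsto_exp_atBot.comp
        (tendsto_neg_atTop_atBot.comp (tendsto_id.const_mul_atTop (by positivity)))
    exact this.eventually_le_const (by norm_num)
  filter_upwards [hsq.eventually h1, hsq.eventually h2, eventually_ge_atTop 5,
    eventually_ge_atTop (2 * R + 2)] with T h1 h2 hT hTR
  set δ := Real.exp (-(A / 2 * √(T / 2))) with hδ
  obtain ⟨Z, hmem, hcard, -⟩ := hZ (T - 1 / 2) (by linarith)
  have hcardδ : (Z.card : ℝ) * (2 * δ) < 1 := by
    have h3 : (Z.card : ℝ) ≤ C * T := by
      refine hcard.trans (mul_le_mul_of_nonneg_left ?_ hC.le)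
      have := Real.log_le_sub_one_of_pos (by linarith : 0 < T - 1 / 2)
      linarith
    rw [Real.norm_of_nonneg (by positivity), Real.sq_sqrt (by linarith),
      Real.norm_of_nonneg (Real.exp_pos _).le] at h1
    have h4 : Real.exp (A / 2 * √(T / 2)) * δ = 1 := by rw [hδ, ← Real.exp_add]; simp
    have hδ0 : 0 < δ := Real.exp_pos _
    have h5 : T / 2 * δ ≤ 1 / (8 * C) := by
      calc T / 2 * δ ≤ 1 / (8 * C) * Real.exp (A / 2 * √(T / 2)) * δ := by gcongr
        _ = _ := by rw [mul_assoc, h4, mul_one]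
    calc (Z.card : ℝ) * (2 * δ) ≤ C * T * (2 * δ) := by gcongr
      _ = 4 * C * (T / 2 * δ) := by ring
      _ ≤ 4 * C * (1 / (8 * C)) := by gcongr
      _ < 1 := by field_simp; norm_num
  obtain ⟨t, ht, hfar⟩ := exists_far_from_finset Z (a := T - 1) hcardδ
  rw [sub_add_cancel] at ht
  refine ⟨t, ht, fun ρ hρ => ?_⟩
  rcases lt_or_ge |ρ.im| (T / 2) with hlt | hge
  · refine (hR ρ hρ).trans ?_
    rw [abs_sub_comm]
    refine le_trans ?_ (le_abs_self _)
    linarith [ht.1]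
  have hrad : bracketRadius A ρ ≤ δ := bracketRadius_le hA (by linarith) hge
  rcases le_total |(|ρ.im| - (T - 1 / 2))| (9 / 10) with hnear | hnotnear
  · obtain ⟨ρ', h3, h4, h5⟩ := exists_nontrivialZero_im_eq_abs hρ
    rw [← h4] at hnear ⊢
    refine hrad.trans (hfar ρ' ((hmem ρ').2 ⟨?_, ?_⟩))
    · rw [riemannZeta₁_eq_sub_mul (ne_one_of_mem_nontrivialZeros h3), h3.1, mul_zero]
    · refine (sq_le_sq₀ (norm_nonneg _) (by norm_num)).1 ?_
      rw [← Complex.normSq_eq_norm_sq, Complex.normSq_apply]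
      have h6 := abs_le.1 hnear
      have h7 := h3.2.2
      simp
      nlinarith
  · refine hrad.trans (h2.trans ?_)
    have h3 : |t - (T - 1 / 2)| ≤ 1 / 2 := abs_le.2 ⟨by linarith [ht.1], by linarith [ht.2]⟩
    have h4 := abs_sub_abs_le_abs_sub (|ρ.im| - (T - 1 / 2)) (t - (T - 1 / 2))
    rw [sub_sub_sub_cancel_right] at h4
    linarith

/-- Two zeros on opposite sides of M are separated by at least the sum of their radii, so no
elementary link of a bracket crosses an uncovered height. -/
theorem abs_im_lt_iff_of_eqvGen {A M : ℝ} (hM : Uncovered A M) {ρ₁ ρ₂ : nontrivialZeros}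
    (h : Relation.EqvGen (BracketClose A) ρ₁ ρ₂) : |(ρ₁ : ℂ).im| < M ↔ |(ρ₂ : ℂ).im| < M := by
  have key : ∀ ρ₁ ρ₂ : nontrivialZeros, BracketClose A ρ₁ ρ₂ →
      |(ρ₁ : ℂ).im| < M → |(ρ₂ : ℂ).im| < M := by
    intro ρ₁ ρ₂ h h1
    by_contra h2
    have h3 := hM ρ₁ ρ₁.2
    have h4 := hM ρ₂ ρ₂.2
    rw [abs_of_nonpos (by linarith)] at h3
    rw [abs_of_nonneg (by linarith)] at h4
    have h5 := abs_sub_abs_le_abs_sub (ρ₂ : ℂ).im (ρ₁ : ℂ).im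
    rw [abs_sub_comm] at h5
    unfold BracketClose at h
    linarith
  have hsymm : ∀ ρ₁ ρ₂ : nontrivialZeros, BracketClose A ρ₁ ρ₂ → BracketClose A ρ₂ ρ₁ := by
    intro ρ₁ ρ₂ h
    unfold BracketClose at h ⊢
    rwa [abs_sub_comm, add_comm]
  induction h with
  | rel x y h => exact ⟨key x y h, key y x (hsymm x y h)⟩
  | refl x => rfl
  | symm x y _ ih => exact ih.symm
  | trans x y z _ _ ih1 ih2 => exact ih1.trans ih2

theorem finite_bracket {A : ℝ} (hA : 0 < A) (ρ : nontrivialZeros) : (bracket A ρ).Finite := by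
  obtain ⟨T, ⟨t, ht, hU⟩, hT⟩ :=
    ((eventually_exists_uncovered hA).and (eventually_gt_atTop (|(ρ : ℂ).im| + 1))).exists
  have hlt : |(ρ : ℂ).im| < t := by linarith [ht.1]
  refine Set.Finite.of_finite_image ((finite_nontrivialZeros_abs_im_le t).subset ?_)
    (f := ((↑) : nontrivialZeros → ℂ)) Subtype.val_injective.injOn
  rintro _ ⟨ρ', h, rfl⟩
  exact ⟨ρ'.2, ((abs_im_lt_iff_of_eqvGen hU h).1 hlt).le⟩

theorem mem_zerosInBracketsBelow_of_eqvGen {A T : ℝ} {ρ ρ' : nontrivialZeros}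
    (h : Relation.EqvGen (BracketClose A) ρ ρ') (hρ : (ρ : ℂ) ∈ zerosInBracketsBelow A T) :
    (ρ' : ℂ) ∈ zerosInBracketsBelow A T := by
  obtain ⟨h1, h2⟩ := hρ
  exact ⟨ρ'.2, fun ρ'' h3 => h2 ρ'' (Relation.EqvGen.trans _ _ _ h h3)⟩

/-- A zero with the same absolute ordinate as `ρ'`, on the same side of the real axis as `ρ`. -/
theorem exists_same_side (ρ ρ' : nontrivialZeros) :
    ∃ ρ'' : nontrivialZeros, |(ρ'' : ℂ).im| = |(ρ' : ℂ).im| ∧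
      |(ρ : ℂ).im - (ρ'' : ℂ).im| = |(|(ρ : ℂ).im| - |(ρ' : ℂ).im|)| := by
  by_cases h : 0 ≤ (ρ : ℂ).im * (ρ' : ℂ).im
  · refine ⟨ρ', rfl, ?_⟩
    rcases mul_nonneg_iff.1 h with ⟨h1, h2⟩ | ⟨h1, h2⟩
    · rw [abs_of_nonneg h1, abs_of_nonneg h2]
    · rw [abs_of_nonpos h1, abs_of_nonpos h2, neg_sub_neg, abs_sub_comm]
  · refine ⟨⟨_, conj_mem_nontrivialZeros ρ'.2⟩, by simp, ?_⟩
    simp only [Complex.conj_im, sub_neg_eq_add]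
    rcases mul_neg_iff.1 (not_le.1 h) with ⟨h1, h2⟩ | ⟨h1, h2⟩
    · rw [abs_of_pos h1, abs_of_neg h2, sub_neg_eq_add]
    · rw [abs_of_neg h1, abs_of_pos h2, ← abs_neg]; congr 1; ring

theorem bracketRadius_eq_of_abs_im_eq {A : ℝ} {ρ ρ' : ℂ} (h : |ρ.im| = |ρ'.im|) :
    bracketRadius A ρ = bracketRadius A ρ' := by
  simp [bracketRadius, h]

/-- Let the reach of a zero be |Im ρ| plus its radius. If all reaches in the complete brackets below
T are at most the uncovered height t ≤ T, then M = t works. Otherwise M is the largest reach, and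
its maximality makes M uncovered and forces every bracket below M to stay below T. -/
theorem eventually_zerosInBracketsBelow_eq {A : ℝ} (hA : 0 < A) :
    ∀ᶠ T : ℝ in atTop, ∃ M : ℝ, T - 1 ≤ M ∧ Uncovered A M ∧
      zerosInBracketsBelow A T = {ρ | ρ ∈ nontrivialZeros ∧ |ρ.im| < M} := by
  filter_upwards [eventually_exists_uncovered hA] with T hT
  obtain ⟨t, ht, hU⟩ := hT
  set S := (finite_zerosInBracketsBelow A T).toFinset with hS
  have hmem : ∀ ρ, ρ ∈ S ↔ ρ ∈ zerosInBracketsBelow A T := fun ρ => by simp [hS]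
  by_cases hcase : ∀ ρ ∈ S, |ρ.im| + bracketRadius A ρ ≤ t
  · refine ⟨t, ht.1, hU, Set.Subset.antisymm ?_ ?_⟩
    · intro ρ hρ
      have := hcase ρ ((hmem ρ).2 hρ)
      exact ⟨hρ.1, by linarith [bracketRadius_pos A ρ]⟩
    · rintro ρ ⟨h1, h2⟩
      exact ⟨h1, fun ρ' h3 => ((abs_im_lt_iff_of_eqvGen hU h3).1 h2).trans_le ht.2⟩
  · push Not at hcase
    obtain ⟨ρ₁, hρ₁, hgt⟩ := hcase
    obtain ⟨ρ₀, hρ₀, hmax⟩ := S.exists_max_image (fun ρ => |ρ.im| + bracketRadius A ρ) ⟨ρ₁, hρ₁⟩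
    obtain ⟨hρ₀z, hρ₀T⟩ := (hmem ρ₀).1 hρ₀
    have hρ₀lt : |ρ₀.im| < T := hρ₀T ⟨ρ₀, hρ₀z⟩ (Relation.EqvGen.refl _)
    set M := |ρ₀.im| + bracketRadius A ρ₀ with hMdef
    have hMt : t < M := hgt.trans_le (hmax ρ₁ hρ₁)
    have hUM : Uncovered A M := by
      intro ρ' hρ'
      by_contra hlt
      push Not at hlt
      obtain ⟨ρ'', h1, h2⟩ := exists_same_side ⟨ρ₀, hρ₀z⟩ ⟨ρ', hρ'⟩
      have hr := bracketRadius_eq_of_abs_im_eq (A := A) h1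
      simp only at h1 h2 hr
      -- A zero covering M would, after conjugation if needed, be linked to ρ₀. It would then belong
      -- to S with a reach beyond the maximum M.
      have hclose : BracketClose A ⟨ρ₀, hρ₀z⟩ ρ'' := by
        unfold BracketClose
        simp only
        rw [h2, hr]
        have h3 := abs_sub_le |ρ₀.im| M |ρ'.im|
        rw [abs_sub_comm M] at h3
        have h4 : |(|ρ₀.im| - M)| = bracketRadius A ρ₀ := by
          rw [hMdef, sub_add_cancel_left, abs_neg, abs_of_pos (bracketRadius_pos A ρ₀)]
        linarith
      have h5 := mem_zerosInBracketsBelow_of_eqvGen (Relation.EqvGen.rel _ _ hclose)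
        ((hmem ρ₀).1 hρ₀)
      have h6 := hmax ρ'' ((hmem ρ'').2 h5)
      rw [h1, hr] at h6
      have h7 := neg_abs_le (|ρ'.im| - M)
      linarith
    refine ⟨M, by linarith [ht.1], hUM, Set.Subset.antisymm ?_ ?_⟩
    · intro ρ hρ
      have := hmax ρ ((hmem ρ).2 hρ)
      exact ⟨hρ.1, by linarith [bracketRadius_pos A ρ]⟩
    · rintro ρ ⟨h1, h2⟩
      refine ⟨h1, fun ρ' h3 => ?_⟩
      have h4 := (abs_im_lt_iff_of_eqvGen hUM h3).1 h2
      by_contra h5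
      push Not at h5
      -- A zero of height in [T, M) lies within the radius of ρ₀, so up to conjugation it joins the
      -- bracket of ρ₀, all of which is below T.
      obtain ⟨ρ'', h6, h7⟩ := exists_same_side ⟨ρ₀, hρ₀z⟩ ρ'
      simp only at h7
      have hclose : BracketClose A ⟨ρ₀, hρ₀z⟩ ρ'' := by
        unfold BracketClose
        simp only
        rw [h7, abs_sub_comm, abs_of_nonneg (by linarith)]
        linarith [bracketRadius_pos A ρ'']
      have h8 := hρ₀T ρ'' (Relation.EqvGen.rel _ _ hclose)
      rw [h6] at h8
      linarith

/-! ### The Dirichlet inverse of σ_r and its Dirichlet series. -/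

/-- The arithmetic function `n ↦ n ^ r * μ(n)`, the Dirichlet inverse of `n ↦ n ^ r`. -/
noncomputable def powMoebius (r : ℕ) : ArithmeticFunction ℂ :=
  ⟨fun n => (n : ℂ) ^ r * (ArithmeticFunction.moebius n : ℂ), by simp⟩

theorem powMoebius_apply (r n : ℕ) :
    powMoebius r n = (n : ℂ) ^ r * (ArithmeticFunction.moebius n : ℂ) := rfl

theorem pow_mul_powMoebius {r : ℕ} (hr : r ≠ 0) :
    ((ArithmeticFunction.pow r : ArithmeticFunction ℕ) : ArithmeticFunction ℂ) * powMoebius r = 1 := by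
  ext n
  have h : ∀ x ∈ n.divisorsAntidiagonal,
      ((ArithmeticFunction.pow r : ArithmeticFunction ℕ) : ArithmeticFunction ℂ) x.1
        * powMoebius r x.2
      = (n : ℂ) ^ r * (((ArithmeticFunction.zeta : ArithmeticFunction ℕ) : ArithmeticFunction ℂ) x.1
        * ((ArithmeticFunction.moebius : ArithmeticFunction ℤ) : ArithmeticFunction ℂ) x.2) := by
    intro x hx
    obtain ⟨h1, h2⟩ := Nat.mem_divisorsAntidiagonal.1 hx
    have h3 : x.1 ≠ 0 := by rintro h3; rw [h3, zero_mul] at h1; exact h2 h1.symm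
    rw [powMoebius_apply, ArithmeticFunction.natCoe_apply, ArithmeticFunction.natCoe_apply,
      ArithmeticFunction.intCoe_apply, ArithmeticFunction.pow_apply,
      ArithmeticFunction.zeta_apply_ne h3, ← h1]
    simp [hr]
    ring
  rw [ArithmeticFunction.mul_apply, Finset.sum_congr rfl h, ← Finset.mul_sum,
    ← ArithmeticFunction.mul_apply, ArithmeticFunction.coe_zeta_mul_coe_moebius]
  by_cases hn : n = 1
  · simp [hn]
  · simp [ArithmeticFunction.one_apply_ne hn]

/-- σ_r is the convolution of ζ with n ↦ n^r, and each factor has an explicit Möbius inverse. -/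
theorem sigmaInv_eq {r : ℕ} (hr : r ≠ 0) :
    sigmaInv r
      = powMoebius r * ((ArithmeticFunction.moebius : ArithmeticFunction ℤ) : ArithmeticFunction ℂ) := by
  have h1 : (ArithmeticFunction.sigma r : ArithmeticFunction ℂ)
      * (powMoebius r
        * ((ArithmeticFunction.moebius : ArithmeticFunction ℤ) : ArithmeticFunction ℂ)) = 1 := by
    rw [← ArithmeticFunction.zeta_mul_pow_eq_sigma, ArithmeticFunction.natCoe_mul]
    calc _ = (((ArithmeticFunction.zeta : ArithmeticFunction ℕ) : ArithmeticFunction ℂ)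
          * ((ArithmeticFunction.moebius : ArithmeticFunction ℤ) : ArithmeticFunction ℂ))
          * (((ArithmeticFunction.pow r : ArithmeticFunction ℕ) : ArithmeticFunction ℂ)
            * powMoebius r) := by ring
      _ = 1 := by
        rw [pow_mul_powMoebius hr, ArithmeticFunction.coe_zeta_mul_coe_moebius, one_mul]
  calc sigmaInv r = sigmaInv r * 1 := (mul_one _).symm
    _ = ((ArithmeticFunction.sigma r : ArithmeticFunction ℂ) * sigmaInv r) * (powMoebius r
        * ((ArithmeticFunction.moebius : ArithmeticFunction ℤ) : ArithmeticFunction ℂ)) := by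
        rw [← h1]; ring
    _ = _ := by rw [sigma_mul_sigmaInv, one_mul]

theorem term_powMoebius (r : ℕ) (s : ℂ) (n : ℕ) :
    LSeries.term (fun n => powMoebius r n) s n
      = LSeries.term (fun n => (ArithmeticFunction.moebius n : ℂ)) (s - r) n := by
  rcases eq_or_ne n 0 with rfl | hn
  · simp
  · have hn' : (n : ℂ) ≠ 0 := by exact_mod_cast hn
    rw [LSeries.term_of_ne_zero hn, LSeries.term_of_ne_zero hn, powMoebius_apply,
      Complex.cpow_sub _ _ hn', Complex.cpow_natCast]
    field_simp

theorem LSeriesSummable_powMoebius {r : ℕ} {s : ℂ} (hs : r + 1 < s.re) :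
    LSeriesSummable (fun n => powMoebius r n) s := by
  have hμ : LSeriesSummable (fun n => (ArithmeticFunction.moebius n : ℂ)) (s - r) :=
    ArithmeticFunction.LSeriesSummable_moebius_iff.2 (by simp; linarith)
  unfold LSeriesSummable at hμ ⊢
  rwa [show LSeries.term (fun n => powMoebius r n) s = _ from funext (term_powMoebius r s)]

theorem LSeries_moebius_eq_zetaRecip {s : ℂ} (hs : 1 < s.re) :
    LSeries (fun n => (ArithmeticFunction.moebius n : ℂ)) s = zetaRecip s := by
  have hs1 : s ≠ 1 := by rintro rfl; simp at hs
  rw [zetaRecip, if_neg hs1, eq_div_iff (riemannZeta_ne_zero_of_one_lt_re hs),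
    ← ArithmeticFunction.LSeries_zeta_eq_riemannZeta hs, mul_comm,
    ArithmeticFunction.LSeries_zeta_mul_Lseries_moebius hs]

theorem LSeriesSummable_sigmaInv {r : ℕ} (hr : r ≠ 0) {s : ℂ} (hs : r + 1 < s.re) :
    LSeriesSummable (fun n => sigmaInv r n) s := by
  rw [sigmaInv_eq hr]
  refine ArithmeticFunction.LSeriesSummable_mul (LSeriesSummable_powMoebius hs) ?_
  simp only [ArithmeticFunction.intCoe_apply]
  exact ArithmeticFunction.LSeriesSummable_moebius_iff.2
    (by linarith [(Nat.cast_nonneg r : (0 : ℝ) ≤ r)])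

theorem LSeries_sigmaInv {r : ℕ} (hr : r ≠ 0) {s : ℂ} (hs : r + 1 < s.re) :
    LSeries (fun n => sigmaInv r n) s = zetaRecip (s - r) * zetaRecip s := by
  have hr0 : (0 : ℝ) ≤ r := Nat.cast_nonneg r
  rw [sigmaInv_eq hr, ArithmeticFunction.LSeries_mul' (LSeriesSummable_powMoebius hs)]
  · congr 1
    · rw [← LSeries_moebius_eq_zetaRecip (by simp; linarith)]
      simp only [LSeries, term_powMoebius]
    · simp only [ArithmeticFunction.intCoe_apply]
      exact LSeries_moebius_eq_zetaRecip (by linarith)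
  · simp only [ArithmeticFunction.intCoe_apply]
    exact ArithmeticFunction.LSeriesSummable_moebius_iff.2 (by linarith)

theorem tendsto_sum_moebius_div :
    Tendsto (fun N : ℕ => ∑ n ∈ Finset.Ioc 0 N, (ArithmeticFunction.moebius n : ℂ) / n)
      atTop (𝓝 0) := by
  have h := tendsto_moebiusSum.comp (Real.tendsto_log_atTop.comp tendsto_natCast_atTop_atTop)
  refine h.congr' ?_
  filter_upwards [eventually_gt_atTop 0] with N hN
  simp only [Function.comp, moebiusSum]
  rw [Real.exp_log (by exact_mod_cast hN), Nat.floor_natCast]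
  rfl

/-- The prime number theorem in the form `∑ σ_r⁻¹(n) / n ^ (r + 1) = 0`. -/
theorem tendsto_sum_sigmaInv_div {r : ℕ} (hr : r ≠ 0) :
    Tendsto (fun N : ℕ => ∑ n ∈ Finset.Icc 1 N, sigmaInv r n / (n : ℂ) ^ (r + 1)) atTop (𝓝 0) := by
  set M : ℕ → ℂ := fun N => ∑ n ∈ Finset.Ioc 0 N, (ArithmeticFunction.moebius n : ℂ) / n with hM
  have hMlim : Tendsto M atTop (𝓝 0) := tendsto_sum_moebius_div
  obtain ⟨B, hB⟩ := hMlim.norm.bddAbove_range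
  have hB' : ∀ N, ‖M N‖ ≤ B := fun N => hB ⟨N, rfl⟩
  have hM0 : M 0 = 0 := by simp [hM]
  set F : ArithmeticFunction ℂ :=
    ⟨fun n => (ArithmeticFunction.moebius n : ℂ) / (n : ℂ) ^ (r + 1), by simp⟩ with hF
  set G : ArithmeticFunction ℂ :=
    ⟨fun n => (ArithmeticFunction.moebius n : ℂ) / (n : ℂ), by simp⟩ with hG
  have hFG : ∀ n, n ≠ 0 → sigmaInv r n / (n : ℂ) ^ (r + 1) = (F * G) n := by
    intro n hn
    rw [sigmaInv_eq hr, mul_comm, ArithmeticFunction.mul_apply, ArithmeticFunction.mul_apply,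
      Finset.sum_div]
    refine Finset.sum_congr rfl fun x hx => ?_
    obtain ⟨h1, h2⟩ := Nat.mem_divisorsAntidiagonal.1 hx
    have h3 : (x.1 : ℂ) ≠ 0 := by
      rintro h3; rw [Nat.cast_eq_zero.1 h3, zero_mul] at h1; exact h2 h1.symm
    have h4 : (x.2 : ℂ) ≠ 0 := by
      rintro h3; rw [Nat.cast_eq_zero.1 h3, mul_zero] at h1; exact h2 h1.symm
    rw [← h1, powMoebius_apply, ArithmeticFunction.intCoe_apply]
    simp only [hF, hG, ArithmeticFunction.coe_mk]
    push_cast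
    field_simp
    ring
  have hFsum : Summable fun n => ‖F n‖ := by
    have hμ : LSeriesSummable (fun n => (ArithmeticFunction.moebius n : ℂ)) ((r + 1 : ℕ) : ℂ) :=
      ArithmeticFunction.LSeriesSummable_moebius_iff.2
        (by simp; exact_mod_cast Nat.pos_of_ne_zero hr)
    refine hμ.norm.congr fun n => ?_
    rcases eq_or_ne n 0 with rfl | hn
    · simp
    · rw [LSeries.term_of_ne_zero hn, Complex.cpow_natCast]
      rfl
  -- The summand is the convolution of μ(d)/d^{r+1}, absolutely summable, with μ(e)/e, whose partial
  -- sums M tend to 0. Grouping by d permits dominated convergence.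
  have hsum : ∀ N : ℕ, ∑ n ∈ Finset.Icc 1 N, sigmaInv r n / (n : ℂ) ^ (r + 1)
      = ∑' d, F d * M (N / d) := by
    intro N
    have h1 : ∑ n ∈ Finset.Icc 1 N, sigmaInv r n / (n : ℂ) ^ (r + 1)
        = ∑ n ∈ Finset.Ioc 0 N, (F * G) n :=
      Finset.sum_congr rfl fun n hn => hFG n (by have := (Finset.mem_Icc.1 hn).1; omega)
    rw [h1, ArithmeticFunction.sum_Ioc_mul_eq_sum_sum, tsum_eq_sum (s := Finset.Ioc 0 N)]
    · rfl
    · intro d hd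
      rcases Nat.eq_zero_or_pos d with rfl | hd0
      · simp
      · have : N / d = 0 := Nat.div_eq_of_lt (by
          by_contra h; exact hd (Finset.mem_Ioc.2 ⟨hd0, not_lt.1 h⟩))
        rw [this, hM0, mul_zero]
  simp only [hsum]
  have h0 : (0 : ℂ) = ∑' d, F d * 0 := by simp
  rw [h0]
  refine tendsto_tsum_of_dominated_convergence (bound := fun d => ‖F d‖ * B) (hFsum.mul_right B)
    (fun d => ?_) (Eventually.of_forall fun N d => ?_)
  · rcases Nat.eq_zero_or_pos d with rfl | hd0
    · simp
    · exact (hMlim.comp (Nat.tendsto_div_const_atTop hd0.ne')).const_mul _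
  · rw [norm_mul]
    exact mul_le_mul_of_nonneg_left (hB' _) (norm_nonneg _)

/-! ### Mellin inversion and the Mellin–Barnes form of the series. -/

/-- The function `y ↦ exp (-y) - 1`, whose Mellin transform on `-1 < Re s < 0` is `Γ(s)`. -/
noncomputable def expNegSubOne (y : ℝ) : ℂ := ((Real.exp (-y) - 1 : ℝ) : ℂ)

theorem norm_expNegSubOne_le {y : ℝ} (hy : 0 ≤ y) : ‖expNegSubOne y‖ ≤ y := by
  rw [expNegSubOne, Complex.norm_real, Real.norm_eq_abs, abs_le]
  constructor
  · linarith [Real.add_one_le_exp (-y)]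
  · linarith [Real.exp_le_one_iff.2 (neg_nonpos.2 hy)]

theorem norm_expNegSubOne_le_one {y : ℝ} (hy : 0 ≤ y) : ‖expNegSubOne y‖ ≤ 1 := by
  rw [expNegSubOne, Complex.norm_real, Real.norm_eq_abs, abs_le]
  constructor
  · linarith [Real.exp_pos (-y)]
  · linarith [Real.exp_le_one_iff.2 (neg_nonpos.2 hy)]

theorem continuous_expNegSubOne : Continuous expNegSubOne := by
  unfold expNegSubOne; fun_prop

theorem mellinConvergent_expNegSubOne {s : ℂ} (h1 : -1 < s.re) (h2 : s.re < 0) :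
    MellinConvergent expNegSubOne s := by
  refine mellinConvergent_of_isBigO_rpow (a := 0) (b := -1)
    (continuous_expNegSubOne.locallyIntegrable.locallyIntegrableOn _) ?_ h2 ?_ h1
  · refine Asymptotics.IsBigO.of_bound 1 ?_
    filter_upwards [eventually_ge_atTop 0] with y hy
    simpa using norm_expNegSubOne_le_one hy
  · refine Asymptotics.IsBigO.of_bound 1 ?_
    filter_upwards [self_mem_nhdsWithin] with y hy
    have hy' : (0 : ℝ) < y := hy
    simpa [abs_of_pos hy'] using norm_expNegSubOne_le hy'.le

/-- Integration by parts reduces to the integral for Γ(s+1) = sΓ(s). The boundary terms are at most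
y^{Re s + 1}/|s| near 0 and y^{Re s}/|s| at infinity, and both vanish in the strip -1 < Re s < 0. -/
theorem mellin_expNegSubOne {s : ℂ} (h1 : -1 < s.re) (h2 : s.re < 0) :
    mellin expNegSubOne s = Complex.Gamma s := by
  have hs0 : s ≠ 0 := by rintro rfl; simp at h2
  have hconv := mellinConvergent_expNegSubOne h1 h2
  have hre : 0 < (s + 1).re := by simp; linarith
  have hΓ := Complex.GammaIntegral_convergent hre
  have hnorm : ∀ y : ℝ, 0 < y → ‖(y : ℂ) ^ s / s * expNegSubOne y‖
      = y ^ s.re * ‖expNegSubOne y‖ / ‖s‖ := by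
    intro y hy
    rw [norm_mul, norm_div, Complex.norm_cpow_eq_rpow_re_of_pos hy]; ring
  have key := MeasureTheory.integral_Ioi_mul_deriv_eq_deriv_mul (a := 0) (a' := (0 : ℂ)) (b' := 0)
    (u := fun y : ℝ => (y : ℂ) ^ s / s) (v := expNegSubOne)
    (u' := fun y : ℝ => (y : ℂ) ^ (s - 1)) (v' := fun y : ℝ => -((Real.exp (-y) : ℝ) : ℂ))
    ?_ ?_ ?_ ?_ ?_ ?_
  · have h3 : ∫ y : ℝ in Set.Ioi 0, (y : ℂ) ^ s / s * -((Real.exp (-y) : ℝ) : ℂ)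
        = -(Complex.Gamma (s + 1) / s) := by
      rw [Complex.Gamma_eq_integral hre, Complex.GammaIntegral, ← MeasureTheory.integral_div,
        ← MeasureTheory.integral_neg]
      refine MeasureTheory.integral_congr_ae (Eventually.of_forall fun y => ?_)
      simp only [add_sub_cancel_right]
      ring
    rw [h3, Complex.Gamma_add_one s hs0, mul_div_cancel_left₀ _ hs0] at key
    simp only [mellin, smul_eq_mul]
    linear_combination key
  · intro y hy
    have hy' : (0 : ℝ) < y := hy
    have h := (hasDerivAt_ofReal_cpow_const (x := y) hy'.ne' hs0).div_const s
    rwa [mul_div_cancel_left₀ _ hs0] at h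
  · intro y _
    have h : HasDerivAt (fun y : ℝ => Real.exp (-y) - 1) (-Real.exp (-y)) y := by
      simpa using ((hasDerivAt_neg y).exp).sub_const 1
    have := h.ofReal_comp
    rwa [Complex.ofReal_neg] at this
  · refine ((hΓ.div_const s).neg).congr (Eventually.of_forall fun y => ?_)
    simp only [add_sub_cancel_right, Pi.neg_apply, Pi.mul_apply]
    ring
  · refine hconv.congr (Eventually.of_forall fun y => ?_)
    simp
  · refine squeeze_zero_norm' (a := fun y : ℝ => y ^ (s.re + 1) / ‖s‖) ?_ ?_
    · filter_upwards [self_mem_nhdsWithin] with y hy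
      have hy' : (0 : ℝ) < y := hy
      rw [Pi.mul_apply, hnorm y hy', Real.rpow_add_one hy'.ne']
      gcongr
      exact norm_expNegSubOne_le hy'.le
    · have h : ContinuousAt (fun y : ℝ => y ^ (s.re + 1) / ‖s‖) 0 :=
        (Real.continuousAt_rpow_const _ _ (Or.inr (by linarith))).div_const _
      have h0 := h.tendsto
      simp only [Real.zero_rpow (show s.re + 1 ≠ 0 by linarith), zero_div] at h0
      exact h0.mono_left nhdsWithin_le_nhds
  · refine squeeze_zero_norm' (a := fun y : ℝ => y ^ (-(-s.re)) / ‖s‖) ?_ ?_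
    · filter_upwards [eventually_gt_atTop 0] with y hy
      rw [Pi.mul_apply, hnorm y hy, neg_neg]
      gcongr
      exact mul_le_of_le_one_right (by positivity) (norm_expNegSubOne_le_one hy.le)
    · simpa using (tendsto_rpow_neg_atTop (y := -s.re) (by linarith)).div_const ‖s‖

theorem norm_Gamma_half_add_mul_I_sq (t : ℝ) :
    ‖Complex.Gamma (1 / 2 + t * Complex.I)‖ ^ 2 = Real.pi / Real.cosh (Real.pi * t) := by
  have h := Complex.Gamma_mul_Gamma_one_sub (1 / 2 + t * Complex.I)
  have hconj : (1 : ℂ) - (1 / 2 + t * Complex.I)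
      = (starRingEnd ℂ) (1 / 2 + t * Complex.I) := by
    apply Complex.ext <;> norm_num
  have hsin : Complex.sin (Real.pi * (1 / 2 + t * Complex.I))
      = ((Real.cosh (Real.pi * t) : ℝ) : ℂ) := by
    rw [show (Real.pi : ℂ) * (1 / 2 + t * Complex.I)
      = (((Real.pi * t : ℝ) : ℂ) * Complex.I) + Real.pi / 2 by push_cast; ring,
      Complex.sin_add_pi_div_two, Complex.cos_mul_I, Complex.ofReal_cosh]
  rw [hconj, Complex.Gamma_conj, hsin, Complex.mul_conj, Complex.normSq_eq_norm_sq] at h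
  exact_mod_cast h

theorem norm_Gamma_neg_half_le (t : ℝ) :
    ‖Complex.Gamma (((-1 / 2 : ℝ) : ℂ) + t * Complex.I)‖ ≤ 11 * (1 + t ^ 2)⁻¹ := by
  set s : ℂ := ((-1 / 2 : ℝ) : ℂ) + t * Complex.I with hs
  have hsre : s.re = -1 / 2 := by simp [hs]
  have hs0 : s ≠ 0 := by intro h; rw [h] at hsre; norm_num at hsre
  have hsn : 1 / 2 ≤ ‖s‖ := by
    have := Complex.abs_re_le_norm s
    rw [hsre] at this
    norm_num [abs_of_neg] at this ⊢
    linarith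
  have h1 : Complex.Gamma (1 / 2 + t * Complex.I) = s * Complex.Gamma s := by
    rw [← Complex.Gamma_add_one s hs0, hs]; congr 1; push_cast; ring
  have h2 := norm_Gamma_half_add_mul_I_sq t
  rw [h1, norm_mul] at h2
  have hpos : (0 : ℝ) < 1 + t ^ 2 := by positivity
  have hq : (1 + t ^ 2) ^ 2 / 8 ≤ Real.cosh (Real.pi * t) := by
    have h3 := Real.quadratic_le_exp_of_nonneg (abs_nonneg t)
    have h4 : (1 + t ^ 2) / 2 ≤ Real.exp |t| := by
      rw [sq_abs] at h3; linarith [abs_nonneg t]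
    have h5 : Real.exp |t| ^ 2 ≤ Real.exp (Real.pi * |t|) := by
      rw [← Real.exp_nat_mul]
      apply Real.exp_le_exp.2
      push_cast
      exact mul_le_mul_of_nonneg_right (by linarith [Real.pi_gt_three]) (abs_nonneg t)
    have h6 : Real.exp (Real.pi * |t|) / 2 ≤ Real.cosh (Real.pi * t) := by
      rw [← Real.cosh_abs, abs_mul, abs_of_pos Real.pi_pos, Real.cosh_eq]
      linarith [Real.exp_pos (-(Real.pi * |t|))]
    have h7 : ((1 + t ^ 2) / 2) ^ 2 ≤ Real.exp |t| ^ 2 := by gcongr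
    nlinarith
  have hG : ‖Complex.Gamma s‖ ^ 2 ≤ (11 * (1 + t ^ 2)⁻¹) ^ 2 := by
    have h3 : Real.pi / Real.cosh (Real.pi * t) ≤ Real.pi / ((1 + t ^ 2) ^ 2 / 8) := by
      gcongr
    have h4 : (1 / 2 * ‖Complex.Gamma s‖) ^ 2 ≤ (‖s‖ * ‖Complex.Gamma s‖) ^ 2 := by gcongr
    have h5 : ‖Complex.Gamma s‖ ^ 2 ≤ 32 * Real.pi * ((1 + t ^ 2)⁻¹) ^ 2 := by
      have h6 : Real.pi / ((1 + t ^ 2) ^ 2 / 8) = 8 * Real.pi * ((1 + t ^ 2)⁻¹) ^ 2 := by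
        field_simp
      rw [h6] at h3
      nlinarith
    -- The constant 11 satisfies 11² = 121 ≥ 32π.
    have h7 : 32 * Real.pi * ((1 + t ^ 2)⁻¹) ^ 2 ≤ 121 * ((1 + t ^ 2)⁻¹) ^ 2 := by
      gcongr
      linarith [Real.pi_lt_d2]
    nlinarith
  exact le_of_sq_le_sq hG (by positivity)

theorem continuous_Gamma_neg_half :
    Continuous fun t : ℝ => Complex.Gamma (((-1 / 2 : ℝ) : ℂ) + t * Complex.I) := by
  refine continuous_iff_continuousAt.2 fun t => ?_
  have h : DifferentiableAt ℂ Complex.Gamma (((-1 / 2 : ℝ) : ℂ) + t * Complex.I) := by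
    refine Complex.differentiableAt_Gamma _ fun m hm => ?_
    have := congrArg Complex.re hm
    simp at this
    have h2 : ((2 * m : ℕ) : ℝ) = (1 : ℕ) := by push_cast; linarith
    have := Nat.cast_injective h2
    omega
  exact ContinuousAt.comp (g := Complex.Gamma) h.continuousAt (by fun_prop)

theorem integrable_Gamma_neg_half :
    MeasureTheory.Integrable
      fun t : ℝ => Complex.Gamma (((-1 / 2 : ℝ) : ℂ) + t * Complex.I) :=
  (integrable_inv_one_add_sq.const_mul 11).mono' continuous_Gamma_neg_half.aestronglyMeasurable
    (Eventually.of_forall norm_Gamma_neg_half_le)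

/-- Mellin inversion for `exp (-y) - 1`. -/
theorem expNegSubOne_eq_integral {y : ℝ} (hy : 0 < y) :
    expNegSubOne y = 1 / (2 * Real.pi) * ∫ t : ℝ,
      (y : ℂ) ^ (-(((-1 / 2 : ℝ) : ℂ) + t * Complex.I))
        * Complex.Gamma (((-1 / 2 : ℝ) : ℂ) + t * Complex.I) := by
  have hre : ∀ t : ℝ, (((-1 / 2 : ℝ) : ℂ) + t * Complex.I).re = -1 / 2 := fun t => by simp
  have hm : ∀ t : ℝ, mellin expNegSubOne (((-1 / 2 : ℝ) : ℂ) + t * Complex.I)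
      = Complex.Gamma (((-1 / 2 : ℝ) : ℂ) + t * Complex.I) := fun t =>
    mellin_expNegSubOne (by rw [hre]; norm_num) (by rw [hre]; norm_num)
  have h := mellinInv_mellin_eq (-1 / 2) expNegSubOne hy
    (mellinConvergent_expNegSubOne (by rw [Complex.ofReal_re]; norm_num)
      (by rw [Complex.ofReal_re]; norm_num))
    (by simp only [Complex.VerticalIntegrable, hm]; exact integrable_Gamma_neg_half)
    continuous_expNegSubOne.continuousAt
  rw [← h, mellinInv]
  simp only [hm, smul_eq_mul, Complex.real_smul]
  push_cast
  rfl

/-- The Mellin kernel of the series `∑ σ_r⁻¹(n) n ^ (-(r + 1)) exp (-x / n)`. -/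
noncomputable def mellinKernel (r : ℕ) (x : ℝ) (s : ℂ) : ℂ :=
  Complex.Gamma s * (x : ℂ) ^ (-s) * (zetaRecip (r + 1 - s) * zetaRecip (1 - s))

theorem norm_LSeries_term_eq_of_re_eq (f : ℕ → ℂ) {s s' : ℂ} (h : s.re = s'.re) (n : ℕ) :
    ‖LSeries.term f s n‖ = ‖LSeries.term f s' n‖ := by
  rw [LSeries.norm_term_eq, LSeries.norm_term_eq, h]

theorem mellinKernel_eq_LSeries {r : ℕ} (hr : r ≠ 0) (x : ℝ) {s : ℂ} (hs : s.re < 0) :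
    mellinKernel r x s
      = ((x : ℂ) ^ (-s) * Complex.Gamma s) * LSeries (fun n => sigmaInv r n) (r + 1 - s) := by
  rw [LSeries_sigmaInv hr (by simp; linarith), mellinKernel,
    show (r : ℂ) + 1 - s - r = 1 - s by ring]
  ring

theorem norm_cpow_neg_half {x : ℝ} (hx : 0 < x) (t : ℝ) :
    ‖(x : ℂ) ^ (-(((-1 / 2 : ℝ) : ℂ) + t * Complex.I))‖ = x ^ (1 / 2 : ℝ) := by
  rw [Complex.norm_cpow_eq_rpow_re_of_pos hx]
  congr 1
  simp
  norm_num

theorem continuous_cpow_neg_half {x : ℝ} (hx : 0 < x) :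
    Continuous fun t : ℝ => (x : ℂ) ^ (-(((-1 / 2 : ℝ) : ℂ) + t * Complex.I)) :=
  Continuous.const_cpow (by fun_prop) (Or.inl (by exact_mod_cast hx.ne'))

/-- On Re s = -1/2 the Dirichlet series is evaluated at real part r + 3/2, inside its half-plane of
absolute convergence, and Γ is integrable there; hence sum and integral may be exchanged. -/
theorem hasSum_expNegSubOne {r : ℕ} (hr : r ≠ 0) {x : ℝ} (hx : 0 < x) :
    HasSum (fun n : ℕ => sigmaInv r n / (n : ℂ) ^ (r + 1) * expNegSubOne (x / n))
      (1 / (2 * Real.pi) * ∫ t : ℝ, mellinKernel r x (((-1 / 2 : ℝ) : ℂ) + t * Complex.I)) := by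
  set a : ℕ → ℂ := fun n => sigmaInv r n with ha
  set s : ℝ → ℂ := fun t => ((-1 / 2 : ℝ) : ℂ) + t * Complex.I with hs
  have hsre : ∀ t, (s t).re = -1 / 2 := fun t => by simp [hs]
  set w : ℂ := ((r + 3 / 2 : ℝ) : ℂ) with hw
  have hwre : ∀ t, ((r : ℂ) + 1 - s t).re = w.re := fun t => by
    simp only [Complex.sub_re, Complex.add_re, hsre, hw, Complex.ofReal_re]; simp; ring
  have hsum : LSeriesSummable a w := LSeriesSummable_sigmaInv hr (by simp [hw]; norm_num)
  set c : ℝ := ∫ t : ℝ, 11 * x ^ (1 / 2 : ℝ) * (1 + t ^ 2)⁻¹ with hc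
  have hint := integrable_inv_one_add_sq.const_mul (11 * x ^ (1 / 2 : ℝ))
  set F : ℕ → ℝ → ℂ := fun n t =>
    ((x : ℂ) ^ (-s t) * Complex.Gamma (s t)) * LSeries.term a (r + 1 - s t) n with hF
  have hFb : ∀ n t, ‖F n t‖ ≤ ‖LSeries.term a w n‖ * (11 * x ^ (1 / 2 : ℝ) * (1 + t ^ 2)⁻¹) := by
    intro n t
    simp only [hF, norm_mul, norm_LSeries_term_eq_of_re_eq a (hwre t)]
    rw [mul_comm, norm_cpow_neg_half hx t]
    refine mul_le_mul_of_nonneg_left ?_ (norm_nonneg _)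
    rw [mul_comm 11, mul_assoc]
    exact mul_le_mul_of_nonneg_left (norm_Gamma_neg_half_le t) (by positivity)
  have hFc : ∀ n, Continuous (F n) := by
    intro n
    refine ((continuous_cpow_neg_half hx).mul continuous_Gamma_neg_half).mul ?_
    rcases eq_or_ne n 0 with rfl | hn
    · simpa using continuous_const
    · simp only [LSeries.term_of_ne_zero hn]
      have hn' : (n : ℂ) ≠ 0 := by exact_mod_cast hn
      refine continuous_const.div (Continuous.const_cpow (by fun_prop) (Or.inl hn')) fun t => ?_
      simp [Complex.cpow_eq_zero_iff, hn']
  have hFi : ∀ n, MeasureTheory.Integrable (F n) := fun n =>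
    (hint.const_mul ‖LSeries.term a w n‖).mono' (hFc n).aestronglyMeasurable
      (Eventually.of_forall (hFb n))
  have hmain := MeasureTheory.hasSum_integral_of_summable_integral_norm hFi ?_
  · have hts : ∀ t, ∑' n, F n t = mellinKernel r x (s t) := by
      intro t
      rw [mellinKernel_eq_LSeries hr x (by rw [hsre]; norm_num)]
      simp only [hF]
      rw [tsum_mul_left]
      rfl
    simp only [hts] at hmain
    refine (hmain.mul_left (1 / (2 * Real.pi : ℂ))).congr_fun ?_
    intro n
    rcases eq_or_ne n 0 with rfl | hn
    · simp [hF]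
    have hn' : (n : ℂ) ≠ 0 := by exact_mod_cast hn
    have hn0 : (0 : ℝ) < n := by exact_mod_cast Nat.pos_of_ne_zero hn
    rw [expNegSubOne_eq_integral (div_pos hx hn0), mul_left_comm, ← MeasureTheory.integral_const_mul]
    congr 2
    funext t
    simp only [hF, LSeries.term_of_ne_zero hn]
    have h1 : ((x / n : ℝ) : ℂ) ^ (-s t) = (x : ℂ) ^ (-s t) * (n : ℂ) ^ (s t) := by
      rw [Complex.ofReal_div, Complex.ofReal_natCast, div_eq_mul_inv, ← Complex.ofReal_natCast,
        ← Complex.ofReal_inv, Complex.mul_cpow_ofReal_nonneg hx.le (by positivity),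
        Complex.ofReal_inv, Complex.inv_cpow _ _ (by
          rw [Complex.arg_ofReal_of_nonneg hn0.le]; exact Real.pi_pos.ne),
        Complex.cpow_neg _ (s t), Complex.ofReal_natCast, Complex.cpow_neg (n : ℂ), inv_inv]
    have h2 : (n : ℂ) ^ ((r : ℂ) + 1 - s t) = (n : ℂ) ^ (r + 1) / (n : ℂ) ^ (s t) := by
      rw [Complex.cpow_sub _ _ hn']
      congr 1
      exact_mod_cast Complex.cpow_natCast (n : ℂ) (r + 1)
    have h3 : (n : ℂ) ^ (s t) ≠ 0 := by simp [Complex.cpow_eq_zero_iff, hn']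
    show sigmaInv r n / (n : ℂ) ^ (r + 1) * (((x / n : ℝ) : ℂ) ^ (-s t) * Complex.Gamma (s t)) = _
    rw [h1, h2]
    simp only [ha]
    field_simp
  · refine Summable.of_nonneg_of_le (fun n => MeasureTheory.integral_nonneg fun t => norm_nonneg _)
      (fun n => ?_) (hsum.norm.mul_right c)
    rw [hc, ← MeasureTheory.integral_const_mul]
    exact MeasureTheory.integral_mono (hFi n).norm (hint.const_mul _) (hFb n)

/-- The series over `σ_r⁻¹` as a Mellin–Barnes integral. -/
theorem hasSigmaInvSum_integral {r : ℕ} (hr : r ≠ 0) {x : ℝ} (hx : 0 < x) :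
    HasSigmaInvSum r x (1 / (2 * Real.pi)
      * ∫ t : ℝ, mellinKernel r x (((-1 / 2 : ℝ) : ℂ) + t * Complex.I)) := by
  -- Each term is split by e^{-x/n} = 1 + (e^{-x/n} - 1). The first part sums to 0, possibly only
  -- conditionally, and the second is the absolutely convergent sum just computed.
  have h1 := (hasSum_expNegSubOne hr hx).tendsto_sum_nat.comp (tendsto_add_atTop_nat 1)
  have h2 := (tendsto_sum_sigmaInv_div hr).add h1
  rw [zero_add] at h2
  refine h2.congr fun N => ?_
  have h3 : ∑ n ∈ Finset.range (N + 1), sigmaInv r n / (n : ℂ) ^ (r + 1) * expNegSubOne (x / n)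
      = ∑ n ∈ Finset.Icc 1 N, sigmaInv r n / (n : ℂ) ^ (r + 1) * expNegSubOne (x / n) := by
    symm
    refine Finset.sum_subset (fun n hn => ?_) fun n hn hn' => ?_
    · rw [Finset.mem_range]; have := (Finset.mem_Icc.1 hn).2; omega
    · have : n = 0 := by
        by_contra h
        exact hn' (Finset.mem_Icc.2 ⟨by omega, by have := Finset.mem_range.1 hn; omega⟩)
      simp [this]
  simp only [Function.comp]
  rw [h3, ← Finset.sum_add_distrib]
  refine Finset.sum_congr rfl fun n _ => ?_
  rw [expNegSubOne, neg_div]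
  push_cast
  ring

theorem continuousAt_zetaRecip {s : ℂ} (hs : 1 ≤ s.re) : ContinuousAt zetaRecip s := by
  rw [show zetaRecip = fun s => (s - 1) / riemannZeta₁ s from funext zetaRecip_eq]
  exact (by fun_prop : ContinuousAt (fun s : ℂ => s - 1) s).div
    (differentiable_riemannZeta₁ s).continuousAt (riemannZeta₁_ne_zero_of_one_le_re hs)

theorem integrable_mellinKernel (r : ℕ) {x : ℝ} (hx : 0 < x) :
    MeasureTheory.Integrable
      fun t : ℝ => mellinKernel r x (((-1 / 2 : ℝ) : ℂ) + t * Complex.I) := by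
  obtain ⟨B, hB1, hB⟩ := exists_norm_zetaRecip_le
  have hr : (0 : ℝ) ≤ r := Nat.cast_nonneg r
  have hz : ∀ m : ℕ, Continuous fun t : ℝ =>
      zetaRecip ((m : ℂ) + 1 - (((-1 / 2 : ℝ) : ℂ) + t * Complex.I)) := by
    intro m
    have hm : (0 : ℝ) ≤ m := Nat.cast_nonneg m
    refine continuous_iff_continuousAt.2 fun t => ?_
    refine ContinuousAt.comp (g := zetaRecip) (continuousAt_zetaRecip ?_) (by fun_prop)
    simp; norm_num; linarith
  refine (integrable_inv_one_add_sq.const_mul (11 * x ^ (1 / 2 : ℝ) * (B * B))).mono'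
    (Continuous.aestronglyMeasurable ?_) (Eventually.of_forall fun t => ?_)
  · refine (continuous_Gamma_neg_half.mul (continuous_cpow_neg_half hx)).mul ((hz r).mul ?_)
    simpa using hz 0
  · rw [mellinKernel, norm_mul, norm_mul, norm_mul, norm_cpow_neg_half hx]
    have h1 := hB (r + 1 - (((-1 / 2 : ℝ) : ℂ) + t * Complex.I)) (by
      simp; norm_num; linarith)
    have h2 := hB (1 - (((-1 / 2 : ℝ) : ℂ) + t * Complex.I)) (by
      simp; norm_num)
    calc _ ≤ 11 * (1 + t ^ 2)⁻¹ * x ^ (1 / 2 : ℝ) * (B * B) := by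
          gcongr
          exact norm_Gamma_neg_half_le t
      _ = _ := by ring

/-! ### The symmetric kernel and its residues. -/

/-- At a simple zero `p` of `f`, the function `1 / f` has residue `1 / f' p`. -/
theorem tendsto_sub_div_of_hasDerivAt {f : ℂ → ℂ} {f' p : ℂ} (h : HasDerivAt f f' p)
    (h0 : f p = 0) (hf' : f' ≠ 0) : Tendsto (fun z => (z - p) / f z) (𝓝[≠] p) (𝓝 f'⁻¹) := by
  refine ((hasDerivAt_iff_tendsto_slope.1 h).inv₀ hf').congr fun z => ?_
  rw [slope_def_field, h0, sub_zero, inv_div]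

theorem cos_pi_mul_div_two_eq_zero {s : ℂ} (h : Complex.cos (Real.pi * s / 2) = 0) :
    ∃ k : ℤ, s = 2 * k + 1 := by
  obtain ⟨k, hk⟩ := Complex.cos_eq_zero_iff.1 h
  refine ⟨k, ?_⟩
  have hπ : (Real.pi : ℂ) ≠ 0 := by exact_mod_cast Real.pi_ne_zero
  apply mul_left_cancel₀ hπ
  linear_combination 2 * hk

/-- To the left of the critical strip, away from the negative even integers, `ζ` does not vanish. -/
theorem riemannZeta_one_sub_ne_zero {w : ℂ} (h1 : 1 ≤ w.re) (hw : w ≠ 1)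
    (hodd : ∀ k : ℤ, w ≠ 2 * k + 1) : riemannZeta (1 - w) ≠ 0 := by
  have hn := ne_neg_natCast_of_re_pos (s := w) (by linarith)
  rw [riemannZeta_one_sub hn hw]
  refine mul_ne_zero (mul_ne_zero (mul_ne_zero (mul_ne_zero two_ne_zero ?_)
    (Complex.Gamma_ne_zero hn)) fun h => ?_) (riemannZeta_ne_zero_of_one_le_re h1)
  · simp [Complex.cpow_eq_zero_iff, Real.pi_ne_zero]
  · obtain ⟨k, hk⟩ := cos_pi_mul_div_two_eq_zero h
    exact hodd k hk

/-- The first trivial zero is at -2, outside this half-plane. The point s = 0 is checked by its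
value because the reflected point w = 1 is excluded from the functional equation. -/
theorem mem_nontrivialZeros_of_neg_half_le_re {s : ℂ} (hs : -(1 / 2) ≤ s.re)
    (h : riemannZeta₁ s = 0) : s ∈ nontrivialZeros := by
  rcases lt_or_ge 0 s.re with h0 | h0
  · exact mem_nontrivialZeros_of_riemannZeta₁_eq_zero h0 h
  exfalso
  have hs1 : s ≠ 1 := by rintro rfl; norm_num at h0
  rw [riemannZeta₁_eq_sub_mul hs1] at h
  have hz : riemannZeta s = 0 := (mul_eq_zero.1 h).resolve_left (sub_ne_zero.2 hs1)
  by_cases hs0 : s = 0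
  · rw [hs0, riemannZeta_zero] at hz; norm_num at hz
  refine riemannZeta_one_sub_ne_zero (w := 1 - s) (by simp; linarith) (by simpa using hs0) ?_
    (by rwa [sub_sub_cancel])
  intro k hk
  have hre := congrArg Complex.re hk
  simp at hre
  have h1 : (0 : ℝ) ≤ k := by linarith
  have h2 : (k : ℝ) < 1 := by linarith
  have h3 : (0 : ℤ) ≤ k := by exact_mod_cast h1
  have h4 : k < 1 := by exact_mod_cast h2
  obtain rfl : k = 0 := by omega
  apply hs0
  simp at hk
  exact hk

/-- The integrand of the contour integral: it agrees with `mellinKernel r x` away from the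
non-positive integers and `1`. -/
noncomputable def cosKernel (r : ℕ) (x : ℝ) (s : ℂ) : ℂ :=
  ((2 * Real.pi / x : ℝ) : ℂ) ^ s * (zetaRecip s * zetaRecip (r + 1 - s))
    / (2 * Complex.cos (Real.pi * s / 2))

/-- The functional equation turns Γ(s)/ζ(1-s) into (2π)^s / (2 cos(πs/2) ζ(s)). The excluded points
are the poles of Γ and the pole of ζ, where the values assigned by convention may disagree. -/
theorem cosKernel_eq_mellinKernel (r : ℕ) {x : ℝ} (hx : 0 < x) {s : ℂ} (hs : ∀ n : ℕ, s ≠ -n)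
    (hs1 : s ≠ 1) : cosKernel r x s = mellinKernel r x s := by
  have hΓ := Complex.Gamma_ne_zero hs
  have hs0 : s ≠ 0 := by simpa using hs 0
  have h1s : (1 : ℂ) - s ≠ 1 := by simpa using hs0
  have hpow : ((2 * Real.pi / x : ℝ) : ℂ) ^ s = (2 * Real.pi : ℂ) ^ s * (x : ℂ) ^ (-s) := by
    have hxs : ((x⁻¹ : ℝ) : ℂ) ^ s = (x : ℂ) ^ (-s) := by
      rw [Complex.ofReal_inv, Complex.inv_cpow _ _ (by
        rw [Complex.arg_ofReal_of_nonneg hx.le]; exact Real.pi_pos.ne), Complex.cpow_neg]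
    rw [div_eq_mul_inv, Complex.ofReal_mul,
      Complex.mul_cpow_ofReal_nonneg (by positivity) (by positivity), hxs]
    push_cast
    rfl
  rw [cosKernel, mellinKernel, hpow]
  simp only [zetaRecip, if_neg h1s, if_neg hs1]
  rw [riemannZeta_one_sub hs hs1, Complex.cpow_neg (2 * Real.pi : ℂ)]
  simp only [div_eq_mul_inv, mul_inv, inv_inv]
  have e : Complex.Gamma s * (Complex.Gamma s)⁻¹ = 1 := mul_inv_cancel₀ hΓ
  generalize (if (r : ℂ) + 1 - s = 1 then (0 : ℂ) else 1 * (riemannZeta (r + 1 - s))⁻¹) = q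
  linear_combination (-(2 * Real.pi : ℂ) ^ s * (x : ℂ) ^ (-s) * q * 2⁻¹
    * (Complex.cos (Real.pi * s * 2⁻¹))⁻¹ * (riemannZeta s)⁻¹) * e

/-- The reflection swaps the two zeta factors. As r + 1 = 2(k + 1), it shifts the cosine by a
multiple of π, hence only changes its sign; αβ = 4π² inverts the base of the power. -/
theorem cosKernel_one_add_sub (k : ℕ) {α β : ℝ} (hα : 0 < α) (hβ : 0 < β)
    (hαβ : α * β = 4 * Real.pi ^ 2) (s : ℂ) :
    cosKernel (2 * k + 1) α ((2 * k + 1 : ℕ) + 1 - s)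
      = (-1) ^ (k + 1) * ((β : ℂ) / (2 * Real.pi)) ^ (2 * k + 2) * cosKernel (2 * k + 1) β s := by
  have hπ : (Real.pi : ℂ) ≠ 0 := by exact_mod_cast Real.pi_ne_zero
  have hβ' : (β : ℂ) ≠ 0 := by exact_mod_cast hβ.ne'
  have h1 : 2 * Real.pi / α = β / (2 * Real.pi) := by
    rw [div_eq_div_iff hα.ne' (by positivity)]; linarith
  have hcos : Complex.cos (Real.pi * (((2 * k + 1 : ℕ) : ℂ) + 1 - s) / 2)
      = (-1) ^ (k + 1) * Complex.cos (Real.pi * s / 2) := by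
    rw [show (Real.pi : ℂ) * (((2 * k + 1 : ℕ) : ℂ) + 1 - s) / 2
      = ((k + 1 : ℕ) : ℂ) * Real.pi - Real.pi * s / 2 by push_cast; ring,
      ← Complex.cos_neg (Real.pi * s / 2)]
    simpa using Complex.cos_antiperiodic.nat_mul_sub_eq (k + 1) (x := Real.pi * s / 2)
  have hpow : ((2 * Real.pi / α : ℝ) : ℂ) ^ (((2 * k + 1 : ℕ) : ℂ) + 1 - s)
      = ((β : ℂ) / (2 * Real.pi)) ^ (2 * k + 2) * ((2 * Real.pi / β : ℝ) : ℂ) ^ s := by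
    have hb : ((β / (2 * Real.pi) : ℝ) : ℂ) ≠ 0 := by
      exact_mod_cast (div_pos hβ (by positivity)).ne'
    rw [h1, Complex.cpow_sub _ _ hb, show ((2 * k + 1 : ℕ) : ℂ) + 1 = ((2 * k + 2 : ℕ) : ℂ) by
      push_cast; ring, Complex.cpow_natCast, div_eq_mul_inv, ← Complex.inv_cpow _ _ (by
        rw [Complex.arg_ofReal_of_nonneg (by positivity)]; exact Real.pi_pos.ne),
      ← Complex.ofReal_inv, inv_div]
    push_cast
    rfl
  rw [cosKernel, cosKernel, hcos, hpow, sub_sub_cancel]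
  have e : ((-1 : ℂ) ^ (k + 1))⁻¹ = (-1) ^ (k + 1) := by
    rw [← inv_pow]; norm_num
  simp only [div_eq_mul_inv, mul_inv, e]
  ring

theorem zetaRecip_of_ne_one {s : ℂ} (hs : s ≠ 1) : zetaRecip s = (riemannZeta s)⁻¹ := by
  rw [zetaRecip, if_neg hs, one_div]

theorem tendsto_sub_mul_zetaRecip {ρ : ℂ} (hρ : ρ ∈ nontrivialZeros)
    (h' : deriv riemannZeta ρ ≠ 0) (c : ℂ) :
    Tendsto (fun z => (z - (c - ρ)) * zetaRecip (c - z)) (𝓝[≠] (c - ρ))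
      (𝓝 (-(deriv riemannZeta ρ)⁻¹)) := by
  have hρ1 := ne_one_of_mem_nontrivialZeros hρ
  have hd : HasDerivAt (fun z => riemannZeta (c - z)) (-deriv riemannZeta ρ) (c - ρ) := by
    have h1 : HasDerivAt riemannZeta (deriv riemannZeta ρ) (c - (c - ρ)) := by
      rw [sub_sub_cancel]; exact (differentiableAt_riemannZeta hρ1).hasDerivAt
    have h2 := h1.comp (c - ρ) ((hasDerivAt_id (c - ρ)).const_sub c)
    rwa [mul_neg_one] at h2
  have h := tendsto_sub_div_of_hasDerivAt hd (by rw [sub_sub_cancel]; exact hρ.1)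
    (neg_ne_zero.2 h')
  rw [inv_neg] at h
  refine h.congr' ?_
  have hev : ∀ᶠ z in 𝓝[≠] (c - ρ), c - z ≠ 1 := by
    refine eventually_nhdsWithin_of_eventually_nhds ?_
    have hc : ContinuousAt (fun z => c - z) (c - ρ) := by fun_prop
    exact hc.eventually_ne (by rwa [sub_sub_cancel])
  filter_upwards [hev] with z hz
  rw [zetaRecip_of_ne_one hz, div_eq_mul_inv]

theorem continuousAt_cpow_neg {x : ℝ} (hx : 0 < x) (p : ℂ) :
    ContinuousAt (fun z : ℂ => (x : ℂ) ^ (-z)) p :=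
  (Continuous.const_cpow continuous_neg (Or.inl (by exact_mod_cast hx.ne'))).continuousAt

theorem eventually_cosKernel_eq (r : ℕ) {x : ℝ} (hx : 0 < x) {p : ℂ} (hp : 0 < p.re)
    (hp1 : p ≠ 1) : ∀ᶠ z in 𝓝[≠] p, cosKernel r x z = mellinKernel r x z := by
  refine eventually_nhdsWithin_of_eventually_nhds ?_
  filter_upwards [Complex.continuous_re.continuousAt.eventually_const_lt hp,
    continuousAt_id.eventually_ne hp1] with z hz hz1
  exact cosKernel_eq_mellinKernel r hx (ne_neg_natCast_of_re_pos hz) hz1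

/-- The residue is read off from the Γ form of the kernel: at 1 - ρ only ζ(1-s) vanishes, to first
order, while ζ(r+1-s) is evaluated to the right of the critical strip. -/
theorem tendsto_sub_mul_cosKernel_one_sub {r : ℕ} (hr : r ≠ 0) {x : ℝ} (hx : 0 < x) {ρ : ℂ}
    (hρ : ρ ∈ nontrivialZeros) (h' : deriv riemannZeta ρ ≠ 0) :
    Tendsto (fun z => (z - (1 - ρ)) * cosKernel r x z) (𝓝[≠] (1 - ρ))
      (𝓝 (-(Complex.Gamma (1 - ρ) * (x : ℂ) ^ (ρ - 1) * (riemannZeta (r + ρ))⁻¹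
        * (deriv riemannZeta ρ)⁻¹))) := by
  have hr1 : (1 : ℝ) ≤ r := by exact_mod_cast Nat.pos_of_ne_zero hr
  have h0 := hρ.2.1
  have h1 := hρ.2.2
  have hΓ : ContinuousAt Complex.Gamma (1 - ρ) := (Complex.differentiableAt_Gamma _
    (ne_neg_natCast_of_re_pos (by simp; linarith))).continuousAt
  have hre : 1 < ((r : ℂ) + 1 - (1 - ρ)).re := by simp; linarith
  have hz : ContinuousAt (fun z => zetaRecip (r + 1 - z)) (1 - ρ) :=
    ContinuousAt.comp (g := zetaRecip) (continuousAt_zetaRecip hre.le) (by fun_prop)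
  have h := ((((hΓ.mul (continuousAt_cpow_neg hx _)).mul hz).tendsto.mono_left
    nhdsWithin_le_nhds).mul (tendsto_sub_mul_zetaRecip hρ h' 1))
  have hv : zetaRecip ((r : ℂ) + 1 - (1 - ρ)) = (riemannZeta (r + ρ))⁻¹ := by
    rw [zetaRecip_of_ne_one (by intro h; rw [h] at hre; simp at hre)]; ring_nf
  simp only [Pi.mul_apply] at h
  rw [hv, neg_sub, mul_neg] at h
  refine h.congr' ?_
  filter_upwards [eventually_cosKernel_eq r hx (p := 1 - ρ) (by simp; linarith)
    (by intro h; rw [sub_eq_self] at h; rw [h] at h0; simp at h0)] with z hz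
  rw [hz, mellinKernel]
  ring

/-- The reflected point r + 1 - ρ has real part strictly between r and r + 1, so it is not an odd
integer and ρ - r is not a trivial zero. -/
theorem riemannZeta_sub_natCast_ne_zero {r : ℕ} (hr : r ≠ 0) {ρ : ℂ} (h0 : 0 < ρ.re)
    (h1 : ρ.re < 1) : riemannZeta (ρ - r) ≠ 0 := by
  have hr1 : (1 : ℝ) ≤ r := by exact_mod_cast Nat.pos_of_ne_zero hr
  have hre : ((r : ℂ) + 1 - ρ).re = r + 1 - ρ.re := by simp
  have hodd : ∀ k : ℤ, (r : ℂ) + 1 - ρ ≠ 2 * k + 1 := by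
    intro k hk
    rw [hk] at hre
    simp at hre
    have h2 : ((r : ℤ) : ℝ) < ((2 * k + 1 : ℤ) : ℝ) := by push_cast; linarith
    have h3 : ((2 * k + 1 : ℤ) : ℝ) < ((r + 1 : ℤ) : ℝ) := by push_cast; linarith
    have := Int.cast_lt.1 h2
    have := Int.cast_lt.1 h3
    omega
  have h := riemannZeta_one_sub_ne_zero (w := r + 1 - ρ) (by rw [hre]; linarith)
    (by simpa using hodd 0) hodd
  rwa [show (1 : ℂ) - (r + 1 - ρ) = ρ - r by ring] at h

theorem tendsto_sub_mul_cosKernel_add_one_sub {r : ℕ} (hr : r ≠ 0) {x : ℝ} (hx : 0 < x) {ρ : ℂ}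
    (hρ : ρ ∈ nontrivialZeros) (h' : deriv riemannZeta ρ ≠ 0) :
    Tendsto (fun z => (z - (r + 1 - ρ)) * cosKernel r x z) (𝓝[≠] (r + 1 - ρ))
      (𝓝 (-(Complex.Gamma (r + 1 - ρ) * (x : ℂ) ^ (ρ - (r + 1)) * (riemannZeta (ρ - r))⁻¹
        * (deriv riemannZeta ρ)⁻¹))) := by
  have hr1 : (1 : ℝ) ≤ r := by exact_mod_cast Nat.pos_of_ne_zero hr
  have h0 := hρ.2.1
  have h1 := hρ.2.2
  have hΓ : ContinuousAt Complex.Gamma (r + 1 - ρ) := (Complex.differentiableAt_Gamma _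
    (ne_neg_natCast_of_re_pos (by simp; linarith))).continuousAt
  have hne := riemannZeta_sub_natCast_ne_zero hr h0 h1
  have hval : (1 : ℂ) - (r + 1 - ρ) = ρ - r := by ring
  have hne1 : ρ - r ≠ 1 := by
    intro h
    have := congrArg Complex.re h
    simp at this
    linarith
  have hzR : ContinuousAt zetaRecip (1 - (r + 1 - ρ)) := by
    rw [hval]
    have h2 : ContinuousAt (fun z => (riemannZeta z)⁻¹) (ρ - r) :=
      (differentiableAt_riemannZeta hne1).continuousAt.inv₀ hne
    refine h2.congr ?_
    filter_upwards [continuousAt_id.eventually_ne hne1] with z hz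
    exact (zetaRecip_of_ne_one hz).symm
  have hz : ContinuousAt (fun z => zetaRecip (1 - z)) (r + 1 - ρ) :=
    ContinuousAt.comp (g := zetaRecip) hzR (by fun_prop)
  have h := ((((hΓ.mul (continuousAt_cpow_neg hx _)).mul hz).tendsto.mono_left
    nhdsWithin_le_nhds).mul (tendsto_sub_mul_zetaRecip hρ h' (r + 1)))
  simp only [Pi.mul_apply] at h
  rw [hval, zetaRecip_of_ne_one hne1, neg_sub, mul_neg] at h
  refine h.congr' ?_
  filter_upwards [eventually_cosKernel_eq r hx (p := r + 1 - ρ) (by simp; linarith)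
    (by intro h; have := congrArg Complex.re h; simp at this; linarith)] with z hz
  rw [hz, mellinKernel]
  ring

/-- Only the cosine vanishes to produce a pole. At j = 0 and j = k the value 1/ζ(1) = 0 cancels it
and the limit is 0, so these points need no separate treatment. -/
theorem tendsto_sub_mul_cosKernel_odd {k j : ℕ} (hj : j ≤ k) {x : ℝ} (hx : 0 < x) :
    Tendsto (fun z => (z - (2 * j + 1)) * cosKernel (2 * k + 1) x z) (𝓝[≠] (2 * j + 1))
      (𝓝 (-((-1) ^ j / Real.pi * ((2 * Real.pi / x : ℝ) : ℂ) ^ (2 * j + 1)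
        * (zetaRecip (2 * j + 1) * zetaRecip ((2 * k + 1 : ℕ) - 2 * j))))) := by
  have hj' : (j : ℝ) ≤ k := by exact_mod_cast hj
  have hj0 : (0 : ℝ) ≤ j := Nat.cast_nonneg j
  have hπ : (Real.pi : ℂ) ≠ 0 := by exact_mod_cast Real.pi_ne_zero
  have harg : (Real.pi : ℂ) * (2 * j + 1) / 2 = Real.pi / 2 + j * Real.pi := by ring
  have hcos0 : Complex.cos (Real.pi * (2 * j + 1) / 2) = 0 :=
    Complex.cos_eq_zero_iff.2 ⟨j, by push_cast; ring⟩
  have hsin : Complex.sin (Real.pi * (2 * j + 1) / 2) = (-1) ^ j := by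
    rw [harg, Complex.sin_antiperiodic.add_nat_mul_eq, Complex.sin_pi_div_two, mul_one]
  have hd : HasDerivAt (fun z : ℂ => 2 * Complex.cos (Real.pi * z / 2))
      (-((-1) ^ j * Real.pi)) (2 * j + 1) := by
    have h1 : HasDerivAt (fun z : ℂ => Real.pi * z / 2) (Real.pi / 2 : ℂ) (2 * j + 1) := by
      simpa using ((hasDerivAt_id (2 * j + 1 : ℂ)).const_mul (Real.pi : ℂ)).div_const 2
    have h2 := (h1.ccos).const_mul (2 : ℂ)
    rw [hsin] at h2
    exact h2.congr_deriv (by ring)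
  have hlim := tendsto_sub_div_of_hasDerivAt hd (by rw [hcos0, mul_zero])
    (neg_ne_zero.2 (mul_ne_zero (pow_ne_zero _ (by norm_num)) hπ))
  have hx' : ((2 * Real.pi / x : ℝ) : ℂ) ≠ 0 := by
    exact_mod_cast (div_pos (by positivity) hx).ne'
  have hc1 : ContinuousAt (fun z : ℂ => ((2 * Real.pi / x : ℝ) : ℂ) ^ z) (2 * j + 1) :=
    (Continuous.const_cpow continuous_id (Or.inl hx')).continuousAt
  have hc2 : ContinuousAt zetaRecip (2 * j + 1) := continuousAt_zetaRecip (by simp)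
  have hval : (((2 * k + 1 : ℕ) : ℂ) + 1 - (2 * j + 1)) = (2 * k + 1 : ℕ) - 2 * j := by ring
  have hc3 : ContinuousAt (fun z => zetaRecip ((2 * k + 1 : ℕ) + 1 - z)) (2 * j + 1) :=
    ContinuousAt.comp (g := zetaRecip) (continuousAt_zetaRecip (by
      simp; linarith)) (by fun_prop)
  have h := ((hc1.mul (hc2.mul hc3)).tendsto.mono_left nhdsWithin_le_nhds).mul hlim
  have hp : ((2 * Real.pi / x : ℝ) : ℂ) ^ (2 * j + 1 : ℂ)
      = ((2 * Real.pi / x : ℝ) : ℂ) ^ (2 * j + 1) := by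
    exact_mod_cast Complex.cpow_natCast ((2 * Real.pi / x : ℝ) : ℂ) (2 * j + 1)
  have e : ((-1 : ℂ) ^ j)⁻¹ = (-1) ^ j := by rw [← inv_pow]; norm_num
  simp only [Pi.mul_apply] at h
  rw [hval, hp, inv_neg, mul_inv, e] at h
  refine Tendsto.congr (fun z => ?_) (h.trans_eq ?_)
  · rw [cosKernel]; ring
  · congr 1; ring

/-- The entire function whose zeros are the possible poles of `cosKernel r x`. -/
noncomputable def cosKernelDenom (r : ℕ) (s : ℂ) : ℂ :=
  riemannZeta₁ s * riemannZeta₁ (r + 1 - s) * Complex.cos (Real.pi * s / 2)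

theorem differentiable_cosKernelDenom (r : ℕ) : Differentiable ℂ (cosKernelDenom r) := by
  have h := differentiable_riemannZeta₁
  have h2 : Differentiable ℂ fun s : ℂ => riemannZeta₁ (r + 1 - s) := h.comp (by fun_prop)
  exact (h.mul h2).mul (by fun_prop)

theorem eventually_cosKernelDenom_ne_zero (r : ℕ) (p : ℂ) :
    ∀ᶠ z in 𝓝[≠] p, cosKernelDenom r z ≠ 0 := by
  by_contra hcon
  rw [not_eventually] at hcon
  simp only [not_not] at hcon
  have han : AnalyticOnNhd ℂ (cosKernelDenom r) Set.univ :=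
    (differentiable_cosKernelDenom r).differentiableOn.analyticOnNhd isOpen_univ
  have hz := han.eqOn_zero_of_preconnected_of_frequently_eq_zero isPreconnected_univ
    -- At r + 1 + i/2 no factor vanishes: the first argument has real part at least 1, the second is
    -- -i/2 on the line Re s = 0, and the cosine has only real zeros.
    (Set.mem_univ p) hcon (Set.mem_univ ((r : ℂ) + 1 + 1 / 2 * Complex.I))
  have hr : (0 : ℝ) ≤ r := Nat.cast_nonneg r
  simp only [cosKernelDenom, Pi.zero_apply, mul_eq_zero] at hz
  rcases hz with (hz | hz) | hz
  · exact riemannZeta₁_ne_zero_of_one_le_re (by simp [hr]) hz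
  · have h0 := mem_nontrivialZeros_of_neg_half_le_re (by simp) hz
    have := h0.2.1
    simp at this
  · obtain ⟨k, hk⟩ := cos_pi_mul_div_two_eq_zero hz
    have := congrArg Complex.im hk
    simp at this

theorem differentiableAt_cosKernel (r : ℕ) {x : ℝ} (hx : 0 < x) {s : ℂ}
    (hs : cosKernelDenom r s ≠ 0) : DifferentiableAt ℂ (cosKernel r x) s := by
  have hz := differentiable_riemannZeta₁
  have hz2 : Differentiable ℂ fun s : ℂ => riemannZeta₁ (r + 1 - s) := hz.comp (by fun_prop)
  simp only [cosKernelDenom, mul_ne_zero_iff] at hs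
  obtain ⟨⟨h1, h2⟩, h3⟩ := hs
  have hx' : ((2 * Real.pi / x : ℝ) : ℂ) ≠ 0 := by
    exact_mod_cast (div_pos (by positivity) hx).ne'
  unfold cosKernel
  simp only [zetaRecip_eq]
  refine DifferentiableAt.div (DifferentiableAt.mul ?_ (DifferentiableAt.mul
    (DifferentiableAt.div (by fun_prop) (hz s) h1)
    (DifferentiableAt.div (by fun_prop) (hz2 s) h2))) (by fun_prop)
    (mul_ne_zero two_ne_zero h3)
  exact differentiableAt_id.const_cpow (Or.inl hx')

/-- The non-trivial zeros with ordinate of absolute value at most `T`. -/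
noncomputable def zerosBelow (T : ℝ) : Finset ℂ := (finite_nontrivialZeros_abs_im_le T).toFinset

theorem mem_zerosBelow {T : ℝ} {ρ : ℂ} : ρ ∈ zerosBelow T ↔ ρ ∈ nontrivialZeros ∧ |ρ.im| ≤ T := by
  simp [zerosBelow]

/-- The poles of `cosKernel (2 * k + 1) x` in the rectangle `[-1/2, 2 * k + 5/2] × [-M, M]`. -/
noncomputable def cosKernelPoles (k : ℕ) (M : ℝ) : Finset ℂ :=
  ((Finset.range (k + 1)).image fun j : ℕ => (2 * j + 1 : ℂ))
    ∪ ((zerosBelow M).image (fun ρ => 1 - ρ)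
      ∪ (zerosBelow M).image (fun ρ => ((2 * k + 1 : ℕ) : ℂ) + 1 - ρ))

theorem mem_cosKernelPoles {k : ℕ} {M : ℝ} {p : ℂ} : p ∈ cosKernelPoles k M ↔
    (∃ j : ℕ, j < k + 1 ∧ (2 * j + 1 : ℂ) = p) ∨ (∃ ρ ∈ zerosBelow M, 1 - ρ = p) ∨
      ∃ ρ ∈ zerosBelow M, ((2 * k + 1 : ℕ) : ℂ) + 1 - ρ = p := by
  simp [cosKernelPoles]

theorem mem_cosKernelPoles_of_denom_eq_zero {k : ℕ} {M : ℝ} {s : ℂ}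
    (hs1 : -(1 / 2) ≤ s.re) (hs2 : s.re ≤ 2 * k + 5 / 2) (hM : |s.im| ≤ M)
    (h : cosKernelDenom (2 * k + 1) s = 0) : s ∈ cosKernelPoles k M := by
  rw [mem_cosKernelPoles]
  simp only [cosKernelDenom, mul_eq_zero] at h
  rcases h with (h | h) | h
  · have h1 := mem_nontrivialZeros_of_neg_half_le_re hs1 h
    refine Or.inr (Or.inl ⟨1 - s, mem_zerosBelow.2 ⟨one_sub_mem_nontrivialZeros h1, ?_⟩, by ring⟩)
    simpa using hM
  · have h1 := mem_nontrivialZeros_of_neg_half_le_re (by simp; linarith) h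
    refine Or.inr (Or.inr ⟨_, mem_zerosBelow.2 ⟨h1, ?_⟩, by ring⟩)
    simpa using hM
  · obtain ⟨m, hm⟩ := cos_pi_mul_div_two_eq_zero h
    left
    have hre : s.re = 2 * m + 1 := by rw [hm]; simp
    have h1 : ((-1 : ℤ) : ℝ) < m := by push_cast; linarith
    have h2 : (m : ℝ) < ((k + 1 : ℤ) : ℝ) := by push_cast; linarith
    have h3 := Int.cast_lt.1 h1
    have h4 := Int.cast_lt.1 h2
    lift m to ℕ using by omega
    exact ⟨m, by omega, by rw [hm]; simp⟩

theorem mem_Ioo_of_mem_cosKernelPoles {k : ℕ} {M : ℝ} (hM : 0 < M)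
    (hne : ∀ ρ ∈ nontrivialZeros, |ρ.im| ≠ M) {p : ℂ} (hp : p ∈ cosKernelPoles k M) :
    p ∈ Set.Ioo (-1 / 2 : ℝ) (2 * k + 5 / 2) ×ℂ Set.Ioo (-M) M := by
  have hk : (0 : ℝ) ≤ k := Nat.cast_nonneg k
  have him : ∀ ρ ∈ zerosBelow M, -M < ρ.im ∧ ρ.im < M := by
    intro ρ hρ
    obtain ⟨h1, h2⟩ := mem_zerosBelow.1 hρ
    exact abs_lt.1 (lt_of_le_of_ne h2 (hne ρ h1))
  rw [Complex.mem_reProdIm]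
  rcases mem_cosKernelPoles.1 hp with ⟨j, hj, rfl⟩ | ⟨ρ, hρ, rfl⟩ | ⟨ρ, hρ, rfl⟩
  · have hj' : (j : ℝ) ≤ k := by exact_mod_cast Nat.lt_succ_iff.1 hj
    have hj0 : (0 : ℝ) ≤ j := Nat.cast_nonneg j
    refine ⟨⟨?_, ?_⟩, ?_, ?_⟩ <;> simp <;> linarith
  · obtain ⟨⟨-, h1, h2⟩, -⟩ := mem_zerosBelow.1 hρ
    obtain ⟨h3, h4⟩ := him ρ hρ
    refine ⟨⟨?_, ?_⟩, ?_, ?_⟩ <;> simp <;> linarith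
  · obtain ⟨⟨-, h1, h2⟩, -⟩ := mem_zerosBelow.1 hρ
    obtain ⟨h3, h4⟩ := him ρ hρ
    refine ⟨⟨?_, ?_⟩, ?_, ?_⟩ <;> simp <;> linarith

theorem zeroTerm_residue {r : ℕ} {x : ℝ} (hx : 0 < x) (ρ : ℂ) :
    -(Complex.Gamma (1 - ρ) * (x : ℂ) ^ (ρ - 1) * (riemannZeta (r + ρ))⁻¹
        * (deriv riemannZeta ρ)⁻¹)
      + -(Complex.Gamma (r + 1 - ρ) * (x : ℂ) ^ (ρ - (r + 1)) * (riemannZeta (ρ - r))⁻¹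
        * (deriv riemannZeta ρ)⁻¹)
      = -(zeroTerm r x ρ / (x : ℂ) ^ (r + 1)) := by
  have hx' : (x : ℂ) ≠ 0 := by exact_mod_cast hx.ne'
  have h1 : (x : ℂ) ^ (ρ - (r + 1)) = (x : ℂ) ^ ρ / (x : ℂ) ^ (r + 1) := by
    rw [Complex.cpow_sub _ _ hx']
    congr 1
    exact_mod_cast Complex.cpow_natCast (x : ℂ) (r + 1)
  have h2 : (x : ℂ) ^ (ρ - 1) = (x : ℂ) ^ ρ * (x : ℂ) ^ r / (x : ℂ) ^ (r + 1) := by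
    rw [Complex.cpow_sub _ _ hx', Complex.cpow_one, pow_succ]
    field_simp
  rw [h1, h2, zeroTerm]
  simp only [div_eq_mul_inv]
  ring

/-- The residue theorem for `cosKernel`. -/
theorem rectIntegral_cosKernel (hsimple : ∀ ρ ∈ nontrivialZeros, deriv riemannZeta ρ ≠ 0)
    (k : ℕ) {x : ℝ} (hx : 0 < x) {M : ℝ} (hM : 0 < M)
    (hne : ∀ ρ ∈ nontrivialZeros, |ρ.im| ≠ M) :
    rectIntegral (cosKernel (2 * k + 1) x) (-1 / 2) (2 * k + 5 / 2) (-M) M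
      = 2 * Real.pi * Complex.I *
        (∑ j ∈ Finset.range (k + 1), -((-1) ^ j / Real.pi
            * ((2 * Real.pi / x : ℝ) : ℂ) ^ (2 * j + 1)
            * (zetaRecip (2 * j + 1) * zetaRecip ((2 * k + 1 : ℕ) - 2 * j)))
          + ∑ ρ ∈ zerosBelow M, -(zeroTerm (2 * k + 1) x ρ / (x : ℂ) ^ (2 * k + 1 + 1))) := by
  have hk : (0 : ℝ) ≤ k := Nat.cast_nonneg k
  have hr : 2 * k + 1 ≠ 0 := by omega
  set f := cosKernel (2 * k + 1) x with hf
  set res : ℂ → ℂ := fun p => limUnder (𝓝[≠] p) fun z => (z - p) * f z with hres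
  have hZ : ∀ ρ ∈ zerosBelow M, ρ ∈ nontrivialZeros := fun ρ hρ => (mem_zerosBelow.1 hρ).1
  have h1 : ∀ j : ℕ, j < k + 1 → Tendsto (fun z => (z - (2 * j + 1)) * f z) (𝓝[≠] (2 * j + 1)) _ :=
    fun j hj => tendsto_sub_mul_cosKernel_odd (by omega) hx
  have h2 : ∀ ρ ∈ zerosBelow M, Tendsto (fun z => (z - (1 - ρ)) * f z) (𝓝[≠] (1 - ρ)) _ :=
    fun ρ hρ => tendsto_sub_mul_cosKernel_one_sub hr hx (hZ ρ hρ) (hsimple ρ (hZ ρ hρ))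
  have h3 : ∀ ρ ∈ zerosBelow M, Tendsto (fun z => (z - (((2 * k + 1 : ℕ) : ℂ) + 1 - ρ)) * f z)
      (𝓝[≠] (((2 * k + 1 : ℕ) : ℂ) + 1 - ρ)) _ :=
    fun ρ hρ => tendsto_sub_mul_cosKernel_add_one_sub hr hx (hZ ρ hρ) (hsimple ρ (hZ ρ hρ))
  have hpres : ∀ p ∈ cosKernelPoles k M,
      Tendsto (fun z => (z - p) * f z) (𝓝[≠] p) (𝓝 (res p)) := by
    intro p hp
    rcases mem_cosKernelPoles.1 hp with ⟨j, hj, rfl⟩ | ⟨ρ, hρ, rfl⟩ | ⟨ρ, hρ, rfl⟩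
    · exact tendsto_nhds_limUnder ⟨_, h1 j hj⟩
    · exact tendsto_nhds_limUnder ⟨_, h2 ρ hρ⟩
    · exact tendsto_nhds_limUnder ⟨_, h3 ρ hρ⟩
  -- Adjoining poles to the non-vanishing set keeps it open because the zeros of the denominator are
  -- isolated.
  have hU : IsOpen ({s | cosKernelDenom (2 * k + 1) s ≠ 0} ∪ (cosKernelPoles k M : Set ℂ)) := by
    rw [isOpen_iff_mem_nhds]
    intro s hs
    have h := eventually_cosKernelDenom_ne_zero (2 * k + 1) s
    rw [eventually_nhdsWithin_iff] at h
    filter_upwards [h] with z hz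
    by_cases hzs : z = s
    · rwa [hzs]
    · exact Or.inl (hz hzs)
  have hmain := rectIntegral_eq_sum_residues (a := -1 / 2) (b := 2 * k + 5 / 2) (c := -M) (d := M)
    (by linarith) (by linarith) hU (fun s hs => ?_) (cosKernelPoles k M) f res
    (fun p hp => mem_Ioo_of_mem_cosKernelPoles hM hne hp) (fun s hs => ?_) hpres
  · rw [hmain]
    congr 1
    unfold cosKernelPoles
    -- Real parts separate the three families: 1 - ρ in (0, 1), the odd integers in [1, 2k+1], and r
    -- + 1 - ρ in (2k+1, 2k+2).
    rw [Finset.sum_union, Finset.sum_union, Finset.sum_image, Finset.sum_image, Finset.sum_image]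
    · congr 1
      · exact Finset.sum_congr rfl fun j hj => (h1 j (Finset.mem_range.1 hj)).limUnder_eq
      · rw [← Finset.sum_add_distrib]
        refine Finset.sum_congr rfl fun ρ hρ => ?_
        rw [← zeroTerm_residue hx]
        exact congrArg₂ (· + ·) (h2 ρ hρ).limUnder_eq (h3 ρ hρ).limUnder_eq
    · intro a _ b _ hab; exact sub_right_injective hab
    · intro a _ b _ hab; exact sub_right_injective hab
    · intro a _ b _ hab
      have : (a : ℂ) = b := by linear_combination hab / 2
      exact_mod_cast this
    · rw [Finset.disjoint_left]
      intro p hp1 hp2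
      obtain ⟨ρ, hρ, rfl⟩ := Finset.mem_image.1 hp1
      obtain ⟨ρ', hρ', he⟩ := Finset.mem_image.1 hp2
      have e := congrArg Complex.re he
      have a1 := (hZ ρ hρ).2
      have a2 := (hZ ρ' hρ').2
      simp at e
      linarith
    · rw [Finset.disjoint_left]
      intro p hp1 hp2
      obtain ⟨j, hj, rfl⟩ := Finset.mem_image.1 hp1
      have hj1 := Finset.mem_range.1 hj
      have hj0 : (0 : ℝ) ≤ j := Nat.cast_nonneg j
      rcases Finset.mem_union.1 hp2 with h | h
      · obtain ⟨ρ, hρ, he⟩ := Finset.mem_image.1 h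
        have e := congrArg Complex.re he
        have a1 := (hZ ρ hρ).2
        simp at e
        linarith
      · obtain ⟨ρ, hρ, he⟩ := Finset.mem_image.1 h
        have e := congrArg Complex.re he
        have a1 := (hZ ρ hρ).2
        simp at e
        have hjk : (j : ℝ) ≤ k := by exact_mod_cast Nat.lt_succ_iff.1 hj1
        linarith
  · rw [Complex.mem_reProdIm] at hs
    by_cases h0 : cosKernelDenom (2 * k + 1) s = 0
    · exact Or.inr (mem_cosKernelPoles_of_denom_eq_zero (by linarith [hs.1.1]) hs.1.2
        (abs_le.2 hs.2) h0)
    · exact Or.inl h0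
  · exact (differentiableAt_cosKernel _ hx (hs.1.resolve_right hs.2)).differentiableWithinAt

/-! ### Decay on the horizontal edges and the limit of the contour integrals. -/

theorem exp_abs_im_sub_le_norm_cos (z : ℂ) :
    (Real.exp |z.im| - Real.exp (-|z.im|)) / 2 ≤ ‖Complex.cos z‖ := by
  have h1 : ‖Complex.exp (z * Complex.I)‖ = Real.exp (-z.im) := by
    rw [Complex.norm_exp]; simp
  have h2 : ‖Complex.exp (-z * Complex.I)‖ = Real.exp z.im := by
    rw [Complex.norm_exp]; simp
  rw [Complex.cos, norm_div, Complex.norm_two]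
  refine div_le_div_of_nonneg_right ?_ (by norm_num)
  rcases abs_cases z.im with ⟨h, -⟩ | ⟨h, -⟩
  · have h3 := norm_sub_norm_le (Complex.exp (-z * Complex.I)) (-Complex.exp (z * Complex.I))
    rw [norm_neg, sub_neg_eq_add, add_comm (Complex.exp (-z * Complex.I)), h1, h2] at h3
    rwa [h]
  · have h3 := norm_sub_norm_le (Complex.exp (z * Complex.I)) (-Complex.exp (-z * Complex.I))
    rw [norm_neg, sub_neg_eq_add, h1, h2] at h3
    rwa [h, neg_neg]

theorem exp_div_four_le_norm_cos {s : ℂ} {M : ℝ} (hM : 1 ≤ M) (hs : |s.im| = M) :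
    Real.exp M / 4 ≤ ‖Complex.cos (Real.pi * s / 2)‖ := by
  have h := exp_abs_im_sub_le_norm_cos (Real.pi * s / 2)
  have him : |(Real.pi * s / 2 : ℂ).im| = Real.pi * M / 2 := by
    have : (Real.pi * s / 2 : ℂ).im = Real.pi * s.im / 2 := by
      rw [Complex.div_ofNat_im, Complex.im_ofReal_mul]
    rw [this, abs_div, abs_mul, hs, abs_of_pos Real.pi_pos, abs_two]
  rw [him] at h
  have h1 : Real.exp M ≤ Real.exp (Real.pi * M / 2) :=
    Real.exp_le_exp.2 (by nlinarith [Real.pi_gt_three])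
  have h2 : Real.exp (-(Real.pi * M / 2)) ≤ 1 :=
    Real.exp_le_one_iff.2 (by nlinarith [Real.pi_gt_three])
  have h3 := Real.add_one_le_exp M
  linarith

theorem rpow_le_add_rpow {q a b σ : ℝ} (hq : 0 < q) (ha : a ≤ σ) (hb : σ ≤ b) :
    q ^ σ ≤ q ^ a + q ^ b := by
  rcases le_total 1 q with h | h
  · exact (Real.rpow_le_rpow_of_exponent_le h hb).trans
      (le_add_of_nonneg_left (Real.rpow_nonneg hq.le _))
  · exact (Real.rpow_le_rpow_of_exponent_ge hq h ha).trans
      (le_add_of_nonneg_right (Real.rpow_nonneg hq.le _))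

/-- With ε = 1/4 each reciprocal zeta factor is at most e^{M/4}, against a cosine of size at least
e^M/4. The constant A is chosen before k and x, so one bracketing serves all r, α and β. -/
theorem exists_norm_cosKernel_le (hsimple : ∀ ρ ∈ nontrivialZeros, deriv riemannZeta ρ ≠ 0) :
    ∃ A : ℝ, 0 < A ∧ ∀ (k : ℕ) {x : ℝ}, 0 < x → ∃ C : ℝ, ∀ᶠ M in atTop, Uncovered A M →
      ∀ s : ℂ, |s.im| = M → -1 / 2 ≤ s.re → s.re ≤ 2 * k + 5 / 2 →
        ‖cosKernel (2 * k + 1) x s‖ ≤ C * Real.exp (-(M / 2)) := by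
  obtain ⟨A, hA, hζ⟩ := exists_le_norm_riemannZeta hsimple (ε := 1 / 4) (by norm_num)
  refine ⟨A, hA, fun k x hx => ?_⟩
  set q : ℝ := 2 * Real.pi / x with hq
  have hq0 : 0 < q := div_pos (by positivity) hx
  set C : ℝ := q ^ (-1 / 2 : ℝ) + q ^ (2 * k + 5 / 2 : ℝ) with hC
  have hC0 : 0 ≤ C := by positivity
  refine ⟨2 * C, ?_⟩
  filter_upwards [hζ, eventually_ge_atTop 1] with M hM hM1 hunc s him h1 h2
  have hrecip : ∀ w : ℂ, |w.im| = M → -(1 / 2) ≤ w.re → ‖zetaRecip w‖ ≤ Real.exp (M / 4) := by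
    intro w hw1 hw2
    have hne : w ≠ 1 := by rintro rfl; simp at hw1; linarith
    rw [zetaRecip_of_ne_one hne, norm_inv]
    have h := hM hunc w hw1 hw2
    calc _ ≤ (Real.exp (-(1 / 4 * M)))⁻¹ := inv_anti₀ (Real.exp_pos _) h
      _ = _ := by rw [← Real.exp_neg]; ring_nf
  have hz1 := hrecip s him (by linarith)
  have hz2 := hrecip (((2 * k + 1 : ℕ) : ℂ) + 1 - s) (by simpa using him) (by simp; linarith)
  have hcos := exp_div_four_le_norm_cos hM1 him
  have hpow : ‖((q : ℝ) : ℂ) ^ s‖ ≤ C := by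
    rw [Complex.norm_cpow_eq_rpow_re_of_pos hq0]
    exact rpow_le_add_rpow hq0 h1 h2
  rw [cosKernel, norm_div, norm_mul, norm_mul, norm_mul, Complex.norm_two]
  calc _ ≤ C * (Real.exp (M / 4) * Real.exp (M / 4)) / (2 * (Real.exp M / 4)) := by gcongr
    _ = 2 * C * Real.exp (-(M / 2)) := by
      rw [← Real.exp_add, div_eq_iff (by positivity)]
      have : Real.exp (M / 4 + M / 4) = Real.exp (-(M / 2)) * Real.exp M := by
        rw [← Real.exp_add]; ring_nf
      rw [this]; ring

/-- The value of the Mellin–Barnes integral, the sum of the series over `σ_r⁻¹`. -/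
noncomputable def sigmaInvSum (r : ℕ) (x : ℝ) : ℂ :=
  1 / (2 * Real.pi) * ∫ t : ℝ, mellinKernel r x (((-1 / 2 : ℝ) : ℂ) + t * Complex.I)

theorem cosKernel_neg_half (r : ℕ) {x : ℝ} (hx : 0 < x) (t : ℝ) :
    cosKernel r x (((-1 / 2 : ℝ) : ℂ) + t * Complex.I)
      = mellinKernel r x (((-1 / 2 : ℝ) : ℂ) + t * Complex.I) := by
  refine cosKernel_eq_mellinKernel r hx (fun n hn => ?_) fun h => ?_
  · have := congrArg Complex.re hn
    simp at this
    have h2 : ((2 * n : ℕ) : ℝ) = (1 : ℕ) := by push_cast; linarith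
    have := Nat.cast_injective h2
    omega
  · have := congrArg Complex.re h
    norm_num at this

theorem cosKernel_right_edge (k : ℕ) {α β : ℝ} (hα : 0 < α) (hβ : 0 < β)
    (hαβ : α * β = 4 * Real.pi ^ 2) (t : ℝ) :
    cosKernel (2 * k + 1) α (((2 * k + 5 / 2 : ℝ) : ℂ) + t * Complex.I)
      = (-1) ^ (k + 1) * ((β : ℂ) / (2 * Real.pi)) ^ (2 * k + 2)
        * mellinKernel (2 * k + 1) β (((-1 / 2 : ℝ) : ℂ) + (-t : ℝ) * Complex.I) := by
  rw [← cosKernel_neg_half _ hβ, ← cosKernel_one_add_sub k hα hβ hαβ]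
  congr 1
  push_cast
  ring

/-- The horizontal edges vanish by `hC`. The left edge converges to the integral for α, and the
right edge, the reflection of the line Re s = -1/2, to a multiple of the integral for β. -/
theorem tendsto_rectIntegral_cosKernel {A : ℝ} (k : ℕ) {α β : ℝ} (hα : 0 < α) (hβ : 0 < β)
    (hαβ : α * β = 4 * Real.pi ^ 2) {C : ℝ}
    (hC : ∀ᶠ M in atTop, Uncovered A M → ∀ s : ℂ, |s.im| = M → -1 / 2 ≤ s.re →
      s.re ≤ 2 * k + 5 / 2 → ‖cosKernel (2 * k + 1) α s‖ ≤ C * Real.exp (-(M / 2)))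
    {M : ℝ → ℝ} (hM : Tendsto M atTop atTop) (hunc : ∀ᶠ T in atTop, Uncovered A (M T)) :
    Tendsto (fun T => rectIntegral (cosKernel (2 * k + 1) α) (-1 / 2) (2 * k + 5 / 2)
        (-M T) (M T)) atTop
      (𝓝 (2 * Real.pi * Complex.I * ((-1) ^ (k + 1) * ((β : ℂ) / (2 * Real.pi)) ^ (2 * k + 2)
        * sigmaInvSum (2 * k + 1) β - sigmaInvSum (2 * k + 1) α))) := by
  have hk : (0 : ℝ) ≤ k := Nat.cast_nonneg k
  have hπ : (Real.pi : ℂ) ≠ 0 := by exact_mod_cast Real.pi_ne_zero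
  have h2π : 2 * (Real.pi : ℂ) ≠ 0 := mul_ne_zero two_ne_zero hπ
  have hhor : ∀ ε : ℝ, |ε| = 1 → Tendsto (fun T => ∫ σ in (-1 / 2 : ℝ)..(2 * k + 5 / 2),
      cosKernel (2 * k + 1) α (σ + (ε * M T : ℝ) * Complex.I)) atTop (𝓝 0) := by
    intro ε hε
    refine squeeze_zero_norm' (a := fun T => C * Real.exp (-(M T / 2))
      * |(2 * k + 5 / 2 : ℝ) - (-1 / 2)|) ?_ ?_
    · filter_upwards [hM.eventually hC, hunc, hM.eventually_ge_atTop 0] with T h1 h2 h3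
      refine intervalIntegral.norm_integral_le_of_norm_le_const fun σ hσ => ?_
      rw [Set.uIoc_of_le (by linarith)] at hσ
      refine h1 h2 _ ?_ (by simp; linarith [hσ.1]) (by simpa using hσ.2)
      simp [abs_mul, hε, abs_of_nonneg h3]
    · have h : Tendsto (fun T => Real.exp (-(M T / 2))) atTop (𝓝 0) :=
        Real.tendsto_exp_neg_atTop_nhds_zero.comp (hM.atTop_div_const two_pos)
      simpa using (h.const_mul C).mul_const |(2 * k + 5 / 2 : ℝ) - (-1 / 2)|
  have hbot := hhor (-1) (by simp)
  have htop := hhor 1 (by simp)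
  have hMneg : Tendsto (fun T => -M T) atTop atBot := tendsto_neg_atTop_atBot.comp hM
  have hleft : Tendsto (fun T => ∫ t in (-M T)..(M T),
      cosKernel (2 * k + 1) α (((-1 / 2 : ℝ) : ℂ) + t * Complex.I)) atTop
      (𝓝 (2 * Real.pi * sigmaInvSum (2 * k + 1) α)) := by
    simp only [cosKernel_neg_half _ hα]
    have h := MeasureTheory.intervalIntegral_tendsto_integral
      (integrable_mellinKernel (2 * k + 1) hα) hMneg hM
    have hval : 2 * Real.pi * sigmaInvSum (2 * k + 1) α
        = ∫ t : ℝ, mellinKernel (2 * k + 1) α (((-1 / 2 : ℝ) : ℂ) + t * Complex.I) := by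
      rw [sigmaInvSum, ← mul_assoc, mul_one_div_cancel h2π, one_mul]
    rwa [hval]
  have hright : Tendsto (fun T => ∫ t in (-M T)..(M T),
      cosKernel (2 * k + 1) α (((2 * k + 5 / 2 : ℝ) : ℂ) + t * Complex.I)) atTop
      (𝓝 (2 * Real.pi * ((-1) ^ (k + 1) * ((β : ℂ) / (2 * Real.pi)) ^ (2 * k + 2)
        * sigmaInvSum (2 * k + 1) β))) := by
    simp only [cosKernel_right_edge k hα hβ hαβ]
    have h := MeasureTheory.intervalIntegral_tendsto_integral
      (((integrable_mellinKernel (2 * k + 1) hβ).comp_neg).const_mul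
        ((-1) ^ (k + 1) * ((β : ℂ) / (2 * Real.pi)) ^ (2 * k + 2))) hMneg hM
    rw [MeasureTheory.integral_const_mul, MeasureTheory.integral_neg_eq_self
      (fun t : ℝ => mellinKernel (2 * k + 1) β (((-1 / 2 : ℝ) : ℂ) + t * Complex.I))] at h
    have hval : 2 * Real.pi * sigmaInvSum (2 * k + 1) β
        = ∫ t : ℝ, mellinKernel (2 * k + 1) β (((-1 / 2 : ℝ) : ℂ) + t * Complex.I) := by
      rw [sigmaInvSum, ← mul_assoc, mul_one_div_cancel h2π, one_mul]
    rwa [mul_left_comm, hval]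
  have h := ((hbot.sub htop).add (hright.const_mul Complex.I)).sub (hleft.const_mul Complex.I)
  refine Tendsto.congr (fun T => ?_) (h.trans_eq ?_)
  · simp only [rectIntegral, neg_one_mul, one_mul]
  · congr 1; ring

/-! ### The bracketed sum over zeros and the final identity. -/

theorem bracketedPartialSum_eq {A T M : ℝ} (hunc : ∀ ρ ∈ nontrivialZeros, |ρ.im| ≠ M)
    (h : zerosInBracketsBelow A T = {ρ | ρ ∈ nontrivialZeros ∧ |ρ.im| < M}) (f : ℂ → ℂ) :
    bracketedPartialSum A f T = ∑ ρ ∈ zerosBelow M, f ρ := by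
  unfold bracketedPartialSum
  congr 1
  ext ρ
  rw [Set.Finite.mem_toFinset, h, mem_zerosBelow]
  exact ⟨fun h => ⟨h.1, h.2.le⟩, fun h => ⟨h.1, lt_of_le_of_ne h.2 (hunc ρ h.1)⟩⟩

theorem Uncovered.abs_im_ne {A M : ℝ} (h : Uncovered A M) {ρ : ℂ} (hρ : ρ ∈ nontrivialZeros) :
    |ρ.im| ≠ M := by
  intro he
  have h1 := h ρ hρ
  rw [he, sub_self, abs_zero] at h1
  exact absurd h1 (not_le.2 (Real.exp_pos _))

/-- The contribution of the poles at the odd integers. -/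
theorem sum_odd_residues {k : ℕ} {α β : ℝ} (hα : 0 < α) (hαβ : α * β = 4 * Real.pi ^ 2) :
    (α : ℂ) ^ (k + 1) * ∑ j ∈ Finset.range (k + 1), -((-1) ^ j / Real.pi
        * ((2 * Real.pi / α : ℝ) : ℂ) ^ (2 * j + 1)
        * (zetaRecip (2 * j + 1) * zetaRecip ((2 * k + 1 : ℕ) - 2 * j)))
      = -(2 * (α : ℂ) ^ k * ∑ m ∈ Finset.Icc 1 k,
          (-1 : ℂ) ^ m * (zetaRecip (((2 * k + 1 : ℕ) : ℂ) - 2 * m) * zetaRecip (2 * m + 1)) *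
            ((β : ℂ) / (2 * Real.pi)) ^ (2 * m)) := by
  have hπ : (Real.pi : ℂ) ≠ 0 := by exact_mod_cast Real.pi_ne_zero
  have hα' : (α : ℂ) ≠ 0 := by exact_mod_cast hα.ne'
  have h1 : ((2 * Real.pi / α : ℝ) : ℂ) = (β : ℂ) / (2 * Real.pi) := by
    rw [show 2 * Real.pi / α = β / (2 * Real.pi) by
      rw [div_eq_div_iff hα.ne' (by positivity)]; linarith]
    push_cast
    rfl
  have h2 : (α : ℂ) * ((β : ℂ) / (2 * Real.pi)) = 2 * Real.pi := by
    rw [← h1]; push_cast; field_simp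
  rw [← Finset.sum_subset (s₁ := Finset.Icc 1 k), Finset.mul_sum, Finset.mul_sum,
    ← Finset.sum_neg_distrib]
  · refine Finset.sum_congr rfl fun j _ => ?_
    rw [h1]
    have h3 : (α : ℂ) ^ (k + 1) * ((β : ℂ) / (2 * Real.pi)) ^ (2 * j + 1)
        = (α : ℂ) ^ k * ((β : ℂ) / (2 * Real.pi)) ^ (2 * j) * (2 * Real.pi) := by
      calc _ = (α : ℂ) ^ k * ((β : ℂ) / (2 * Real.pi)) ^ (2 * j)
            * ((α : ℂ) * ((β : ℂ) / (2 * Real.pi))) := by ring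
        _ = _ := by rw [h2]
    have h4 : (2 * (Real.pi : ℂ)) / Real.pi = 2 := by field_simp
    calc _ = -((α : ℂ) ^ (k + 1) * ((β : ℂ) / (2 * Real.pi)) ^ (2 * j + 1) * ((-1) ^ j / Real.pi)
          * (zetaRecip (2 * j + 1) * zetaRecip ((2 * k + 1 : ℕ) - 2 * j))) := by ring
      _ = -((2 * (Real.pi : ℂ)) / Real.pi * ((α : ℂ) ^ k * ((β : ℂ) / (2 * Real.pi)) ^ (2 * j))
          * (-1) ^ j * (zetaRecip (2 * j + 1) * zetaRecip ((2 * k + 1 : ℕ) - 2 * j))) := by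
        rw [h3]; ring
      _ = _ := by rw [h4]; ring
  · intro j hj
    rw [Finset.mem_range]; have := (Finset.mem_Icc.1 hj).2; omega
  -- The only index dropped is j = 0, whose term contains 1/ζ(1) = 0.
  · intro j hj hj'
    obtain rfl : j = 0 := by
      by_contra h
      exact hj' (Finset.mem_Icc.2 ⟨by omega, by have := Finset.mem_range.1 hj; omega⟩)
    simp [zetaRecip]

/-- The residue theorem is solved for the sum over zeros. The contour integrals converge and the
odd-integer residues do not depend on the height, so the bracketed partial sums converge too. -/
theorem hasBracketedSum_zeroTerm (hsimple : ∀ ρ ∈ nontrivialZeros, deriv riemannZeta ρ ≠ 0)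
    {A : ℝ} (hA : 0 < A) (k : ℕ) {α β : ℝ} (hα : 0 < α) (hβ : 0 < β)
    (hαβ : α * β = 4 * Real.pi ^ 2) {C : ℝ}
    (hC : ∀ᶠ M in atTop, Uncovered A M → ∀ s : ℂ, |s.im| = M → -1 / 2 ≤ s.re →
      s.re ≤ 2 * k + 5 / 2 → ‖cosKernel (2 * k + 1) α s‖ ≤ C * Real.exp (-(M / 2))) :
    HasBracketedSum A (zeroTerm (2 * k + 1) α) ((α : ℂ) ^ (2 * k + 1 + 1) *
      (∑ j ∈ Finset.range (k + 1), -((-1) ^ j / Real.pi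
          * ((2 * Real.pi / α : ℝ) : ℂ) ^ (2 * j + 1)
          * (zetaRecip (2 * j + 1) * zetaRecip ((2 * k + 1 : ℕ) - 2 * j)))
        - ((-1) ^ (k + 1) * ((β : ℂ) / (2 * Real.pi)) ^ (2 * k + 2)
          * sigmaInvSum (2 * k + 1) β - sigmaInvSum (2 * k + 1) α))) := by
  refine ⟨finite_bracket hA, ?_⟩
  have hπ : (Real.pi : ℂ) ≠ 0 := by exact_mod_cast Real.pi_ne_zero
  have hα' : (α : ℂ) ≠ 0 := by exact_mod_cast hα.ne'
  have h2πI : 2 * (Real.pi : ℂ) * Complex.I ≠ 0 := by simp [hπ]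
  -- M(T) ≥ T - 1 is the uncovered height below which the zeros are exactly those in complete
  -- brackets below T; the contour is taken at height M(T) rather than T.
  obtain ⟨M, hM⟩ := (eventually_zerosInBracketsBelow_eq hA).choice
  have hMtop : Tendsto M atTop atTop :=
    tendsto_atTop_mono' atTop (hM.mono fun T h => h.1)
      (tendsto_atTop_add_const_right atTop (-1) tendsto_id)
  have hlim := tendsto_rectIntegral_cosKernel k hα hβ hαβ hC hMtop (hM.mono fun T h => h.2.1)
  have hlim2 := ((hlim.div_const (2 * Real.pi * Complex.I)).const_sub
    (∑ j ∈ Finset.range (k + 1), -((-1) ^ j / Real.pi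
          * ((2 * Real.pi / α : ℝ) : ℂ) ^ (2 * j + 1)
          * (zetaRecip (2 * j + 1) * zetaRecip ((2 * k + 1 : ℕ) - 2 * j))))).const_mul
    ((α : ℂ) ^ (2 * k + 1 + 1))
  rw [mul_div_cancel_left₀ _ h2πI] at hlim2
  refine hlim2.congr' ?_
  filter_upwards [hM, hMtop.eventually_gt_atTop 0] with T hT hT0
  have hne : ∀ ρ ∈ nontrivialZeros, |ρ.im| ≠ M T := fun ρ hρ => hT.2.1.abs_im_ne hρ
  rw [bracketedPartialSum_eq hne hT.2.2, rectIntegral_cosKernel hsimple k hα hT0 hne,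
    mul_div_cancel_left₀ _ h2πI, sub_add_cancel_left, Finset.sum_neg_distrib, neg_neg,
    ← Finset.sum_div, mul_div_cancel₀ _ (pow_ne_zero _ hα')]

theorem mainTheorem11
    (hsimple : ∀ ρ ∈ nontrivialZeros, deriv riemannZeta ρ ≠ 0) :
    ∃ A₀ : ℝ, 0 < A₀ ∧
      ∀ (r : ℕ), Odd r → ∀ (α β : ℝ), 0 < α → 0 < β → α * β = 4 * Real.pi ^ 2 →
        ∃ Sα Sβ Z : ℂ,
          HasSigmaInvSum r α Sα ∧ HasSigmaInvSum r β Sβ ∧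
          HasBracketedSum A₀ (zeroTerm r α) Z ∧
          (α : ℂ) ^ ((r + 1) / 2) * Sα - (-(β : ℂ)) ^ ((r + 1) / 2) * Sβ =
            2 * (α : ℂ) ^ ((r - 1) / 2) *
                ∑ m ∈ Finset.Icc 1 (r / 2),
                  (-1 : ℂ) ^ m * (zetaRecip ((r : ℂ) - 2 * m) * zetaRecip (2 * m + 1)) *
                    ((β : ℂ) / (2 * Real.pi)) ^ (2 * m)
              + ((α : ℂ) ^ ((r + 1) / 2))⁻¹ * Z := by
  obtain ⟨A, hA, hb⟩ := exists_norm_cosKernel_le hsimple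
  refine ⟨A, hA, ?_⟩
  rintro r ⟨k, rfl⟩ α β hα hβ hαβ
  obtain ⟨C, hC⟩ := hb k hα
  have hr : 2 * k + 1 ≠ 0 := by omega
  refine ⟨sigmaInvSum (2 * k + 1) α, sigmaInvSum (2 * k + 1) β, _,
    hasSigmaInvSum_integral hr hα, hasSigmaInvSum_integral hr hβ,
    hasBracketedSum_zeroTerm hsimple hA k hα hβ hαβ hC, ?_⟩
  have hα' : (α : ℂ) ≠ 0 := by exact_mod_cast hα.ne'
  have hπ : (Real.pi : ℂ) ≠ 0 := by exact_mod_cast Real.pi_ne_zero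
  have e1 : (2 * k + 1 + 1) / 2 = k + 1 := by omega
  have e2 : (2 * k + 1 - 1) / 2 = k := by omega
  have e3 : (2 * k + 1) / 2 = k := by omega
  rw [e1, e2, e3]
  have hodd := sum_odd_residues (k := k) hα hαβ
  have hpow : ((α : ℂ) ^ (k + 1))⁻¹ * (α : ℂ) ^ (2 * k + 1 + 1) = (α : ℂ) ^ (k + 1) := by
    rw [show 2 * k + 1 + 1 = (k + 1) + (k + 1) by ring, pow_add _ (k + 1) (k + 1),
      inv_mul_cancel_left₀ (pow_ne_zero _ hα')]
  -- Since (αβ)/(4π²) = 1, the k+1 powers of α combine with (β/2π)^{2k+2} to give β^{k+1}, and the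
  -- reflection sign (-1)^{k+1} makes it (-β)^{k+1}.
  have hab : (α : ℂ) * ((β : ℂ) / (2 * Real.pi)) ^ 2 = β := by
    have h : (α : ℂ) * β = 4 * Real.pi ^ 2 := by exact_mod_cast hαβ
    rw [div_pow, mul_div_assoc', div_eq_iff (by simp [hπ])]
    linear_combination (β : ℂ) * h
  have hβpow : (α : ℂ) ^ (k + 1) * ((-1) ^ (k + 1) * ((β : ℂ) / (2 * Real.pi)) ^ (2 * k + 2))
      = (-(β : ℂ)) ^ (k + 1) := by
    rw [show 2 * k + 2 = 2 * (k + 1) by ring, pow_mul, ← mul_pow, ← mul_pow]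
    congr 1
    linear_combination -hab
  rw [← mul_assoc, hpow, mul_sub, hodd, mul_sub, ← mul_assoc ((α : ℂ) ^ (k + 1)), hβpow]
  ring
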